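/- **Setting.** Let $n=p+m$ with $p,m\ge 0$, let $X\subseteq\mathbb R^n$ be open (a manifold with global coordinates $x_1,\dots,x_n$), and let $F:\mathrm TX=X\times\mathbb R^n\to\mathbb R^{p}$, $F=F(x,\dot x)$, be real analytic. Let $\mathfrak X=X\times\mathbb R^n\times\mathbb R^n\times\cdots$, with the product topology, be the space of jets $\bar x=(x,\dot x,\ddot x,\dots)$. A function on a subset of $\mathfrak X$ is called analytic if it depends only on finitely many of the coordinates $x_i^{(k)}$ and is (the restriction of a function) real analytic in these. Let $\tau=\sum_{i,k}x_i^{(k+1)}\,\partial/\partial x_i^{(k)}$ be the Cartan field, $\frac{d}{dt}=L_\tau$, and $$\mathfrak X_0=\{\bar x\in\mathfrak X:\ L_\tau^kF(\bar x)=0\ \text{ for all }k\ge 0\}.$$ Fix $\bar x_0\in\mathfrak X_0$ such that $\partial F/\partial\dot x$ has rank $p=n-m$ at $(x_0,\dot x_0)$. *Flatness.* Define $\mathbb R^m_\infty=\mathbb R^m\times\mathbb R^m\times\cdots$ and its Cartan field $\tau_m$ in the same way. The system $F(x,\dot x)=0$ is flat at $(\bar x_0,\bar y_0)$, $\bar y_0\in\mathbb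 R^m_\infty$, if there are neighbourhoods $\mathcal X_0$ of $\bar x_0$ in $\mathfrak X_0$ and $\mathcal Y_0$ of $\bar y_0$ in $\mathbb R^m_\infty$ and mutually inverse bijections $\Phi:\mathcal Y_0\to\mathcal X_0$, $\Psi:\mathcal X_0\to\mathcal Y_0$ with analytic components, such that $\Phi(\bar y_0)=\bar x_0$, $\Phi_*\tau_m=\tau$ and $\Psi_*\tau=\tau_m$. *Matrices.* Let $\mathfrak K$ be the ring of germs at $\bar x_0$ (in $\mathfrak X$) of analytic functions, that is, of meromorphic functions that are smooth near $\bar x_0$, and let $\mathfrak K[\frac d{dt}]$ be the noncommutative ring of polynomials in $\frac d{dt}$ over $\mathfrak K$, with $\frac d{dt}\,a=a\,\frac d{dt}+L_\tau a$. A square matrix over $\mathfrak K[\frac d{dt}]$ is unimodular if it has an inverse over $\mathfrak K[\frac d{dt}]$. Denote by $E_{r,s}$ the $r\times s$ matrix $(I_r,0)$, $I_r$ or $\binom{I_s}{0}$, according to $r<s$, $r=s$ or $r>s$. An $r\times s$ matrix $N$ is hyper-regular if $VNW=E_{r,s}$ for some unimodular $V$, $W$; the set of all $W$ (resp. $V$)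 that occur in such decompositions is the right (resp. left) Smith set of $N$. Let $P(F)=\frac{\partial F}{\partial x}+\frac{\partial F}{\partial\dot x}\frac d{dt}$, a $p\times n$ matrix over $\mathfrak K[\frac d{dt}]$. *Forms.* $\mathfrak K[\frac d{dt}]$ acts on 1-forms (finite combinations of the $dx_i^{(k)}$ with coefficients in $\mathfrak K$) by $\frac d{dt}\omega=L_\tau\omega$, so that $\frac{d}{dt}dx_i^{(k)}=dx_i^{(k+1)}$. The $\mathfrak K[\frac d{dt}]$-ideal generated by the restrictions to $\mathfrak X_0$ of 1-forms $\omega_1,\dots,\omega_m$ is strongly closed near $\bar x_0$ if there is a unimodular $m\times m$ matrix $M$ such that $d(M\omega)=0$ on $\mathfrak X_0$ near $\bar x_0$, where $\omega=(\omega_1,\dots,\omega_m)^T$. The restriction to $\mathfrak X_0$ means that the 2-forms are evaluated at points $\bar x\in\mathfrak X_0$ on vectors annihilated by all $dL_\tau^kF(\bar x)$, $k\ge0$. **Theorem.** Assume that $P(F)$ is hyper-regular. There is $\bar y_0\in\mathbb R^m_\infty$ such that the system $F(x,\dot x)=0$ is flat at $(\bar x_0,\bar y_0)$ if and only if there exist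 $U$ in the right Smith set of $P(F)$ and $Q$ in the left Smith set of $\hat U=U\binom{0_{p,m}}{I_m}$ such that the $\mathfrak K[\frac d{dt}]$-ideal $\Omega$ generated by the restrictions to $\mathfrak X_0$ of the components $\omega_1,\dots,\omega_m$ of $\omega=(I_m,0_{m,n-m})\,Q\,dx$ is strongly closed near $\bar x_0$. -/

import Mathlib

open Filter Topology

/-! ### The ring `A[d/dt]` of linear differential operators over a differential ring `A` -/

noncomputable section

section DiffOp

variable {A : Type*} [CommRing A]

/-- `A[d/dt]` for a commutative ring `A` with a derivation `d`: formal finite sums `∑ a_k (d/dt)^k`,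
stored as the polynomial `∑ a_k X^k`. The product below is composition of operators,
`(d/dt) a = a (d/dt) + d a`, and not the product of polynomials. -/
def DiffOp (_d : Derivation ℤ A A) : Type _ := Polynomial A

namespace DiffOp

variable {d : Derivation ℤ A A}

instance : AddCommGroup (DiffOp d) := inferInstanceAs (AddCommGroup (Polynomial A))

/-- The coefficient of `(d/dt)^k` is the `k`-th coefficient of this polynomial. -/
def toPoly (P : DiffOp d) : Polynomial A := P

/-- The operator with the given coefficients. -/
def ofPoly (d : Derivation ℤ A A) (p : Polynomial A) : DiffOp d := p

/-- Left composition with `d/dt`: `(d/dt) ∑ a_k (d/dt)^k = ∑ ((d a_k) (d/dt)^k + a_k (d/dt)^(k+1))`. -/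
def compD (d : Derivation ℤ A A) (q : Polynomial A) : Polynomial A :=
  q.sum fun k a => Polynomial.monomial k (d a) + Polynomial.monomial (k + 1) a

/-- Left composition with `P = ∑ a_k (d/dt)^k`. -/
def compOp (d : Derivation ℤ A A) (p q : Polynomial A) : Polynomial A :=
  p.sum fun k a => Polynomial.C a * (compD d)^[k] q

theorem compD_add (p q : Polynomial A) : compD d (p + q) = compD d p + compD d q := by
  unfold compD
  rw [Polynomial.sum_add_index]
  · simp
  · intros; simp only [map_add]; abel

theorem compD_monomial (n : ℕ) (a : A) :
    compD d (Polynomial.monomial n a) =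
      Polynomial.monomial n (d a) + Polynomial.monomial (n + 1) a := by
  unfold compD
  rw [Polynomial.sum_monomial_index]
  simp

theorem compD_C_mul (a : A) (q : Polynomial A) :
    compD d (Polynomial.C a * q) = Polynomial.C (d a) * q + Polynomial.C a * compD d q := by
  induction q using Polynomial.induction_on' with
  | add p p' hp hp' => rw [mul_add, compD_add, hp, hp', compD_add]; ring
  | monomial n b =>
    rw [Polynomial.C_mul_monomial, compD_monomial, compD_monomial, mul_add,
      Polynomial.C_mul_monomial, Polynomial.C_mul_monomial, Polynomial.C_mul_monomial,
      Derivation.leibniz, smul_eq_mul, smul_eq_mul, map_add, mul_comm b (d a)]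
    abel

theorem compD_iterate_add (k : ℕ) (p q : Polynomial A) :
    (compD d)^[k] (p + q) = (compD d)^[k] p + (compD d)^[k] q := by
  induction k with
  | zero => rfl
  | succ k ih => simp only [Function.iterate_succ_apply', ih, compD_add]

theorem compOp_add_left (p p' q : Polynomial A) :
    compOp d (p + p') q = compOp d p q + compOp d p' q := by
  unfold compOp
  rw [Polynomial.sum_add_index]
  · simp
  · intros; simp [add_mul]

theorem compOp_add_right (p q q' : Polynomial A) :
    compOp d p (q + q') = compOp d p q + compOp d p q' := by
  unfold compOp Polynomial.sum
  simp [mul_add, Finset.sum_add_distrib, compD_iterate_add]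

theorem compOp_C_mul (a : A) (p q : Polynomial A) :
    compOp d (Polynomial.C a * p) q = Polynomial.C a * compOp d p q := by
  unfold compOp
  induction p using Polynomial.induction_on' with
  | add p p' hp hp' =>
    rw [mul_add, Polynomial.sum_add_index, Polynomial.sum_add_index, hp, hp', mul_add] <;>
      intros <;> simp [add_mul]
  | monomial n b =>
    rw [Polynomial.C_mul_monomial, Polynomial.sum_monomial_index, Polynomial.sum_monomial_index]
      <;> simp [mul_assoc]

theorem compOp_monomial (n : ℕ) (a : A) (q : Polynomial A) :
    compOp d (Polynomial.monomial n a) q = Polynomial.C a * (compD d)^[n] q := by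
  unfold compOp
  rw [Polynomial.sum_monomial_index]
  simp

theorem compOp_compD (p q : Polynomial A) :
    compOp d (compD d p) q = compD d (compOp d p q) := by
  induction p using Polynomial.induction_on' with
  | add p p' hp hp' => rw [compD_add, compOp_add_left, compOp_add_left, hp, hp', compD_add]
  | monomial n b =>
    rw [compD_monomial, compOp_add_left, compOp_monomial, compOp_monomial, compOp_monomial,
      compD_C_mul, Function.iterate_succ_apply']

theorem compOp_iterate (k : ℕ) (p q : Polynomial A) :
    compOp d ((compD d)^[k] p) q = (compD d)^[k] (compOp d p q) := by
  induction k with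
  | zero => rfl
  | succ k ih => rw [Function.iterate_succ_apply', compOp_compD, ih, Function.iterate_succ_apply']

theorem compOp_assoc (p q r : Polynomial A) :
    compOp d (compOp d p q) r = compOp d p (compOp d q r) := by
  induction p using Polynomial.induction_on' with
  | add p p' hp hp' => simp only [compOp_add_left, hp, hp']
  | monomial n b => rw [compOp_monomial, compOp_C_mul, compOp_iterate, compOp_monomial]

theorem one_compOp (q : Polynomial A) : compOp d 1 q = q := by
  rw [← Polynomial.monomial_zero_one, compOp_monomial]; simp

theorem compD_iterate_one (n : ℕ) : (compD d)^[n] (1 : Polynomial A) = Polynomial.X ^ n := by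
  induction n with
  | zero => simp
  | succ n ih =>
    rw [Function.iterate_succ_apply', ih, ← Polynomial.monomial_one_right_eq_X_pow, compD_monomial,
      Derivation.map_one_eq_zero, map_zero, zero_add, Polynomial.monomial_one_right_eq_X_pow]

theorem compOp_one (p : Polynomial A) : compOp d p 1 = p := by
  induction p using Polynomial.induction_on' with
  | add p p' hp hp' => rw [compOp_add_left, hp, hp']
  | monomial n b => rw [compOp_monomial, compD_iterate_one, Polynomial.C_mul_X_pow_eq_monomial]

instance : One (DiffOp d) := ⟨ofPoly d 1⟩

instance : Mul (DiffOp d) := ⟨fun P Q => ofPoly d (compOp d P.toPoly Q.toPoly)⟩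

instance : Ring (DiffOp d) where
  __ := (inferInstance : AddCommGroup (DiffOp d))
  one := 1
  mul := (· * ·)
  mul_assoc P Q R := compOp_assoc (d := d) P Q R
  one_mul P := one_compOp (d := d) P
  mul_one P := compOp_one (d := d) P
  left_distrib P Q R := compOp_add_right (d := d) P Q R
  right_distrib P Q R := compOp_add_left (d := d) P Q R
  zero_mul P := by
    have h := compOp_add_left (d := d) 0 0 P
    rw [add_zero] at h
    exact left_eq_add.mp h
  mul_zero P := by
    have h := compOp_add_right (d := d) P 0 0
    rw [add_zero] at h
    exact left_eq_add.mp h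

end DiffOp
end DiffOp

/-! ### Jets of infinite order and the Cartan field -/

/-- Jets of infinite order of curves in `ℝⁿ`: `x k i` is the coordinate `x_i^{(k)}`. The topology is
the product topology. -/
abbrev Jet (n : ℕ) : Type := ℕ → Fin n → ℝ

/-- The value of the trivial Cartan field `∑ x_i^{(k+1)} ∂/∂x_i^{(k)}` at the jet `x`. -/
def cartanField {n : ℕ} (x : Jet n) : Jet n := fun k => x (k + 1)

/-- The first `N` derivatives (of orders `0, …, N - 1`) of a jet. -/
def jetTrunc {n : ℕ} (N : ℕ) (x : Jet n) : Fin N → Fin n → ℝ := fun k => x k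

/-- `f` is real analytic at the jet `x`: near `x` it depends on finitely many coordinates only, and is
analytic in these. -/
def AnalyticJetAt {n : ℕ} (f : Jet n → ℝ) (x : Jet n) : Prop :=
  ∃ (N : ℕ) (g : (Fin N → Fin n → ℝ) → ℝ),
    AnalyticAt ℝ g (jetTrunc N x) ∧ f =ᶠ[𝓝 x] fun z => g (jetTrunc N z)

/-- The Lie derivative `L_τ f` of a function along the Cartan field `τ`. -/
def cartanDeriv {n : ℕ} (f : Jet n → ℝ) : Jet n → ℝ := fun x => lineDeriv ℝ f x (cartanField x)

section JetLemmas

variable {n : ℕ}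

/-- `jetTrunc` as a continuous linear map. -/
def jetTruncL (n N : ℕ) : Jet n →L[ℝ] (Fin N → Fin n → ℝ) :=
  ContinuousLinearMap.pi fun k => ContinuousLinearMap.proj (k : ℕ)

theorem jetTruncL_apply (N : ℕ) (x : Jet n) : jetTruncL n N x = jetTrunc N x := rfl

/-- Forgetting the highest derivatives of a truncated jet. -/
def truncRestrict (n : ℕ) {N N' : ℕ} (h : N ≤ N') :
    (Fin N' → Fin n → ℝ) →L[ℝ] (Fin N → Fin n → ℝ) :=
  ContinuousLinearMap.pi fun k => ContinuousLinearMap.proj (Fin.castLE h k)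

/-- The Cartan field on truncated jets. -/
def truncShift (n N : ℕ) : (Fin (N + 1) → Fin n → ℝ) →L[ℝ] (Fin N → Fin n → ℝ) :=
  ContinuousLinearMap.pi fun k => ContinuousLinearMap.proj k.succ

theorem AnalyticJetAt.raise {f : Jet n → ℝ} {x : Jet n} (h : AnalyticJetAt f x) :
    ∃ N : ℕ, ∀ N' ≥ N, ∃ g : (Fin N' → Fin n → ℝ) → ℝ,
      AnalyticAt ℝ g (jetTrunc N' x) ∧ f =ᶠ[𝓝 x] fun z => g (jetTrunc N' z) := by
  obtain ⟨N, g, hg, hf⟩ := h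
  refine ⟨N, fun N' hN' => ⟨fun w => g (truncRestrict n hN' w), ?_, hf⟩⟩
  exact AnalyticAt.comp (g := g) (f := truncRestrict n hN') hg
    ((truncRestrict n hN').analyticAt _)

theorem AnalyticJetAt.map₂ {f f' : Jet n → ℝ} {x : Jet n} (h : AnalyticJetAt f x)
    (h' : AnalyticJetAt f' x) (op : ℝ → ℝ → ℝ)
    (hop : ∀ {E : Type} [NormedAddCommGroup E] [NormedSpace ℝ E] {u v : E → ℝ} {e : E},
      AnalyticAt ℝ u e → AnalyticAt ℝ v e → AnalyticAt ℝ (fun y => op (u y) (v y)) e) :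
    AnalyticJetAt (fun z => op (f z) (f' z)) x := by
  obtain ⟨N, hN⟩ := h.raise
  obtain ⟨N', hN'⟩ := h'.raise
  obtain ⟨g, hg, hgf⟩ := hN (max N N') (le_max_left _ _)
  obtain ⟨g', hg', hgf'⟩ := hN' (max N N') (le_max_right _ _)
  refine ⟨max N N', fun w => op (g w) (g' w), hop hg hg', ?_⟩
  filter_upwards [hgf, hgf'] with z hz hz'
  rw [hz, hz']

theorem analyticJetAt_const (c : ℝ) (x : Jet n) : AnalyticJetAt (fun _ => c) x :=
  ⟨0, fun _ => c, analyticAt_const, Eventually.of_forall fun _ => rfl⟩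

theorem tendsto_line (x v : Jet n) : Tendsto (fun t : ℝ => x + t • v) (𝓝 0) (𝓝 x) := by
  have h : Continuous fun t : ℝ => x + t • v := by fun_prop
  simpa using h.tendsto 0

theorem lineDeriv_congr_of_eventuallyEq {f f' : Jet n → ℝ} {x : Jet n} (h : f =ᶠ[𝓝 x] f')
    (v : Jet n) : lineDeriv ℝ f x v = lineDeriv ℝ f' x v :=
  Filter.EventuallyEq.deriv_eq ((tendsto_line x v).eventually h)

theorem cartanDeriv_congr {f f' : Jet n → ℝ} {x : Jet n} (h : f =ᶠ[𝓝 x] f') :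
    cartanDeriv f =ᶠ[𝓝 x] cartanDeriv f' := by
  filter_upwards [h.eventuallyEq_nhds] with z hz
  exact lineDeriv_congr_of_eventuallyEq hz _

theorem AnalyticJetAt.hasLineDerivAt {f : Jet n → ℝ} {x : Jet n} {N : ℕ}
    {g : (Fin N → Fin n → ℝ) → ℝ} (hg : AnalyticAt ℝ g (jetTrunc N x))
    (hf : f =ᶠ[𝓝 x] fun z => g (jetTrunc N z)) :
    ∀ᶠ z in 𝓝 x, ∀ v, HasLineDerivAt ℝ f (fderiv ℝ g (jetTrunc N z) (jetTrunc N v)) z v := by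
  have h1 : ∀ᶠ z in 𝓝 x, AnalyticAt ℝ g (jetTrunc N z) :=
    ((jetTruncL n N).continuous.tendsto x).eventually hg.eventually_analyticAt
  filter_upwards [h1, hf.eventuallyEq_nhds] with z hz hz' v
  have hd : HasLineDerivAt ℝ g (fderiv ℝ g (jetTrunc N z) (jetTrunc N v)) (jetTrunc N z)
      (jetTrunc N v) := hz.differentiableAt.hasFDerivAt.hasLineDerivAt _
  exact HasDerivAt.congr_of_eventuallyEq (f := fun t : ℝ => g (jetTrunc N (z + t • v))) hd
    ((tendsto_line z v).eventually hz')

theorem AnalyticJetAt.eventually_lineDifferentiable {f : Jet n → ℝ} {x : Jet n}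
    (h : AnalyticJetAt f x) : ∀ᶠ z in 𝓝 x, ∀ v, LineDifferentiableAt ℝ f z v := by
  obtain ⟨N, g, hg, hf⟩ := h
  filter_upwards [AnalyticJetAt.hasLineDerivAt hg hf] with z hz v
  exact (hz v).lineDifferentiableAt

theorem AnalyticJetAt.cartanDeriv {f : Jet n → ℝ} {x : Jet n} (h : AnalyticJetAt f x) :
    AnalyticJetAt (cartanDeriv f) x := by
  obtain ⟨N, g, hg, hf⟩ := h
  refine ⟨N + 1, fun w => fderiv ℝ g (truncRestrict n N.le_succ w) (truncShift n N w), ?_, ?_⟩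
  · exact AnalyticAt.comp₂
      ((ContinuousLinearMap.id ℝ ((Fin N → Fin n → ℝ) →L[ℝ] ℝ)).analyticAt_bilinear _)
      (AnalyticAt.comp (g := fderiv ℝ g) (f := truncRestrict n N.le_succ) hg.fderiv
        ((truncRestrict n N.le_succ).analyticAt _))
      ((truncShift n N).analyticAt _)
  · filter_upwards [AnalyticJetAt.hasLineDerivAt hg hf] with z hz
    exact (hz (cartanField z)).lineDeriv

end JetLemmas

/-! ### The differential ring of analytic germs -/

/-- The ring of germs at the jet `x₀` of real analytic functions (equivalently, of meromorphic
functions that are smooth near `x₀`). -/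
def analyticGerms {n : ℕ} (x₀ : Jet n) : Subring (Germ (𝓝 x₀) ℝ) where
  carrier := {γ | ∃ f : Jet n → ℝ, AnalyticJetAt f x₀ ∧ (f : Germ (𝓝 x₀) ℝ) = γ}
  mul_mem' := by
    rintro _ _ ⟨f, hf, rfl⟩ ⟨f', hf', rfl⟩
    exact ⟨_, hf.map₂ hf' (· * ·) fun h h' => h.mul h', rfl⟩
  one_mem' := ⟨_, analyticJetAt_const 1 x₀, rfl⟩
  add_mem' := by
    rintro _ _ ⟨f, hf, rfl⟩ ⟨f', hf', rfl⟩
    exact ⟨_, hf.map₂ hf' (· + ·) fun h h' => h.add h', rfl⟩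
  zero_mem' := ⟨_, analyticJetAt_const 0 x₀, rfl⟩
  neg_mem' := by
    rintro _ ⟨f, hf, rfl⟩
    exact ⟨_, hf.map₂ hf (fun a _ => -a) fun h _ => h.neg, rfl⟩

/-- The germ at `x₀` of a function that is analytic there. -/
def analyticGerms.mk {n : ℕ} {x₀ : Jet n} (f : Jet n → ℝ) (hf : AnalyticJetAt f x₀) :
    analyticGerms x₀ := ⟨(f : Germ (𝓝 x₀) ℝ), f, hf, rfl⟩

/-- The derivation `d/dt = L_τ` on germs of analytic functions. -/
def germDeriv {n : ℕ} (x₀ : Jet n) : Derivation ℤ (analyticGerms x₀) (analyticGerms x₀) :=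
  Derivation.mk'
    (AddMonoidHom.toIntLinearMap
      { toFun := fun γ => ⟨Germ.map' (lc := 𝓝 x₀) cartanDeriv (fun _ _ h => cartanDeriv_congr h) γ.1, by
          obtain ⟨_, f, hf, rfl⟩ := γ
          exact ⟨cartanDeriv f, hf.cartanDeriv, rfl⟩⟩
        map_zero' := by
          refine Subtype.ext (Germ.coe_eq.2 (Eventually.of_forall fun z => ?_))
          simp [cartanDeriv, lineDeriv]
        map_add' := by
          rintro ⟨_, f, hf, rfl⟩ ⟨_, f', hf', rfl⟩
          refine Subtype.ext (Germ.coe_eq.2 ?_)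
          filter_upwards [hf.eventually_lineDifferentiable, hf'.eventually_lineDifferentiable]
            with z hz hz'
          exact (HasDerivAt.add (hz _).hasLineDerivAt (hz' _).hasLineDerivAt).deriv })
    (by
      rintro ⟨_, f, hf, rfl⟩ ⟨_, f', hf', rfl⟩
      refine Subtype.ext (Germ.coe_eq.2 ?_)
      filter_upwards [hf.eventually_lineDifferentiable, hf'.eventually_lineDifferentiable]
        with z hz hz'
      have h := (HasDerivAt.mul (hz (cartanField z)).hasLineDerivAt
        (hz' (cartanField z)).hasLineDerivAt).deriv
      simp only [zero_smul, add_zero] at h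
      refine h.trans ?_
      show _ = f z * lineDeriv ℝ f' z (cartanField z) + f' z * lineDeriv ℝ f z (cartanField z)
      ring)

/-- A representative of an analytic germ. -/
def germRep {n : ℕ} {x₀ : Jet n} (γ : analyticGerms x₀) : Jet n → ℝ :=
  Classical.choose γ.2

theorem germRep_spec {n : ℕ} {x₀ : Jet n} (γ : analyticGerms x₀) :
    AnalyticJetAt (germRep γ) x₀ ∧ ((germRep γ : Jet n → ℝ) : Germ (𝓝 x₀) ℝ) = γ.1 :=
  Classical.choose_spec γ.2

/-- The ring of polynomials in `d/dt = L_τ` with coefficients in the analytic germs at `x₀`. -/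
abbrev JetOp {n : ℕ} (x₀ : Jet n) : Type := DiffOp (germDeriv x₀)

/-! ### Unimodular matrices and Smith sets over a noncommutative ring -/

section Matrices

variable {R : Type*} [Ring R]

/-- The `p × q` matrix `(I_p, 0)`, `I_p`, or `(I_q ; 0)`, according to `p < q`, `p = q`, `p > q`. -/
def rectId (R : Type*) [Ring R] (p q : ℕ) : Matrix (Fin p) (Fin q) R :=
  Matrix.of fun i j => if (i : ℕ) = (j : ℕ) then 1 else 0

/-- The `(p + m) × m` matrix `(0_{p,m} ; I_m)`. -/
def lowerId (R : Type*) [Ring R] (p m : ℕ) : Matrix (Fin (p + m)) (Fin m) R :=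
  Matrix.of fun i j => if (i : ℕ) = p + (j : ℕ) then 1 else 0

/-- Right Smith set: the unimodular `U` with `V * M * U = rectId` for some unimodular `V`. -/
def rightSmith {p q : ℕ} (M : Matrix (Fin p) (Fin q) R) : Set (Matrix (Fin q) (Fin q) R) :=
  {U | IsUnit U ∧ ∃ V : Matrix (Fin p) (Fin p) R, IsUnit V ∧ V * M * U = rectId R p q}

/-- Left Smith set: the unimodular `V` with `V * M * U = rectId` for some unimodular `U`. -/
def leftSmith {p q : ℕ} (M : Matrix (Fin p) (Fin q) R) : Set (Matrix (Fin p) (Fin p) R) :=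
  {V | IsUnit V ∧ ∃ U : Matrix (Fin q) (Fin q) R, IsUnit U ∧ V * M * U = rectId R p q}

/-- `M` is hyper-regular: its Smith form is `rectId`. -/
def IsHyperRegular {p q : ℕ} (M : Matrix (Fin p) (Fin q) R) : Prop :=
  ∃ (V : Matrix (Fin p) (Fin p) R) (U : Matrix (Fin q) (Fin q) R),
    IsUnit V ∧ IsUnit U ∧ V * M * U = rectId R p q

end Matrices

/-! ### Differential forms on jets -/

/-- Germs at `x₀` of 1-forms: finite combinations `∑ a_{k,i} dx_i^{(k)}` with analytic coefficients. -/
abbrev JetForm {n : ℕ} (x₀ : Jet n) : Type := (ℕ × Fin n) →₀ analyticGerms x₀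

/-- The Lie derivative of a 1-form along the Cartan field:
`L_τ (a dx_i^{(k)}) = (d a/dt) dx_i^{(k)} + a dx_i^{(k+1)}`. -/
def lieForm {n : ℕ} {x₀ : Jet n} (ω : JetForm x₀) : JetForm x₀ :=
  ω.sum fun b a => Finsupp.single b (germDeriv x₀ a) + Finsupp.single (b.1 + 1, b.2) a

/-- The action `(∑ a_k (d/dt)^k) ω = ∑ a_k L_τ^k ω` of operators on 1-forms. -/
def opForm {n : ℕ} {x₀ : Jet n} (P : JetOp x₀) (ω : JetForm x₀) : JetForm x₀ :=
  P.toPoly.sum fun k a => a • lieForm^[k] ω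

/-- The product `M τ` of a matrix of operators and a column of 1-forms. -/
def matForm {n r s : ℕ} {x₀ : Jet n} (M : Matrix (Fin r) (Fin s) (JetOp x₀))
    (τ : Fin s → JetForm x₀) : Fin r → JetForm x₀ :=
  fun i => ∑ j, opForm (M i j) (τ j)

/-- The column `dx = (dx_1, …, dx_n)`. -/
def dxForm {n : ℕ} (x₀ : Jet n) : Fin n → JetForm x₀ := fun i => Finsupp.single (0, i) 1

/-- The value at the jet `x` (near `x₀`) and the tangent vectors `v`, `w` of the exterior derivative
`dη = ∑ d a_{k,i} ∧ dx_i^{(k)}` of `η = ∑ a_{k,i} dx_i^{(k)}`. -/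
def extDerivForm {n : ℕ} {x₀ : Jet n} (η : JetForm x₀) (x v w : Jet n) : ℝ :=
  η.sum fun b a =>
    lineDeriv ℝ (germRep a) x v * w b.1 b.2 - lineDeriv ℝ (germRep a) x w * v b.1 b.2

/-! ### Implicit control systems -/

/-- An implicit system `F(x, ẋ) = 0` of `p` analytic equations on an open set `X` of `ℝⁿ`, that is,
on a manifold with global coordinates `x_1, …, x_n`; the tangent bundle is `X × ℝⁿ`. -/
structure ImplicitSystem (n p : ℕ) where
  /-- the state space -/
  X : Set (Fin n → ℝ)
  isOpen_X : IsOpen X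
  /-- the equations, with arguments `(x, ẋ)` -/
  F : (Fin n → ℝ) × (Fin n → ℝ) → (Fin p → ℝ)
  analytic_F : AnalyticOnNhd ℝ F (X ×ˢ Set.univ)

namespace ImplicitSystem

variable {n p n' p' : ℕ}

/-- `F_i` as a function of jets. -/
def eqn (S : ImplicitSystem n p) (i : Fin p) : Jet n → ℝ := fun x => S.F (x 0, x 1) i

/-- The set of jets with `L_τ^k F = 0` for all `k`. -/
def solutionJets (S : ImplicitSystem n p) : Set (Jet n) :=
  {x | x 0 ∈ S.X ∧ ∀ (k : ℕ) (i : Fin p), cartanDeriv^[k] (S.eqn i) x = 0}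

/-- The tangent space at `x` of the set of solution jets: `d (L_τ^k F) = 0` for all `k`. -/
def solutionTangent (S : ImplicitSystem n p) (x : Jet n) : Set (Jet n) :=
  {v | ∀ (k : ℕ) (i : Fin p), lineDeriv ℝ (cartanDeriv^[k] (S.eqn i)) x v = 0}

/-- Regularity at the jet `x`: `∂F/∂ẋ` has rank `p` at `(x, ẋ)`. -/
def RegularAt (S : ImplicitSystem n p) (x : Jet n) : Prop :=
  (Matrix.of fun (i : Fin p) (j : Fin n) =>
    fderiv ℝ S.F (x 0, x 1) (0, Pi.single j 1) i).rank = p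

theorem analyticJetAt_partial (S : ImplicitSystem n p) {x₀ : Jet n} (hx₀ : x₀ 0 ∈ S.X)
    (i : Fin p) (v : (Fin n → ℝ) × (Fin n → ℝ)) :
    AnalyticJetAt (fun x => fderiv ℝ S.F (x 0, x 1) v i) x₀ := by
  refine ⟨2, fun w => fderiv ℝ S.F (w 0, w 1) v i, ?_, Eventually.of_forall fun _ => rfl⟩
  let π : (Fin 2 → Fin n → ℝ) →L[ℝ] (Fin n → ℝ) × (Fin n → ℝ) :=
    (ContinuousLinearMap.proj 0).prod (ContinuousLinearMap.proj 1)
  let ev : (((Fin n → ℝ) × (Fin n → ℝ)) →L[ℝ] (Fin p → ℝ)) →L[ℝ] ℝ :=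
    (ContinuousLinearMap.proj i).comp (ContinuousLinearMap.apply ℝ (Fin p → ℝ) v)
  have h : AnalyticAt ℝ (fderiv ℝ S.F) (π (jetTrunc 2 x₀)) :=
    (S.analytic_F _ ⟨hx₀, trivial⟩).fderiv
  exact (ev.analyticAt _).comp
    (AnalyticAt.comp (g := fderiv ℝ S.F) (f := π) h (π.analyticAt _))

/-- The matrix `P(F) = ∂F/∂x + ∂F/∂ẋ d/dt`, with coefficients taken as germs at `x₀`. -/
def polyMatrix (S : ImplicitSystem n p) (x₀ : Jet n) (hx₀ : x₀ 0 ∈ S.X) :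
    Matrix (Fin p) (Fin n) (JetOp x₀) :=
  Matrix.of fun i j => DiffOp.ofPoly (germDeriv x₀)
    (Polynomial.C (analyticGerms.mk _ (S.analyticJetAt_partial hx₀ i (Pi.single j 1, 0))) +
      Polynomial.C (analyticGerms.mk _ (S.analyticJetAt_partial hx₀ i (0, Pi.single j 1))) *
        Polynomial.X)

/-- Near `x₀`, the restriction of `dη` to the set of solution jets vanishes. -/
def IsClosedForm (S : ImplicitSystem n p) {x₀ : Jet n} (η : JetForm x₀) : Prop :=
  ∀ᶠ x in 𝓝 x₀, x ∈ S.solutionJets →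
    ∀ v ∈ S.solutionTangent x, ∀ w ∈ S.solutionTangent x, extDerivForm η x v w = 0

/-- The ideal generated by the restrictions of `τ_1, …, τ_r` to the set of solution jets is strongly
closed: `d(M τ) = 0` there for some unimodular `M`. -/
def StronglyClosed (S : ImplicitSystem n p) {x₀ : Jet n} {r : ℕ} (τ : Fin r → JetForm x₀) :
    Prop :=
  ∃ M : Matrix (Fin r) (Fin r) (JetOp x₀), IsUnit M ∧ ∀ i, S.IsClosedForm (matForm M τ i)

/-- `Φ` is an analytic map between sets of jets that relates the Cartan fields: on `𝒴`, each component
`φ_{k,i}` is the restriction of an analytic function of finitely many coordinates, and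
`L_τ φ_{k,i} = φ_{k+1,i}`. -/
def RelatesCartan (Φ : Jet n' → Jet n) (𝒴 : Set (Jet n')) : Prop :=
  ∀ (k : ℕ) (i : Fin n), ∃ (N : ℕ) (g : (Fin N → Fin n' → ℝ) → ℝ), ∀ y ∈ 𝒴,
    AnalyticAt ℝ g (jetTrunc N y) ∧ Φ y k i = g (jetTrunc N y) ∧
      Φ y (k + 1) i = cartanDeriv (fun z => g (jetTrunc N z)) y

/-- Lie-Bäcklund equivalence of two systems at a pair of solution jets, in the analytic category:
mutually inverse maps `Φ`, `Ψ` between neighbourhoods of `y₀` and `x₀` in the sets of solution jets. -/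
def LBEquivAt (S : ImplicitSystem n p) (T : ImplicitSystem n' p') (x₀ : Jet n) (y₀ : Jet n') :
    Prop :=
  x₀ ∈ S.solutionJets ∧ y₀ ∈ T.solutionJets ∧
    ∃ (𝒳 : Set (Jet n)) (𝒴 : Set (Jet n')) (Φ : Jet n' → Jet n) (Ψ : Jet n → Jet n'),
      (∃ O, IsOpen O ∧ x₀ ∈ O ∧ 𝒳 = O ∩ S.solutionJets) ∧
      (∃ O, IsOpen O ∧ y₀ ∈ O ∧ 𝒴 = O ∩ T.solutionJets) ∧
      Set.MapsTo Φ 𝒴 𝒳 ∧ Set.MapsTo Ψ 𝒳 𝒴 ∧ Set.InvOn Ψ Φ 𝒴 𝒳 ∧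
      Φ y₀ = x₀ ∧ Ψ x₀ = y₀ ∧ RelatesCartan Φ 𝒴 ∧ RelatesCartan Ψ 𝒳

/-- The trivial system `0 = 0` of dimension `m`. -/
def trivialSystem (m : ℕ) : ImplicitSystem m 0 where
  X := Set.univ
  isOpen_X := isOpen_univ
  F := 0
  analytic_F := fun _ _ => analyticAt_const

/-- Flatness at `(x₀, y₀)`: equivalence with the trivial system of dimension `m`. -/
def FlatAt {m : ℕ} (S : ImplicitSystem n p) (x₀ : Jet n) (y₀ : Jet m) : Prop :=
  S.LBEquivAt (trivialSystem m) x₀ y₀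

end ImplicitSystem

end

-- The argument rests on a retraction onto the solution set and on a splitting of the matrix P =
-- P(F).
--
-- Retraction. By the rank condition ẋ can be corrected analytically so that F = 0. For k ≥ 1, L_τ^k
-- F is affine in the derivative of order k + 1 with linear part ∂F/∂ẋ, so the higher derivatives
-- can be corrected one after another. This gives an analytic map ρ of a neighbourhood of x₀ into
-- the solution set, which fixes the solutions and whose derivative is the identity on their tangent
-- spaces (`exists_isRetraction`). Composition with ρ turns functions and forms on the solution set
-- into functions and forms on an open set of jets. Each of them involves finitely many coordinates,
-- so the calculus is finite-dimensional.
--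
-- Splitting. With B = (I, 0) Q there are G and X such that PG = 0, BG = 1 and GB + XP = 1
-- (`exists_splitting`). The rows of P are the differentials of the equations, so multiples of P
-- vanish on the tangent spaces. Hence the components of B dx generate the forms on the solution set
-- over the operators, and they are independent there (`rowEval_eq_zero_of_vecMul`).
--
-- Flat implies strongly closed. Let h be the flat output and φ the parametrization. On the solution
-- set dh = (BG)(B dx), where B dx now denotes the given forms and the first B the rows of dh. The
-- matrix BG need not be unimodular over the germs in the ambient jet space, since the inverse
-- relations between h and φ hold only on the solution set. Pulled back along φ to the free jets it
-- does become unimodular, because there h ∘ φ is the identity on an open set. Pulling the result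
-- back along h gives a unimodular M that agrees with BG on the solution set
-- (`IsFlatParam.exists_isClosedForm`).
--
-- Strongly closed implies flat. After replacing B by MB the forms B dx are closed on the solution
-- set. The Poincaré lemma, applied to their pullbacks by ρ, gives functions h with dh = B dx on the
-- tangent spaces. By GB + XP = 1 every dx_i is a combination of finitely many derivatives of the
-- dh_j, so x is an analytic function φ of finitely many derivatives of h. By BG = 1 the
-- differential of the prolonged h is onto, so the finite truncations of the prolonged h are open on
-- the solution set. The identities F(φ, φ̇) = 0 and h ∘ φ = y, which hold on the image of the
-- solution set, therefore hold near y₀ (`exists_isFlatParam_of_isClosedForm`).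

noncomputable section

/-! ### Analytic maps from jets to normed spaces -/

set_option linter.unusedSectionVars false

section JetAnalytic

variable {n n' : ℕ} {E E' : Type*} [NormedAddCommGroup E] [NormedSpace ℝ E]
  [NormedAddCommGroup E'] [NormedSpace ℝ E'] [CompleteSpace E] [CompleteSpace E']

/-- A map from jets to a normed space that, near `x`, is an analytic function of finitely many
coordinates. -/
def JetAnalyticAt (u : Jet n → E) (x : Jet n) : Prop :=
  ∃ (N : ℕ) (g : (Fin N → Fin n → ℝ) → E),
    AnalyticAt ℝ g (jetTrunc N x) ∧ u =ᶠ[𝓝 x] fun z => g (jetTrunc N z)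

theorem continuous_jetTrunc (N : ℕ) : Continuous (jetTrunc N : Jet n → _) :=
  (jetTruncL n N).continuous

/-- The jet with the given first `N` derivatives and the others taken from `x`. -/
def jetExtend (x : Jet n) (N : ℕ) (e : Fin N → Fin n → ℝ) : Jet n :=
  fun k => if h : k < N then e ⟨k, h⟩ else x k

theorem jetTrunc_jetExtend (x : Jet n) (N : ℕ) (e : Fin N → Fin n → ℝ) :
    jetTrunc N (jetExtend x N e) = e := by
  funext k
  simp [jetTrunc, jetExtend]

theorem jetExtend_jetTrunc (x : Jet n) (N : ℕ) : jetExtend x N (jetTrunc N x) = x := by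
  funext k
  by_cases h : k < N <;> simp [jetTrunc, jetExtend, h]

theorem continuous_jetExtend (x : Jet n) (N : ℕ) : Continuous (jetExtend x N) := by
  refine continuous_pi fun k => ?_
  by_cases h : k < N
  · simpa [jetExtend, h] using continuous_apply _
  · simpa [jetExtend, h] using continuous_const

/-- Truncation has a continuous section `jetExtend x N` through `x`, hence is open. This moves
statements that hold near a jet to statements near its truncation, where the finite-dimensional
theorems apply. -/
theorem map_jetTrunc_nhds (x : Jet n) (N : ℕ) : map (jetTrunc N) (𝓝 x) = 𝓝 (jetTrunc N x) := by
  refine le_antisymm ((continuous_jetTrunc N).tendsto x) ?_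
  have h : Tendsto (jetExtend x N) (𝓝 (jetTrunc N x)) (𝓝 x) := by
    simpa [jetExtend_jetTrunc] using (continuous_jetExtend x N).tendsto (jetTrunc N x)
  calc 𝓝 (jetTrunc N x) = map (jetTrunc N ∘ jetExtend x N) (𝓝 (jetTrunc N x)) := by
        simp [Function.comp_def, jetTrunc_jetExtend]
    _ ≤ map (jetTrunc N) (𝓝 x) := by
        rw [← Filter.map_map]
        exact Filter.map_mono h

namespace JetAnalyticAt

variable {u u' : Jet n → E} {w : Jet n → E'} {x : Jet n}

theorem raise (h : JetAnalyticAt u x) : ∃ N : ℕ, ∀ N' ≥ N, ∃ g : (Fin N' → Fin n → ℝ) → E,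
    AnalyticAt ℝ g (jetTrunc N' x) ∧ u =ᶠ[𝓝 x] fun z => g (jetTrunc N' z) := by
  obtain ⟨N, g, hg, hf⟩ := h
  refine ⟨N, fun N' hN' => ⟨fun w => g (truncRestrict n hN' w), ?_, hf⟩⟩
  exact AnalyticAt.comp (g := g) (f := truncRestrict n hN') hg
    ((truncRestrict n hN').analyticAt _)

theorem congr (h : JetAnalyticAt u x) (hu : u' =ᶠ[𝓝 x] u) : JetAnalyticAt u' x := by
  obtain ⟨N, g, hg, hf⟩ := h
  exact ⟨N, g, hg, hu.trans hf⟩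

theorem continuousAt (h : JetAnalyticAt u x) : ContinuousAt u x := by
  obtain ⟨N, g, hg, hf⟩ := h
  exact (ContinuousAt.comp (g := g) hg.continuousAt (continuous_jetTrunc N).continuousAt).congr
    hf.symm

theorem eventually (h : JetAnalyticAt u x) : ∀ᶠ z in 𝓝 x, JetAnalyticAt u z := by
  obtain ⟨N, g, hg, hf⟩ := h
  filter_upwards [((continuous_jetTrunc N).tendsto x).eventually hg.eventually_analyticAt,
    hf.eventuallyEq_nhds] with z hz hz'
  exact ⟨N, g, hz, hz'⟩

theorem prodMk (h : JetAnalyticAt u x) (h' : JetAnalyticAt w x) :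
    JetAnalyticAt (fun z => (u z, w z)) x := by
  obtain ⟨N, hN⟩ := h.raise
  obtain ⟨N', hN'⟩ := h'.raise
  obtain ⟨g, hg, hgf⟩ := hN (max N N') (le_max_left _ _)
  obtain ⟨g', hg', hgf'⟩ := hN' (max N N') (le_max_right _ _)
  refine ⟨max N N', fun w => (g w, g' w), hg.prod hg', ?_⟩
  filter_upwards [hgf, hgf'] with z hz hz'
  rw [hz, hz']

theorem pi {ι : Type*} [Fintype ι] {G : ι → Type*} [∀ i, NormedAddCommGroup (G i)]
    [∀ i, NormedSpace ℝ (G i)] [∀ i, CompleteSpace (G i)] {u : Jet n → ∀ i, G i}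
    (h : ∀ i, JetAnalyticAt (fun z => u z i) x) : JetAnalyticAt u x := by
  choose N hN using fun i => (h i).raise
  choose g hg hgf using fun i => hN i (Finset.univ.sup N) (Finset.le_sup (Finset.mem_univ i))
  refine ⟨_, fun w i => g i w, AnalyticAt.pi hg, ?_⟩
  filter_upwards [eventually_all.2 hgf] with z hz
  exact funext hz

theorem comp_analyticAt {G : E → E'} (hG : AnalyticAt ℝ G (u x)) (h : JetAnalyticAt u x) :
    JetAnalyticAt (fun z => G (u z)) x := by
  obtain ⟨N, g, hg, hf⟩ := h
  refine ⟨N, fun w => G (g w), ?_, hf.mono fun z hz => congrArg G hz⟩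
  exact AnalyticAt.comp (g := G) (f := g) (by rwa [hf.self_of_nhds] at hG) hg

theorem sub (h : JetAnalyticAt u x) (h' : JetAnalyticAt u' x) :
    JetAnalyticAt (fun z => u z - u' z) x :=
  comp_analyticAt (G := fun p : E × E => p.1 - p.2) (analyticAt_fst.sub analyticAt_snd)
    (h.prodMk h')

end JetAnalyticAt

theorem jetAnalyticAt_trunc (N : ℕ) (x : Jet n) : JetAnalyticAt (jetTrunc N) x :=
  ⟨N, id, analyticAt_id, Eventually.of_forall fun _ => rfl⟩

theorem jetAnalyticAt_coord (k : ℕ) (x : Jet n) : JetAnalyticAt (fun z => z k) x :=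
  (jetAnalyticAt_trunc (k + 1) x).comp_analyticAt
    (G := fun e : Fin (k + 1) → Fin n → ℝ => e (Fin.last k))
    ((ContinuousLinearMap.proj (R := ℝ) (φ := fun _ : Fin (k + 1) => Fin n → ℝ)
      (Fin.last k)).analyticAt _)

theorem jetAnalyticAt_coord₂ (k : ℕ) (i : Fin n) (x : Jet n) :
    JetAnalyticAt (fun z => z k i) x :=
  (jetAnalyticAt_coord k x).comp_analyticAt (G := fun e : Fin n → ℝ => e i)
    ((ContinuousLinearMap.proj (R := ℝ) (φ := fun _ : Fin n => ℝ) i).analyticAt _)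

theorem jetAnalyticAt_const (c : E) (x : Jet n) : JetAnalyticAt (fun _ => c) x :=
  ⟨0, fun _ => c, analyticAt_const, Eventually.of_forall fun _ => rfl⟩

/-- A map between jet spaces all of whose components are analytic at `y`. -/
def JetMapAt (Φ : Jet n' → Jet n) (y : Jet n') : Prop :=
  ∀ k, JetAnalyticAt (fun z => Φ z k) y

namespace JetMapAt

variable {Φ : Jet n' → Jet n} {y : Jet n'}

theorem of_components (h : ∀ k i, AnalyticJetAt (fun z => Φ z k i) y) : JetMapAt Φ y :=
  fun k => JetAnalyticAt.pi fun i => h k i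

theorem component (h : JetMapAt Φ y) (k : ℕ) (i : Fin n) : JetAnalyticAt (fun z => Φ z k i) y :=
  (h k).comp_analyticAt (G := fun e : Fin n → ℝ => e i)
    ((ContinuousLinearMap.proj (R := ℝ) (φ := fun _ : Fin n => ℝ) i).analyticAt _)

theorem trunc (h : JetMapAt Φ y) (N : ℕ) : JetAnalyticAt (fun z => jetTrunc N (Φ z)) y :=
  JetAnalyticAt.pi fun k => h k

theorem continuousAt (h : JetMapAt Φ y) : ContinuousAt Φ y :=
  continuousAt_pi.2 fun k => (h k).continuousAt

theorem comp_jet {u : Jet n → E} (hu : JetAnalyticAt u (Φ y)) (h : JetMapAt Φ y) :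
    JetAnalyticAt (fun z => u (Φ z)) y := by
  obtain ⟨N, g, hg, hf⟩ := hu
  exact (JetAnalyticAt.comp_analyticAt (u := fun z => jetTrunc N (Φ z)) (G := g) hg
    (h.trunc N)).congr (h.continuousAt.eventually hf)

end JetMapAt

theorem jetMapAt_id (x : Jet n) : JetMapAt (fun z => z) x := fun k => jetAnalyticAt_coord k x

theorem JetMapAt.comp {n'' : ℕ} {Φ : Jet n' → Jet n} {Θ : Jet n'' → Jet n'} {z : Jet n''}
    (hΦ : JetMapAt Φ (Θ z)) (hΘ : JetMapAt Θ z) : JetMapAt (fun t => Φ (Θ t)) z :=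
  fun k => JetMapAt.comp_jet (hΦ k) hΘ

/-! ### Derivatives of analytic maps on jets -/

namespace JetAnalyticAt

variable {u u' : Jet n → E} {w : Jet n → E'} {x : Jet n}

/-- Jets carry no norm, so only directional derivatives are available. They are read off the Fréchet
derivative of a finite-dimensional model, on a neighbourhood and in all directions at once. -/
theorem hasLineDerivAt_model {N : ℕ} {g : (Fin N → Fin n → ℝ) → E}
    (hg : AnalyticAt ℝ g (jetTrunc N x)) (hf : u =ᶠ[𝓝 x] fun z => g (jetTrunc N z)) :
    ∀ᶠ z in 𝓝 x, ∀ v, HasLineDerivAt ℝ u (fderiv ℝ g (jetTrunc N z) (jetTrunc N v)) z v := by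
  filter_upwards [((continuous_jetTrunc N).tendsto x).eventually hg.eventually_analyticAt,
    hf.eventuallyEq_nhds] with z hz hz' v
  have hd : HasLineDerivAt ℝ g (fderiv ℝ g (jetTrunc N z) (jetTrunc N v)) (jetTrunc N z)
      (jetTrunc N v) := hz.differentiableAt.hasFDerivAt.hasLineDerivAt _
  exact HasDerivAt.congr_of_eventuallyEq (f := fun t : ℝ => g (jetTrunc N (z + t • v))) hd
    ((tendsto_line z v).eventually hz')

theorem hasLineDerivAt (h : JetAnalyticAt u x) (v : Jet n) :
    HasLineDerivAt ℝ u (lineDeriv ℝ u x v) x v := by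
  obtain ⟨N, g, hg, hf⟩ := h
  exact ((hasLineDerivAt_model hg hf).self_of_nhds v).lineDifferentiableAt.hasLineDerivAt

/-- The derivative depends linearly on finitely many coordinates of the tangent vector. -/
theorem exists_lineDeriv_eq (h : JetAnalyticAt u x) :
    ∃ (N : ℕ) (L : (Fin N → Fin n → ℝ) →L[ℝ] E), ∀ v, lineDeriv ℝ u x v = L (jetTrunc N v) := by
  obtain ⟨N, g, hg, hf⟩ := h
  exact ⟨N, fderiv ℝ g (jetTrunc N x), fun v =>
    ((hasLineDerivAt_model hg hf).self_of_nhds v).lineDeriv⟩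

theorem lineDeriv_add_right (h : JetAnalyticAt u x) (v v' : Jet n) :
    lineDeriv ℝ u x (v + v') = lineDeriv ℝ u x v + lineDeriv ℝ u x v' := by
  obtain ⟨N, L, hL⟩ := h.exists_lineDeriv_eq
  rw [hL, hL, hL]
  exact map_add L (jetTrunc N v) (jetTrunc N v')

theorem hasLineDerivAt_comp {G : E → E'} {x : Jet n} (hG : AnalyticAt ℝ G (u x))
    (h : JetAnalyticAt u x) (v : Jet n) :
    HasLineDerivAt ℝ (fun z => G (u z)) (fderiv ℝ G (u x) (lineDeriv ℝ u x v)) x v := by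
  have h1 : HasFDerivAt G (fderiv ℝ G (u x)) (u (x + (0 : ℝ) • v)) := by
    simpa using hG.differentiableAt.hasFDerivAt
  exact h1.comp_hasDerivAt (0 : ℝ) (h.hasLineDerivAt v)

theorem lineDeriv_comp {G : E → E'} {x : Jet n} (hG : AnalyticAt ℝ G (u x))
    (h : JetAnalyticAt u x) (v : Jet n) :
    lineDeriv ℝ (fun z => G (u z)) x v = fderiv ℝ G (u x) (lineDeriv ℝ u x v) :=
  (hasLineDerivAt_comp hG h v).lineDeriv

theorem lineDeriv_pi {ι : Type*} [Fintype ι] {G : ι → Type*} [∀ i, NormedAddCommGroup (G i)]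
    [∀ i, NormedSpace ℝ (G i)] [∀ i, CompleteSpace (G i)] {u : Jet n → ∀ i, G i} (h : JetAnalyticAt u x) (v : Jet n) (i : ι) :
    lineDeriv ℝ (fun z => u z i) x v = lineDeriv ℝ u x v i :=
  (hasDerivAt_pi.1 (h.hasLineDerivAt v) i).deriv

end JetAnalyticAt

theorem lineDeriv_jetTrunc (N : ℕ) (x v : Jet n) :
    lineDeriv ℝ (jetTrunc N : Jet n → _) x v = jetTrunc N v := by
  have h := (JetAnalyticAt.hasLineDerivAt_model (x := x) (N := N) (g := id) (u := jetTrunc N)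
    analyticAt_id (Eventually.of_forall fun _ => rfl)).self_of_nhds v
  simpa using h.lineDeriv

theorem lineDeriv_coord (k : ℕ) (x v : Jet n) : lineDeriv ℝ (fun z : Jet n => z k) x v = v k := by
  have := (jetAnalyticAt_trunc (k + 1) x).lineDeriv_pi v (Fin.last k)
  rw [lineDeriv_jetTrunc] at this
  exact this

theorem lineDeriv_coord₂ (k : ℕ) (i : Fin n) (x v : Jet n) :
    lineDeriv ℝ (fun z : Jet n => z k i) x v = v k i := by
  rw [(jetAnalyticAt_coord k x).lineDeriv_pi v i, lineDeriv_coord]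

theorem lineDeriv_congr {u u' : Jet n → E} {x : Jet n} (h : u =ᶠ[𝓝 x] u') (v : Jet n) :
    lineDeriv ℝ u x v = lineDeriv ℝ u' x v :=
  Filter.EventuallyEq.deriv_eq ((tendsto_line x v).eventually h)

/-- The tangent map of a map between jet spaces. -/
def jetTangent (Φ : Jet n' → Jet n) (y w : Jet n') : Jet n :=
  fun k => lineDeriv ℝ (fun z => Φ z k) y w

theorem jetTangent_apply {Φ : Jet n' → Jet n} {y : Jet n'} (h : JetMapAt Φ y) (w : Jet n')
    (k : ℕ) (i : Fin n) : jetTangent Φ y w k i = lineDeriv ℝ (fun z => Φ z k i) y w :=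
  ((h k).lineDeriv_pi w i).symm

theorem lineDeriv_trunc_comp {Φ : Jet n' → Jet n} {y : Jet n'} (h : JetMapAt Φ y) (w : Jet n')
    (N : ℕ) : lineDeriv ℝ (fun z => jetTrunc N (Φ z)) y w = jetTrunc N (jetTangent Φ y w) := by
  funext k
  rw [← (h.trunc N).lineDeriv_pi w k]
  rfl

/-- The chain rule. -/
theorem lineDeriv_comp_jet {Φ : Jet n' → Jet n} {y : Jet n'} {u : Jet n → E}
    (hu : JetAnalyticAt u (Φ y)) (h : JetMapAt Φ y) (w : Jet n') :
    lineDeriv ℝ (fun z => u (Φ z)) y w = lineDeriv ℝ u (Φ y) (jetTangent Φ y w) := by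
  obtain ⟨N, g, hg, hf⟩ := hu
  have hf' : (fun z => u (Φ z)) =ᶠ[𝓝 y] fun z => g (jetTrunc N (Φ z)) :=
    h.continuousAt.eventually hf
  rw [lineDeriv_congr hf', lineDeriv_congr hf,
    JetAnalyticAt.lineDeriv_comp (u := fun z => jetTrunc N (Φ z)) (G := g) hg (h.trunc N),
    JetAnalyticAt.lineDeriv_comp (G := g) hg (jetAnalyticAt_trunc N (Φ y)),
    lineDeriv_trunc_comp h, lineDeriv_jetTrunc]

theorem jetTangent_comp {n'' : ℕ} {Φ : Jet n' → Jet n} {Θ : Jet n'' → Jet n'} {z : Jet n''}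
    (hΦ : JetMapAt Φ (Θ z)) (hΘ : JetMapAt Θ z) (w : Jet n'') :
    jetTangent (fun t => Φ (Θ t)) z w = jetTangent Φ (Θ z) (jetTangent Θ z w) :=
  funext fun k => lineDeriv_comp_jet (hΦ k) hΘ w

end JetAnalytic
end

noncomputable section

/-! ### Analytic 1-forms on jets -/

section JetForms

variable {n n' : ℕ}

/-- A function of a jet and a tangent vector which near `x` is a 1-form with analytic coefficients in
finitely many coordinates. -/
def JetFormAt (e : Jet n → Jet n → ℝ) (x : Jet n) : Prop :=
  ∃ (N : ℕ) (g : (Fin N → Fin n → ℝ) → ((Fin N → Fin n → ℝ) →L[ℝ] ℝ)),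
    AnalyticAt ℝ g (jetTrunc N x) ∧
      ∀ᶠ z in 𝓝 x, ∀ v, e z v = g (jetTrunc N z) (jetTrunc N v)

/-- The exterior derivative of a 1-form. -/
def extD (e : Jet n → Jet n → ℝ) (x v w : Jet n) : ℝ :=
  lineDeriv ℝ (fun z => e z w) x v - lineDeriv ℝ (fun z => e z v) x w

/-- The Lie derivative of a 1-form along the Cartan field. -/
def formLie (e : Jet n → Jet n → ℝ) (x v : Jet n) : ℝ :=
  lineDeriv ℝ (fun z => e z v) x (cartanField x) + e x (cartanField v)

/-- The pullback of a 1-form. -/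
def formPull (Φ : Jet n' → Jet n) (e : Jet n → Jet n → ℝ) : Jet n' → Jet n' → ℝ :=
  fun y w => e (Φ y) (jetTangent Φ y w)

theorem lineDeriv_form_model {e : Jet n → Jet n → ℝ} {x : Jet n} {N : ℕ}
    {g : (Fin N → Fin n → ℝ) → ((Fin N → Fin n → ℝ) →L[ℝ] ℝ)} (hg : AnalyticAt ℝ g (jetTrunc N x))
    (he : ∀ᶠ z in 𝓝 x, ∀ v, e z v = g (jetTrunc N z) (jetTrunc N v)) (v w : Jet n) :
    lineDeriv ℝ (fun z => e z v) x w = fderiv ℝ g (jetTrunc N x) (jetTrunc N w) (jetTrunc N v) := by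
  have h1 : (fun z => e z v) =ᶠ[𝓝 x] fun z => g (jetTrunc N z) (jetTrunc N v) :=
    he.mono fun z hz => hz v
  have h2 : JetAnalyticAt (fun z => g (jetTrunc N z)) x :=
    JetAnalyticAt.comp_analyticAt (G := g) hg (jetAnalyticAt_trunc N x)
  rw [lineDeriv_congr h1, JetAnalyticAt.lineDeriv_comp (u := fun z => g (jetTrunc N z))
    (G := fun L : (Fin N → Fin n → ℝ) →L[ℝ] ℝ => L (jetTrunc N v))
    ((ContinuousLinearMap.apply ℝ ℝ (jetTrunc N v)).analyticAt _) h2,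
    JetAnalyticAt.lineDeriv_comp (G := g) hg (jetAnalyticAt_trunc N x), lineDeriv_jetTrunc]
  exact congrArg (fun L : ((Fin N → Fin n → ℝ) →L[ℝ] ℝ) →L[ℝ] ℝ =>
    L (fderiv ℝ g (jetTrunc N x) (jetTrunc N w)))
    (ContinuousLinearMap.apply ℝ ℝ (jetTrunc N v)).fderiv

namespace JetFormAt

variable {e e' : Jet n → Jet n → ℝ} {x : Jet n}

theorem eventually (h : JetFormAt e x) : ∀ᶠ z in 𝓝 x, JetFormAt e z := by
  obtain ⟨N, g, hg, he⟩ := h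
  filter_upwards [((continuous_jetTrunc N).tendsto x).eventually hg.eventually_analyticAt,
    he.eventually_nhds] with z hz hz'
  exact ⟨N, g, hz, hz'⟩

theorem congr (h : JetFormAt e x) (h' : ∀ᶠ z in 𝓝 x, ∀ v, e' z v = e z v) : JetFormAt e' x := by
  obtain ⟨N, g, hg, he⟩ := h
  refine ⟨N, g, hg, ?_⟩
  filter_upwards [he, h'] with z hz hz' v
  rw [hz', hz]

theorem of_analytic {f : Jet n → ℝ} (h : AnalyticJetAt f x) : JetFormAt (lineDeriv ℝ f) x := by
  obtain ⟨N, g, hg, hf⟩ := h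
  exact ⟨N, fderiv ℝ g, hg.fderiv,
    (JetAnalyticAt.hasLineDerivAt_model hg hf).mono fun z hz v => (hz v).lineDeriv⟩

theorem raise (h : JetFormAt e x) : ∃ N : ℕ, ∀ N' ≥ N,
    ∃ g : (Fin N' → Fin n → ℝ) → ((Fin N' → Fin n → ℝ) →L[ℝ] ℝ),
    AnalyticAt ℝ g (jetTrunc N' x) ∧
      ∀ᶠ z in 𝓝 x, ∀ v, e z v = g (jetTrunc N' z) (jetTrunc N' v) := by
  obtain ⟨N, g, hg, he⟩ := h
  refine ⟨N, fun N' hN' => ⟨fun w => (g (truncRestrict n hN' w)).comp (truncRestrict n hN'), ?_, he⟩⟩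
  have h1 : AnalyticAt ℝ (fun w => g (truncRestrict n hN' w)) (jetTrunc N' x) :=
    AnalyticAt.comp (g := g) (f := truncRestrict n hN') hg ((truncRestrict n hN').analyticAt _)
  let C : ((Fin N → Fin n → ℝ) →L[ℝ] ℝ) →L[ℝ] ((Fin N' → Fin n → ℝ) →L[ℝ] ℝ) :=
    (ContinuousLinearMap.compL ℝ _ _ ℝ).flip (truncRestrict n hN')
  exact AnalyticAt.comp (g := C) (f := fun w => g (truncRestrict n hN' w)) (C.analyticAt _) h1

theorem add (h : JetFormAt e x) (h' : JetFormAt e' x) :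
    JetFormAt (fun z v => e z v + e' z v) x := by
  obtain ⟨N, hN⟩ := h.raise
  obtain ⟨N', hN'⟩ := h'.raise
  obtain ⟨g, hg, hgf⟩ := hN (max N N') (le_max_left _ _)
  obtain ⟨g', hg', hgf'⟩ := hN' (max N N') (le_max_right _ _)
  refine ⟨max N N', fun w => g w + g' w, hg.add hg', ?_⟩
  filter_upwards [hgf, hgf'] with z hz hz' v
  simp [hz, hz']

theorem smul {f : Jet n → ℝ} (hf : AnalyticJetAt f x) (h : JetFormAt e x) :
    JetFormAt (fun z v => f z * e z v) x := by
  obtain ⟨N, hN⟩ := JetAnalyticAt.raise hf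
  obtain ⟨N', hN'⟩ := h.raise
  obtain ⟨g, hg, hgf⟩ := hN (max N N') (le_max_left _ _)
  obtain ⟨g', hg', hgf'⟩ := hN' (max N N') (le_max_right _ _)
  refine ⟨max N N', fun w => g w • g' w, hg.smul hg', ?_⟩
  filter_upwards [hgf, hgf'] with z hz hz' v
  simp [hz, hz']

theorem zero (x : Jet n) : JetFormAt (fun _ _ => 0) x :=
  ⟨0, 0, analyticAt_const, Eventually.of_forall fun _ _ => rfl⟩

theorem sub (h : JetFormAt e x) (h' : JetFormAt e' x) :
    JetFormAt (fun z v => e z v - e' z v) x :=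
  (h.add (smul (analyticJetAt_const (-1) x) h')).congr
    (Eventually.of_forall fun _ _ => by ring)

theorem sum {ι : Type*} (s : Finset ι) {e : ι → Jet n → Jet n → ℝ}
    (h : ∀ i ∈ s, JetFormAt (e i) x) : JetFormAt (fun z v => ∑ i ∈ s, e i z v) x := by
  classical
  induction s using Finset.induction_on with
  | empty => simpa using zero x
  | insert a s ha ih =>
    simp only [Finset.sum_insert ha]
    exact (h a (Finset.mem_insert_self _ _)).add
      (ih fun i hi => h i (Finset.mem_insert_of_mem hi))

theorem coord (k : ℕ) (i : Fin n) (x : Jet n) : JetFormAt (fun _ v => v k i) x :=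
  (of_analytic (jetAnalyticAt_coord₂ k i x)).congr
    (Eventually.of_forall fun z v => (lineDeriv_coord₂ k i z v).symm)

theorem jetAnalyticAt_apply (h : JetFormAt e x) {V : Jet n → Jet n} (hV : JetMapAt V x) :
    JetAnalyticAt (fun z => e z (V z)) x := by
  obtain ⟨N, g, hg, he⟩ := h
  have h2 : JetAnalyticAt (fun z => (g (jetTrunc N z), jetTrunc N (V z))) x :=
    (JetAnalyticAt.comp_analyticAt (G := g) hg (jetAnalyticAt_trunc N x)).prodMk (hV.trunc N)
  have h3 : AnalyticAt ℝ (fun p : ((Fin N → Fin n → ℝ) →L[ℝ] ℝ) × (Fin N → Fin n → ℝ) => p.1 p.2)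
      (g (jetTrunc N x), jetTrunc N (V x)) :=
    (ContinuousLinearMap.id ℝ ((Fin N → Fin n → ℝ) →L[ℝ] ℝ)).analyticAt_bilinear _
  exact (JetAnalyticAt.comp_analyticAt (G := fun p : ((Fin N → Fin n → ℝ) →L[ℝ] ℝ) × _ => p.1 p.2)
    h3 h2).congr (he.mono fun z hz => hz (V z))

/-- Product rule: one term differentiates the coefficients of the form with the vector frozen, the
other differentiates the vector field. -/
theorem lineDeriv_apply (h : JetFormAt e x) {V : Jet n → Jet n} (hV : JetMapAt V x) (w : Jet n) :
    lineDeriv ℝ (fun z => e z (V z)) x w =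
      lineDeriv ℝ (fun z => e z (V x)) x w + e x (jetTangent V x w) := by
  obtain ⟨N, g, hg, he⟩ := h
  have h1 : HasLineDerivAt ℝ (fun z => g (jetTrunc N z))
      (fderiv ℝ g (jetTrunc N x) (jetTrunc N w)) x w := by
    have := JetAnalyticAt.hasLineDerivAt_comp (G := g) hg (jetAnalyticAt_trunc N x) w
    rwa [lineDeriv_jetTrunc] at this
  have h2 := (hV.trunc N).hasLineDerivAt w
  rw [lineDeriv_trunc_comp hV] at h2
  have h3 : (fun z => e z (V z)) =ᶠ[𝓝 x] fun z => g (jetTrunc N z) (jetTrunc N (V z)) :=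
    he.mono fun z hz => hz (V z)
  rw [lineDeriv_congr h3, lineDeriv_form_model hg he, he.self_of_nhds]
  have h4 := HasDerivAt.clm_apply h1 h2
  simp only [zero_smul, add_zero] at h4
  exact h4.deriv

/-- In a model G of the map and g of the form, the pullback is ξ ↦ g(G ξ) ∘ DG(ξ). Its derivative
has a term with D²G, which is symmetric and cancels on antisymmetrization. What is left is the
pullback of the exterior derivative. -/
theorem pull {Φ : Jet n' → Jet n} {y : Jet n'} (hΦ : JetMapAt Φ y) {e : Jet n → Jet n → ℝ}
    (h : JetFormAt e (Φ y)) : JetFormAt (formPull Φ e) y ∧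
    ∀ v w, extD (formPull Φ e) y v w = extD e (Φ y) (jetTangent Φ y v) (jetTangent Φ y w) := by
  obtain ⟨N, g, hg, he⟩ := h
  obtain ⟨M, G, hG, hGΦ⟩ := hΦ.trunc N
  have hΦy : jetTrunc N (Φ y) = G (jetTrunc M y) := hGΦ.self_of_nhds
  have hder : ∀ᶠ z in 𝓝 y, ∀ w,
      jetTrunc N (jetTangent Φ z w) = fderiv ℝ G (jetTrunc M z) (jetTrunc M w) := by
    filter_upwards [JetAnalyticAt.hasLineDerivAt_model hG hGΦ, eventually_all.2 fun k : Fin N =>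
      (hΦ k).eventually] with z hz hz' w
    have hz'' : JetAnalyticAt (fun t => jetTrunc N (Φ t)) z := JetAnalyticAt.pi fun k => hz' k
    rw [← (hz w).lineDeriv]
    funext k
    rw [← hz''.lineDeriv_pi w k]
    rfl
  have hgG : AnalyticAt ℝ (fun ξ => g (G ξ)) (jetTrunc M y) :=
    AnalyticAt.comp (g := g) (f := G) (by rwa [← hΦy]) hG
  let g' : (Fin M → Fin n' → ℝ) → ((Fin M → Fin n' → ℝ) →L[ℝ] ℝ) :=
    fun ξ => (g (G ξ)).comp (fderiv ℝ G ξ)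
  have hg' : AnalyticAt ℝ g' (jetTrunc M y) := by
    exact AnalyticAt.comp₂ (h := fun p : ((Fin N → Fin n → ℝ) →L[ℝ] ℝ) × _ => p.1.comp p.2)
      ((ContinuousLinearMap.compL ℝ (Fin M → Fin n' → ℝ) (Fin N → Fin n → ℝ) ℝ).analyticAt_bilinear
        (g (G (jetTrunc M y)), fderiv ℝ G (jetTrunc M y))) hgG hG.fderiv
  have hmod : ∀ᶠ z in 𝓝 y, ∀ v, formPull Φ e z v = g' (jetTrunc M z) (jetTrunc M v) := by
    filter_upwards [hder, hGΦ, hΦ.continuousAt.eventually he] with z h1 h2 h3 v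
    show e (Φ z) (jetTangent Φ z v) = _
    rw [h3, h1]
    exact congrArg (fun ξ => g ξ (fderiv ℝ G (jetTrunc M z) (jetTrunc M v))) h2
  refine ⟨⟨M, g', hg', hmod⟩, fun v w => ?_⟩
  have hfd : ∀ a b, fderiv ℝ g' (jetTrunc M y) a b =
      fderiv ℝ g (G (jetTrunc M y)) (fderiv ℝ G (jetTrunc M y) a) (fderiv ℝ G (jetTrunc M y) b) +
        g (G (jetTrunc M y)) (fderiv ℝ (fderiv ℝ G) (jetTrunc M y) a b) := by
    intro a b
    have h1 : HasFDerivAt (fun ξ => g (G ξ))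
        ((fderiv ℝ g (G (jetTrunc M y))).comp (fderiv ℝ G (jetTrunc M y))) (jetTrunc M y) := by
      have : AnalyticAt ℝ g (G (jetTrunc M y)) := by rwa [← hΦy]
      exact this.differentiableAt.hasFDerivAt.comp _ hG.differentiableAt.hasFDerivAt
    have h2 := (h1.clm_comp hG.fderiv.differentiableAt.hasFDerivAt).fderiv
    have h3 : fderiv ℝ g' (jetTrunc M y) = _ := h2
    rw [h3]
    simp [add_comm]
  have hsym : IsSymmSndFDerivAt ℝ G (jetTrunc M y) :=
    (hG.contDiffAt (n := ⊤)).isSymmSndFDerivAt (by simp)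
  unfold extD
  rw [lineDeriv_form_model hg' hmod, lineDeriv_form_model hg' hmod, lineDeriv_form_model hg he,
    lineDeriv_form_model hg he, hfd, hfd, hsym.eq (jetTrunc M v), hder.self_of_nhds,
    hder.self_of_nhds]
  rw [hΦy]
  ring

end JetFormAt

theorem jetMapAt_cartanField (x : Jet n) : JetMapAt cartanField x :=
  fun k => jetAnalyticAt_coord (k + 1) x

theorem jetTangent_cartanField (x v : Jet n) : jetTangent cartanField x v = cartanField v :=
  funext fun k => lineDeriv_coord (k + 1) x v

theorem jetMapAt_const (v x : Jet n) : JetMapAt (fun _ : Jet n => v) x :=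
  fun k => jetAnalyticAt_const (v k) x

/-- Exact forms are closed. -/
theorem extD_lineDeriv {f : Jet n → ℝ} {x : Jet n} (hf : AnalyticJetAt f x) (v w : Jet n) :
    extD (lineDeriv ℝ f) x v w = 0 := by
  obtain ⟨N, g, hg, hf⟩ := hf
  have h := (JetAnalyticAt.hasLineDerivAt_model hg hf).mono fun z hz v => (hz v).lineDeriv
  have hsym : IsSymmSndFDerivAt ℝ g (jetTrunc N x) :=
    (hg.contDiffAt (n := ⊤)).isSymmSndFDerivAt (by simp)
  unfold extD
  rw [lineDeriv_form_model hg.fderiv h, lineDeriv_form_model hg.fderiv h, hsym.eq (jetTrunc N v),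
    sub_self]

/-- Cartan's formula. -/
theorem formLie_eq {e : Jet n → Jet n → ℝ} {x : Jet n} (h : JetFormAt e x) (v : Jet n) :
    formLie e x v = extD e x (cartanField x) v + lineDeriv ℝ (fun z => e z (cartanField z)) x v := by
  rw [h.lineDeriv_apply (jetMapAt_cartanField x), jetTangent_cartanField]
  unfold formLie extD
  ring

/-- The Lie derivative commutes with d: this is Cartan's formula for an exact form. -/
theorem lineDeriv_cartanDeriv {f : Jet n → ℝ} {x : Jet n} (hf : AnalyticJetAt f x) (v : Jet n) :
    lineDeriv ℝ (cartanDeriv f) x v = formLie (lineDeriv ℝ f) x v := by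
  rw [formLie_eq (JetFormAt.of_analytic hf), extD_lineDeriv hf, zero_add]
  rfl

theorem formLie_congr {e e' : Jet n → Jet n → ℝ} {x : Jet n}
    (h : ∀ᶠ z in 𝓝 x, ∀ v, e z v = e' z v) (v : Jet n) : formLie e x v = formLie e' x v := by
  unfold formLie
  rw [lineDeriv_congr (h.mono fun z hz => hz v : (fun z => e z v) =ᶠ[𝓝 x] fun z => e' z v),
    h.self_of_nhds]

theorem extD_congr {e e' : Jet n → Jet n → ℝ} {x : Jet n}
    (h : ∀ᶠ z in 𝓝 x, ∀ v, e z v = e' z v) (v w : Jet n) : extD e x v w = extD e' x v w := by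
  unfold extD
  rw [lineDeriv_congr (h.mono fun z hz => hz v : (fun z => e z v) =ᶠ[𝓝 x] fun z => e' z v),
    lineDeriv_congr (h.mono fun z hz => hz w : (fun z => e z w) =ᶠ[𝓝 x] fun z => e' z w)]

theorem formLie_sub {e e' : Jet n → Jet n → ℝ} {x : Jet n} (h : JetFormAt e x)
    (h' : JetFormAt e' x) (v : Jet n) :
    formLie (fun z v => e z v - e' z v) x v = formLie e x v - formLie e' x v := by
  have h1 := (h.jetAnalyticAt_apply (jetMapAt_const v x)).hasLineDerivAt (cartanField x)
  have h2 := (h'.jetAnalyticAt_apply (jetMapAt_const v x)).hasLineDerivAt (cartanField x)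
  have h3 := (HasDerivAt.sub h1 h2).deriv
  have h4 : lineDeriv ℝ (fun z => e z v - e' z v) x (cartanField x) = _ := h3
  unfold formLie
  rw [h4]
  ring

theorem extD_sub {e e' : Jet n → Jet n → ℝ} {x : Jet n} (h : JetFormAt e x)
    (h' : JetFormAt e' x) (v w : Jet n) :
    extD (fun z v => e z v - e' z v) x v w = extD e x v w - extD e' x v w := by
  have key : ∀ v w, lineDeriv ℝ (fun z => e z v - e' z v) x w =
      lineDeriv ℝ (fun z => e z v) x w - lineDeriv ℝ (fun z => e' z v) x w := fun v w =>
    (HasDerivAt.sub ((h.jetAnalyticAt_apply (jetMapAt_const v x)).hasLineDerivAt w)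
      ((h'.jetAnalyticAt_apply (jetMapAt_const v x)).hasLineDerivAt w)).deriv
  unfold extD
  rw [key, key]
  ring

theorem cartanDeriv_comp {Φ : Jet n' → Jet n} {y : Jet n'} {f : Jet n → ℝ} (hΦ : JetMapAt Φ y)
    (hf : AnalyticJetAt f (Φ y)) (h : jetTangent Φ y (cartanField y) = cartanField (Φ y)) :
    cartanDeriv (fun z => f (Φ z)) y = cartanDeriv f (Φ y) := by
  unfold cartanDeriv
  rw [lineDeriv_comp_jet (u := f) hf hΦ, h]

theorem AnalyticJetAt.cartanDeriv_iterate {f : Jet n → ℝ} {x : Jet n} (h : AnalyticJetAt f x)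
    (k : ℕ) : AnalyticJetAt (_root_.cartanDeriv^[k] f) x := by
  induction k with
  | zero => exact h
  | succ k ih =>
    rw [Function.iterate_succ_apply']
    exact ih.cartanDeriv

theorem cartanDeriv_iterate_congr {f f' : Jet n → ℝ} {x : Jet n} (h : f =ᶠ[𝓝 x] f') (k : ℕ) :
    cartanDeriv^[k] f =ᶠ[𝓝 x] cartanDeriv^[k] f' := by
  induction k with
  | zero => exact h
  | succ k ih =>
    simp only [Function.iterate_succ_apply']
    exact cartanDeriv_congr ih

/-- If the tangent map of Φ carries the Cartan field to the Cartan field, then L_τ commutes with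
composition by Φ. An open set is used because each equality has to be differentiated again. -/
theorem cartanDeriv_iterate_comp {Φ : Jet n' → Jet n} {O : Set (Jet n')} (hO : IsOpen O)
    {f : Jet n → ℝ} (hΦ : ∀ y ∈ O, JetMapAt Φ y) (hf : ∀ y ∈ O, AnalyticJetAt f (Φ y))
    (h : ∀ y ∈ O, jetTangent Φ y (cartanField y) = cartanField (Φ y)) (k : ℕ) :
    ∀ y ∈ O, cartanDeriv^[k] (fun z => f (Φ z)) y = cartanDeriv^[k] f (Φ y) := by
  induction k with
  | zero => exact fun _ _ => rfl
  | succ k ih =>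
    intro y hy
    have : cartanDeriv^[k] (fun z => f (Φ z)) =ᶠ[𝓝 y] fun z => cartanDeriv^[k] f (Φ z) := by
      filter_upwards [hO.mem_nhds hy] with z hz
      exact ih z hz
    rw [Function.iterate_succ_apply', Function.iterate_succ_apply',
      (cartanDeriv_congr this).self_of_nhds]
    exact cartanDeriv_comp (hΦ y hy) ((hf y hy).cartanDeriv_iterate k) (h y hy)

/-- The jet map `y ↦ (φ, L φ, L² φ, …)`. -/
def prolong (φ : Fin n → Jet n' → ℝ) : Jet n' → Jet n :=
  fun y k i => cartanDeriv^[k] (φ i) y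

theorem jetMapAt_prolong {φ : Fin n → Jet n' → ℝ} {y : Jet n'} (h : ∀ i, AnalyticJetAt (φ i) y) :
    JetMapAt (prolong φ) y :=
  JetMapAt.of_components fun k i => (h i).cartanDeriv_iterate k

theorem jetTangent_prolong {φ : Fin n → Jet n' → ℝ} {y : Jet n'}
    (h : ∀ i, AnalyticJetAt (φ i) y) (w : Jet n') (k : ℕ) (i : Fin n) :
    jetTangent (prolong φ) y w k i = lineDeriv ℝ (cartanDeriv^[k] (φ i)) y w :=
  jetTangent_apply (jetMapAt_prolong h) w k i

theorem jetTangent_prolong_cartanField {φ : Fin n → Jet n' → ℝ} {y : Jet n'}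
    (h : ∀ i, AnalyticJetAt (φ i) y) :
    jetTangent (prolong φ) y (cartanField y) = cartanField (prolong φ y) := by
  funext k i
  rw [jetTangent_prolong h]
  show _ = cartanDeriv^[k + 1] (φ i) y
  rw [Function.iterate_succ_apply']
  rfl

end JetForms
end

noncomputable section

/-! ### A local retraction onto the set of solution jets -/

namespace ImplicitSystem

variable {n p : ℕ}

-- The functions L_τ^k F and their dependence on the highest derivative

section Structure

variable (S : ImplicitSystem n p)

theorem isOpen_stateJets : IsOpen {y : Jet n | y 0 ∈ S.X} :=
  S.isOpen_X.preimage (continuous_apply 0)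

/-- The vector `L_τ^k F`. -/
def lieEqn (k : ℕ) : Jet n → Fin p → ℝ := fun y i => cartanDeriv^[k] (S.eqn i) y

/-- `∂F/∂ẋ` as a linear map. -/
def velDeriv (q : (Fin n → ℝ) × (Fin n → ℝ)) : (Fin n → ℝ) →L[ℝ] (Fin p → ℝ) :=
  (fderiv ℝ S.F q).comp (ContinuousLinearMap.inr ℝ (Fin n → ℝ) (Fin n → ℝ))

variable {S}

theorem jetAnalyticAt_pair (y : Jet n) : JetAnalyticAt (fun z : Jet n => (z 0, z 1)) y :=
  (jetAnalyticAt_coord 0 y).prodMk (jetAnalyticAt_coord 1 y)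

theorem lineDeriv_pair (y v : Jet n) :
    lineDeriv ℝ (fun z : Jet n => (z 0, z 1)) y v = (v 0, v 1) := by
  have h0 := (jetAnalyticAt_coord 0 y).hasLineDerivAt v
  have h1 := (jetAnalyticAt_coord 1 y).hasLineDerivAt v
  rw [lineDeriv_coord] at h0 h1
  exact (HasDerivAt.prodMk h0 h1).deriv

theorem analyticJetAt_eqn {y : Jet n} (hy : y 0 ∈ S.X) (i : Fin p) :
    AnalyticJetAt (S.eqn i) y := by
  have h : JetAnalyticAt (fun z : Jet n => S.F (z 0, z 1)) y :=
    JetAnalyticAt.comp_analyticAt (G := S.F) (S.analytic_F (y 0, y 1) ⟨hy, trivial⟩)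
      (jetAnalyticAt_pair y)
  exact JetAnalyticAt.comp_analyticAt (G := fun e : Fin p → ℝ => e i)
    ((ContinuousLinearMap.proj (R := ℝ) (φ := fun _ : Fin p => ℝ) i).analyticAt _) h

theorem analyticJetAt_lieEqn {y : Jet n} (hy : y 0 ∈ S.X) (k : ℕ) (i : Fin p) :
    AnalyticJetAt (cartanDeriv^[k] (S.eqn i)) y :=
  (analyticJetAt_eqn hy i).cartanDeriv_iterate k

theorem jetAnalyticAt_lieEqn {y : Jet n} (hy : y 0 ∈ S.X) (k : ℕ) :
    JetAnalyticAt (S.lieEqn k) y :=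
  JetAnalyticAt.pi fun i => analyticJetAt_lieEqn hy k i

theorem analyticAt_velDeriv {q : (Fin n → ℝ) × (Fin n → ℝ)} (hq : q.1 ∈ S.X) :
    AnalyticAt ℝ S.velDeriv q := by
  let C := (ContinuousLinearMap.compL ℝ (Fin n → ℝ) ((Fin n → ℝ) × (Fin n → ℝ)) (Fin p → ℝ)).flip
    (ContinuousLinearMap.inr ℝ (Fin n → ℝ) (Fin n → ℝ))
  have h : AnalyticAt ℝ (fderiv ℝ S.F) q := (S.analytic_F q ⟨hq, trivial⟩).fderiv
  exact AnalyticAt.comp (g := C) (f := fderiv ℝ S.F) (C.analyticAt _) h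

theorem mem_solutionJets_iff {y : Jet n} :
    y ∈ S.solutionJets ↔ y 0 ∈ S.X ∧ ∀ k, S.lieEqn k y = 0 :=
  and_congr_right fun _ => forall_congr' fun _ => funext_iff.symm

theorem lineDeriv_lieEqn_eq_zero {y v : Jet n} (hy : y 0 ∈ S.X) (hv : v ∈ S.solutionTangent y)
    (k : ℕ) : lineDeriv ℝ (S.lieEqn k) y v = 0 := by
  funext i
  rw [← (jetAnalyticAt_lieEqn hy k).lineDeriv_pi v i]
  exact hv k i

variable (S) in
/-- `f` is a function of the derivatives of order at most `N`. -/
def OrderAtMost (f : Jet n → ℝ) (N : ℕ) : Prop :=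
  ∀ y z : Jet n, y 0 ∈ S.X → (∀ j ≤ N, y j = z j) → f y = f z

/-- The function takes the same values along both lines for small parameters, because membership in
X is an open condition on y. -/
theorem OrderAtMost.lineDeriv_eq {f : Jet n → ℝ} {N : ℕ} (h : S.OrderAtMost f N) {y z v w : Jet n}
    (hy : y 0 ∈ S.X) (hyz : ∀ j ≤ N, y j = z j) (hvw : ∀ j ≤ N, v j = w j) :
    lineDeriv ℝ f y v = lineDeriv ℝ f z w := by
  refine Filter.EventuallyEq.deriv_eq ?_
  filter_upwards [(tendsto_line y v).eventually (S.isOpen_stateJets.mem_nhds hy)] with t ht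
  exact h _ _ ht fun j hj => by simp [hyz j hj, hvw j hj]

/-- L_τ differentiates in the direction of the shifted jet, so each application raises the order by
one; F itself has order one. -/
theorem orderAtMost_lieEqn (k : ℕ) (i : Fin p) :
    S.OrderAtMost (cartanDeriv^[k] (S.eqn i)) (k + 1) := by
  induction k with
  | zero =>
    intro y z _ h
    simp [eqn, h 0 (by omega), h 1 (by omega)]
  | succ k ih =>
    intro y z hy h
    rw [Function.iterate_succ_apply']
    exact ih.lineDeriv_eq hy (fun j hj => h j (by omega)) fun j hj => h (j + 1) (by omega)

theorem lieEqn_congr {k : ℕ} {y z : Jet n} (hy : y 0 ∈ S.X) (h : ∀ j ≤ k + 1, y j = z j) :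
    S.lieEqn k y = S.lieEqn k z :=
  funext fun i => orderAtMost_lieEqn k i y z hy h

theorem cartanField_add_single (y : Jet n) (k : ℕ) (w : Fin n → ℝ) :
    cartanField (y + Pi.single (k + 1) w) = cartanField y + Pi.single k w := by
  funext j
  simp only [cartanField, Pi.add_apply]
  congr 1
  by_cases h : j = k
  · subst h; simp
  · rw [Pi.single_eq_of_ne h, Pi.single_eq_of_ne (by omega)]

/-- L_τ^{k+1} F is the differential of L_τ^k F applied to the Cartan field. The derivative of order
k + 2 is absent from L_τ^k F and enters only through the component of order k + 1 of the Cartan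
field, hence linearly. -/
theorem lieEqn_affine_aux (k : ℕ) (i : Fin p) {y : Jet n} (hy : y 0 ∈ S.X) (w : Fin n → ℝ)
    (h : lineDeriv ℝ (cartanDeriv^[k] (S.eqn i)) y (Pi.single (k + 1) w) =
      S.velDeriv (y 0, y 1) w i) :
    cartanDeriv^[k + 1] (S.eqn i) (y + Pi.single (k + 2) w) =
      cartanDeriv^[k + 1] (S.eqn i) y + S.velDeriv (y 0, y 1) w i := by
  rw [Function.iterate_succ_apply', ← h]
  unfold cartanDeriv
  rw [cartanField_add_single]
  have h1 : ∀ v, lineDeriv ℝ (cartanDeriv^[k] (S.eqn i)) (y + Pi.single (k + 2) w) v =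
      lineDeriv ℝ (cartanDeriv^[k] (S.eqn i)) y v := fun v =>
    (orderAtMost_lieEqn k i).lineDeriv_eq (by simpa using hy)
      (fun j hj => by simp [Pi.single_eq_of_ne (show j ≠ k + 2 by omega)]) fun _ _ => rfl
  exact (h1 _).trans (JetAnalyticAt.lineDeriv_add_right (analyticJetAt_lieEqn hy k i) _ _)

theorem lineDeriv_lieEqn_single (k : ℕ) (i : Fin p) {y : Jet n} (hy : y 0 ∈ S.X)
    (w : Fin n → ℝ) :
    lineDeriv ℝ (cartanDeriv^[k] (S.eqn i)) y (Pi.single (k + 1) w) =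
      S.velDeriv (y 0, y 1) w i := by
  induction k generalizing y w with
  | zero =>
    have h : JetAnalyticAt (fun z : Jet n => S.F (z 0, z 1)) y :=
      JetAnalyticAt.comp_analyticAt (G := S.F) (S.analytic_F (y 0, y 1) ⟨hy, trivial⟩)
        (jetAnalyticAt_pair y)
    have h1 := h.lineDeriv_pi (Pi.single (0 + 1) w) i
    rw [JetAnalyticAt.lineDeriv_comp (G := S.F) (S.analytic_F (y 0, y 1) ⟨hy, trivial⟩)
      (jetAnalyticAt_pair y), lineDeriv_pair] at h1
    refine Eq.trans h1 ?_
    simp [velDeriv]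
  | succ k ih =>
    have h : ∀ t : ℝ, cartanDeriv^[k + 1] (S.eqn i) (y + t • (Pi.single (k + 2) w : Jet n)) =
        cartanDeriv^[k + 1] (S.eqn i) y + t * S.velDeriv (y 0, y 1) w i := by
      intro t
      rw [← Pi.single_smul, lieEqn_affine_aux k i hy _ (ih hy _)]
      simp
    have h2 : HasLineDerivAt ℝ (cartanDeriv^[k + 1] (S.eqn i)) (S.velDeriv (y 0, y 1) w i) y
        (Pi.single (k + 2) w) := by
      unfold HasLineDerivAt
      simp only [h]
      simpa using ((hasDerivAt_id (0 : ℝ)).mul_const (S.velDeriv (y 0, y 1) w i)).const_add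
        (cartanDeriv^[k + 1] (S.eqn i) y)
    exact h2.lineDeriv

theorem lieEqn_affine (k : ℕ) {y : Jet n} (hy : y 0 ∈ S.X) (w : Fin n → ℝ) :
    S.lieEqn (k + 1) (y - Pi.single (k + 2) w) = S.lieEqn (k + 1) y - S.velDeriv (y 0, y 1) w := by
  funext i
  have h := lieEqn_affine_aux k i hy (-w) (lineDeriv_lieEqn_single k i hy (-w))
  rw [Pi.single_neg, ← sub_eq_add_neg] at h
  rw [map_neg, Pi.neg_apply, ← sub_eq_add_neg] at h
  exact h

end Structure

/-- Rank p means that ∂F/∂ẋ is onto ℝᵖ. The right inverse R provides the directions in which all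
derivatives are corrected. -/
theorem exists_rightInverse_velDeriv {S : ImplicitSystem n p} {x : Jet n} (h : S.RegularAt x) :
    ∃ R : (Fin p → ℝ) →L[ℝ] (Fin n → ℝ),
      (S.velDeriv (x 0, x 1)).comp R = ContinuousLinearMap.id ℝ _ := by
  have hm : (Matrix.of fun (i : Fin p) (j : Fin n) =>
      fderiv ℝ S.F (x 0, x 1) (0, Pi.single j 1) i) =
      LinearMap.toMatrix' (S.velDeriv (x 0, x 1) : (Fin n → ℝ) →ₗ[ℝ] (Fin p → ℝ)) := by
    ext i j
    simp [LinearMap.toMatrix'_apply, velDeriv]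
  unfold RegularAt at h
  rw [hm, Matrix.rank, ← Matrix.toLin'_apply', Matrix.toLin'_toMatrix'] at h
  have hr : LinearMap.range (S.velDeriv (x 0, x 1) : (Fin n → ℝ) →ₗ[ℝ] (Fin p → ℝ)) = ⊤ :=
    Submodule.eq_top_of_finrank_eq (by simpa using h)
  obtain ⟨R, hR⟩ := LinearMap.exists_rightInverse_of_surjective _ hr
  exact ⟨LinearMap.toContinuousLinearMap R, ContinuousLinearMap.ext fun v =>
    congrArg (fun L : (Fin p → ℝ) →ₗ[ℝ] (Fin p → ℝ) => L v) hR⟩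

/-- Local solution of `F(x, ẋ - R c) = 0` for `c`. -/
theorem exists_velocity_correction {S : ImplicitSystem n p} {q₀ : (Fin n → ℝ) × (Fin n → ℝ)}
    (hq₀ : q₀.1 ∈ S.X) (hF : S.F q₀ = 0) {R : (Fin p → ℝ) →L[ℝ] (Fin n → ℝ)}
    (hR : (S.velDeriv q₀).comp R = ContinuousLinearMap.id ℝ _) :
    ∃ c : (Fin n → ℝ) × (Fin n → ℝ) → (Fin p → ℝ), ∀ᶠ q in 𝓝 q₀, q.1 ∈ S.X ∧ AnalyticAt ℝ c q ∧
      S.F (q.1, q.2 - R (c q)) = 0 ∧ (S.F q = 0 → c q = 0) ∧ IsUnit ((S.velDeriv q).comp R) ∧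
      IsUnit ((S.velDeriv (q.1, q.2 - R (c q))).comp R) := by
  let A : (((Fin n → ℝ) × (Fin n → ℝ)) × (Fin p → ℝ)) →L[ℝ] (Fin n → ℝ) × (Fin n → ℝ) :=
    ((ContinuousLinearMap.fst ℝ _ _).comp (ContinuousLinearMap.fst ℝ _ _)).prod
      ((ContinuousLinearMap.snd ℝ _ _).comp (ContinuousLinearMap.fst ℝ _ _) -
        R.comp (ContinuousLinearMap.snd ℝ _ _))
  have hA : ∀ q c, A (q, c) = (q.1, q.2 - R c) := fun _ _ => rfl
  have hA0 : A (q₀, 0) = q₀ := by simp [hA]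
  have hFa : AnalyticAt ℝ S.F (A (q₀, 0)) := by rw [hA0]; exact S.analytic_F q₀ ⟨hq₀, trivial⟩
  let G : (((Fin n → ℝ) × (Fin n → ℝ)) × (Fin p → ℝ)) → (Fin p → ℝ) := fun v => S.F (A v)
  -- The exponent `⊤` of `WithTop ℕ∞` stands for analyticity, so the implicit function is analytic
  -- too.
  have hG : ContDiffAt ℝ ⊤ G (q₀, 0) :=
    (AnalyticAt.comp (g := S.F) (f := A) hFa (A.analyticAt _)).contDiffAt
  have hG' : fderiv ℝ G (q₀, 0) = (fderiv ℝ S.F q₀).comp A := by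
    have := (hFa.differentiableAt.hasFDerivAt.comp (q₀, (0 : Fin p → ℝ)) A.hasFDerivAt).fderiv
    rw [hA0] at this
    exact this
  -- The partial derivative in c is -(∂F/∂ẋ) R = -1, as the implicit function theorem requires.
  have hinr : (fderiv ℝ G (q₀, 0)).comp (.inr ℝ ((Fin n → ℝ) × (Fin n → ℝ)) (Fin p → ℝ)) =
      -ContinuousLinearMap.id ℝ (Fin p → ℝ) := by
    rw [hG', ← hR]
    refine ContinuousLinearMap.ext fun c => ?_
    have : A (0, c) = -((0 : Fin n → ℝ), R c) := by simp [hA]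
    have h2 : fderiv ℝ S.F q₀ (A (0, c)) = -fderiv ℝ S.F q₀ (0, R c) := by rw [this, map_neg]
    simpa [velDeriv] using h2
  have hinv : ((fderiv ℝ G (q₀, 0)).comp
      (.inr ℝ ((Fin n → ℝ) × (Fin n → ℝ)) (Fin p → ℝ))).IsInvertible := by
    rw [hinr]
    exact ⟨ContinuousLinearEquiv.neg ℝ, by ext; simp⟩
  have hω : (⊤ : WithTop ℕ∞) ≠ 0 := by simp
  let c := hG.implicitFunction hω hinv
  have hG0 : G (q₀, 0) = 0 := by show S.F (A (q₀, 0)) = 0; rw [hA0, hF]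
  have hc0 : c q₀ = 0 := hG.implicitFunction_apply_self hω hinv
  have hca : AnalyticAt ℝ c q₀ := (hG.contDiffAt_implicitFunction hω hinv).analyticAt
  have hunit : ∀ᶠ q in 𝓝 q₀, IsUnit ((S.velDeriv q).comp R) := by
    have hcont : ContinuousAt (fun q => (S.velDeriv q).comp R) q₀ :=
      ((analyticAt_velDeriv hq₀).continuousAt).clm_comp continuousAt_const
    refine hcont.eventually (Units.isOpen.mem_nhds ?_)
    show IsUnit ((S.velDeriv q₀).comp R)
    rw [hR]
    exact isUnit_one
  have hcorr : Tendsto (fun q : (Fin n → ℝ) × (Fin n → ℝ) => (q.1, q.2 - R (c q))) (𝓝 q₀)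
      (𝓝 q₀) := by
    have : ContinuousAt (fun q : (Fin n → ℝ) × (Fin n → ℝ) => (q.1, q.2 - R (c q))) q₀ :=
      continuousAt_fst.prodMk (continuousAt_snd.sub (R.continuous.continuousAt.comp
        hca.continuousAt))
    simpa [ContinuousAt, hc0] using this
  have hiff : ∀ᶠ q in 𝓝 q₀, G (q, 0) = G (q₀, 0) ↔ c q = 0 := by
    have : Tendsto (fun q : (Fin n → ℝ) × (Fin n → ℝ) => (q, (0 : Fin p → ℝ))) (𝓝 q₀)
      (𝓝 (q₀, 0)) := (Continuous.prodMk_left _).tendsto q₀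
    exact this.eventually (hG.eventually_apply_eq_iff_implicitFunction hω hinv)
  refine ⟨c, ?_⟩
  filter_upwards [continuousAt_fst.eventually (S.isOpen_X.mem_nhds hq₀), hca.eventually_analyticAt,
    hG.eventually_apply_implicitFunction hω hinv, hiff, hunit, hcorr.eventually hunit]
    with q h1 h2 h3 h4 h5 h6
  refine ⟨h1, h2, h3.trans hG0, fun h => h4.1 ?_, h5, h6⟩
  rw [hG0]
  show S.F (A (q, 0)) = 0
  simpa [hA] using h

end ImplicitSystem
end

noncomputable section

namespace ImplicitSystem

variable {n p : ℕ}

-- Successive correction of the derivatives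

section Newton

variable (S : ImplicitSystem n p) (R : (Fin p → ℝ) →L[ℝ] (Fin n → ℝ))
  (c : (Fin n → ℝ) × (Fin n → ℝ) → (Fin p → ℝ))

/-- The correction of the derivative of order `k + 1` that achieves `L_τ^k F = 0`. -/
def newtonCorr : ℕ → Jet n → Fin n → ℝ
  | 0, y => R (c (y 0, y 1))
  | k + 1, y => R (Ring.inverse ((S.velDeriv (y 0, y 1)).comp R) (S.lieEqn (k + 1) y))

/-- Correct the derivative of order `k + 1`. -/
def newtonStep (k : ℕ) (y : Jet n) : Jet n := y - Pi.single (k + 1) (S.newtonCorr R c k y)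

/-- Correct the derivatives of orders `1, …, k` successively. -/
def newtonIter : ℕ → Jet n → Jet n
  | 0, y => y
  | k + 1, y => S.newtonStep R c k (newtonIter k y)

/-- Correct all derivatives. -/
def newtonLimit (y : Jet n) : Jet n := fun k => S.newtonIter R c k y k

/-- The conditions under which the corrections are defined. -/
def NewtonDomain (q : (Fin n → ℝ) × (Fin n → ℝ)) : Prop :=
  q.1 ∈ S.X ∧ AnalyticAt ℝ c q ∧
    S.F (q.1, q.2 - R (c q)) = 0 ∧ (S.F q = 0 → c q = 0) ∧ IsUnit ((S.velDeriv q).comp R) ∧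
    IsUnit ((S.velDeriv (q.1, q.2 - R (c q))).comp R)

variable {S R c}

theorem newtonStep_of_ne {k j : ℕ} (h : j ≠ k + 1) (y : Jet n) : S.newtonStep R c k y j = y j := by
  simp [newtonStep, Pi.single_eq_of_ne h]

/-- Step k changes only the derivative of order k + 1, so the derivative of order j is final after j
steps. This is why the diagonal definition of `newtonLimit` needs no convergence argument. -/
theorem newtonIter_of_le {k j : ℕ} (h : j ≤ k) (y : Jet n) :
    S.newtonIter R c k y j = S.newtonLimit R c y j := by
  induction k, h using Nat.le_induction with
  | base => rfl
  | succ k hk ih => exact (newtonStep_of_ne (by omega) _).trans ih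

theorem newtonIter_zero_coord (k : ℕ) (y : Jet n) : S.newtonIter R c k y 0 = y 0 :=
  newtonIter_of_le (Nat.zero_le k) y

theorem newtonIter_one_coord (k : ℕ) (y : Jet n) :
    S.newtonIter R c (k + 1) y 1 = y 1 - R (c (y 0, y 1)) := by
  rw [newtonIter_of_le (by omega), ← newtonIter_of_le le_rfl]
  simp [newtonIter, newtonStep, newtonCorr]

variable {y : Jet n}

theorem jetAnalyticAt_newtonCorr {k : ℕ} (hX : y 0 ∈ S.X)
    (h0 : k = 0 → AnalyticAt ℝ c (y 0, y 1))
    (h1 : k ≠ 0 → IsUnit ((S.velDeriv (y 0, y 1)).comp R)) :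
    JetAnalyticAt (S.newtonCorr R c k) y := by
  cases k with
  | zero =>
    exact JetAnalyticAt.comp_analyticAt (G := R) (R.analyticAt _)
      (JetAnalyticAt.comp_analyticAt (G := c) (h0 rfl) (jetAnalyticAt_pair y))
  | succ k =>
    have h2 : JetAnalyticAt (fun z : Jet n => S.velDeriv (z 0, z 1)) y :=
      JetAnalyticAt.comp_analyticAt (G := S.velDeriv) (analyticAt_velDeriv hX)
        (jetAnalyticAt_pair y)
    let C := (ContinuousLinearMap.compL ℝ (Fin p → ℝ) (Fin n → ℝ) (Fin p → ℝ)).flip R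
    have h3 : JetAnalyticAt (fun z : Jet n => (S.velDeriv (z 0, z 1)).comp R) y :=
      JetAnalyticAt.comp_analyticAt (G := C) (C.analyticAt _) h2
    obtain ⟨a, ha⟩ := h1 (by omega)
    have h4 : JetAnalyticAt (fun z : Jet n => Ring.inverse ((S.velDeriv (z 0, z 1)).comp R)) y :=
      JetAnalyticAt.comp_analyticAt (G := Ring.inverse) (by
        rw [← ha]
        exact analyticAt_inverse a) h3
    have h5 : JetAnalyticAt (fun z : Jet n =>
        Ring.inverse ((S.velDeriv (z 0, z 1)).comp R) (S.lieEqn (k + 1) z)) y :=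
      JetAnalyticAt.comp_analyticAt (u := fun z : Jet n =>
          (Ring.inverse ((S.velDeriv (z 0, z 1)).comp R), S.lieEqn (k + 1) z))
        (G := fun q : ((Fin p → ℝ) →L[ℝ] (Fin p → ℝ)) × (Fin p → ℝ) => q.1 q.2)
        ((ContinuousLinearMap.id ℝ ((Fin p → ℝ) →L[ℝ] (Fin p → ℝ))).analyticAt_bilinear
          (Ring.inverse ((S.velDeriv (y 0, y 1)).comp R), S.lieEqn (k + 1) y))
        (h4.prodMk (jetAnalyticAt_lieEqn hX _))
    exact JetAnalyticAt.comp_analyticAt (u := fun z : Jet n =>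
      Ring.inverse ((S.velDeriv (z 0, z 1)).comp R) (S.lieEqn (k + 1) z)) (G := R)
      (R.analyticAt _) h5

theorem jetMapAt_newtonStep {k : ℕ} (h : JetAnalyticAt (S.newtonCorr R c k) y) :
    JetMapAt (S.newtonStep R c k) y := by
  intro j
  by_cases hj : j = k + 1
  · subst hj
    simpa [newtonStep] using (jetAnalyticAt_coord _ y).sub h
  · simp only [newtonStep_of_ne hj]
    exact jetAnalyticAt_coord _ y

/-- The first correction replaces (x, ẋ) by (x, ẋ - R c) and the later ones leave this pair alone.
All higher corrections thus invert the same matrix, the one in the last clause of `NewtonDomain`. -/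
theorem NewtonDomain.jetAnalyticAt_newtonCorr_iter (h : S.NewtonDomain R c (y 0, y 1)) (k : ℕ) :
    JetAnalyticAt (S.newtonCorr R c k) (S.newtonIter R c k y) := by
  refine jetAnalyticAt_newtonCorr (by rw [newtonIter_zero_coord]; exact h.1) ?_ ?_
  · rintro rfl
    exact h.2.1
  · intro hk
    obtain ⟨k, rfl⟩ := Nat.exists_eq_succ_of_ne_zero hk
    rw [newtonIter_zero_coord, newtonIter_one_coord]
    exact h.2.2.2.2.2

theorem NewtonDomain.jetMapAt_newtonIter (h : S.NewtonDomain R c (y 0, y 1)) (k : ℕ) :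
    JetMapAt (S.newtonIter R c k) y := by
  induction k with
  | zero => exact jetMapAt_id y
  | succ k ih => exact (jetMapAt_newtonStep (h.jetAnalyticAt_newtonCorr_iter k)).comp ih

theorem NewtonDomain.jetMapAt_newtonLimit (h : S.NewtonDomain R c (y 0, y 1)) :
    JetMapAt (S.newtonLimit R c) y :=
  fun k => h.jetMapAt_newtonIter k k

/-- L_τ^k F has order k + 1, so it may be evaluated at the iterate k + 1. There it vanishes: by the
choice of c for k = 0, and for larger k because it is affine in the corrected derivative and the
correction solves this linear equation. -/
theorem NewtonDomain.newtonLimit_mem (h : S.NewtonDomain R c (y 0, y 1)) :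
    S.newtonLimit R c y ∈ S.solutionJets := by
  refine mem_solutionJets_iff.2 ⟨h.1, fun k => ?_⟩
  have hX : S.newtonLimit R c y 0 ∈ S.X := h.1
  rw [lieEqn_congr hX fun j hj => (newtonIter_of_le hj y).symm]
  cases k with
  | zero =>
    show S.F (S.newtonIter R c 1 y 0, S.newtonIter R c 1 y 1) = 0
    rw [newtonIter_zero_coord, newtonIter_one_coord]
    exact h.2.2.1
  | succ k =>
    set z := S.newtonIter R c (k + 1) y with hz
    have hz0 : z 0 = y 0 := newtonIter_zero_coord _ _
    have hz1 : z 1 = y 1 - R (c (y 0, y 1)) := newtonIter_one_coord _ _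
    have hu : IsUnit ((S.velDeriv (z 0, z 1)).comp R) := by rw [hz0, hz1]; exact h.2.2.2.2.2
    show S.lieEqn (k + 1) (z - Pi.single (k + 2) (S.newtonCorr R c (k + 1) z)) = 0
    rw [lieEqn_affine k (by rw [hz0]; exact h.1), sub_eq_zero]
    have h2 := congrArg (fun L : (Fin p → ℝ) →L[ℝ] (Fin p → ℝ) => L (S.lieEqn (k + 1) z))
      (Ring.mul_inverse_cancel _ hu)
    exact h2.symm

theorem NewtonDomain.newtonCorr_eq_zero (h : S.NewtonDomain R c (y 0, y 1))
    (hy : y ∈ S.solutionJets) (k : ℕ) : S.newtonCorr R c k y = 0 := by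
  have hy' := (mem_solutionJets_iff.1 hy).2 k
  cases k with
  | zero =>
    have : c (y 0, y 1) = 0 := h.2.2.2.1 hy'
    simp [newtonCorr, this]
  | succ k => simp [newtonCorr, hy']

theorem NewtonDomain.newtonIter_eq_self (h : S.NewtonDomain R c (y 0, y 1))
    (hy : y ∈ S.solutionJets) (k : ℕ) : S.newtonIter R c k y = y := by
  induction k with
  | zero => rfl
  | succ k ih => simp [newtonIter, ih, newtonStep, h.newtonCorr_eq_zero hy k]

/-- For k = 0, differentiate F(x, ẋ - R c) = 0 at a solution, where c = 0: along a tangent vector dF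
= 0, so (∂F/∂ẋ) R dc = 0 and dc = 0. For k > 0 the correction is linear in L_τ^k F, which vanishes
at the point together with its derivative along the vector. -/
theorem lineDeriv_newtonCorr_eq_zero (h : ∀ᶠ q in 𝓝 (y 0, y 1), S.NewtonDomain R c q)
    (hy : y ∈ S.solutionJets) {v : Jet n} (hv : v ∈ S.solutionTangent y) (k : ℕ) :
    lineDeriv ℝ (S.newtonCorr R c k) y v = 0 := by
  have hd := h.self_of_nhds
  have hy' := (mem_solutionJets_iff.1 hy).2 k
  have hv' := lineDeriv_lieEqn_eq_zero hd.1 hv k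
  cases k with
  | zero =>
    have hc0 : c (y 0, y 1) = 0 := hd.2.2.2.1 hy'
    have hca : JetAnalyticAt (fun z : Jet n => c (z 0, z 1)) y :=
      JetAnalyticAt.comp_analyticAt (G := c) hd.2.1 (jetAnalyticAt_pair y)
    have hFa : AnalyticAt ℝ S.F (y 0, y 1) := S.analytic_F _ ⟨hd.1, trivial⟩
    let A : (((Fin n → ℝ) × (Fin n → ℝ)) × (Fin p → ℝ)) →L[ℝ] (Fin n → ℝ) × (Fin n → ℝ) :=
      ((ContinuousLinearMap.fst ℝ _ _).comp (ContinuousLinearMap.fst ℝ _ _)).prod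
        ((ContinuousLinearMap.snd ℝ _ _).comp (ContinuousLinearMap.fst ℝ _ _) -
          R.comp (ContinuousLinearMap.snd ℝ _ _))
    have hA : ∀ q c, A (q, c) = (q.1, q.2 - R c) := fun _ _ => rfl
    have hqc := (jetAnalyticAt_pair y).prodMk hca
    have hAa := JetAnalyticAt.comp_analyticAt (G := A) (A.analyticAt _) hqc
    have hA0 : A ((y 0, y 1), c (y 0, y 1)) = (y 0, y 1) := by simp [hA, hc0]
    have h1 : lineDeriv ℝ (fun z : Jet n => S.F (A ((z 0, z 1), c (z 0, z 1)))) y v = 0 := by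
      have : (fun z : Jet n => S.F (A ((z 0, z 1), c (z 0, z 1)))) =ᶠ[𝓝 y] fun _ => 0 := by
        filter_upwards [(jetAnalyticAt_pair y).continuousAt.eventually h] with z hz
        exact hz.2.2.1
      rw [lineDeriv_congr this]
      simp [lineDeriv]
    have hpair : lineDeriv ℝ (fun z : Jet n => ((z 0, z 1), c (z 0, z 1))) y v =
        ((v 0, v 1), lineDeriv ℝ (fun z : Jet n => c (z 0, z 1)) y v) := by
      have h1 := (jetAnalyticAt_pair y).hasLineDerivAt v
      rw [lineDeriv_pair] at h1
      exact (HasDerivAt.prodMk h1 (hca.hasLineDerivAt v)).deriv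
    rw [JetAnalyticAt.lineDeriv_comp (G := S.F) (by rwa [hA0]) hAa,
      JetAnalyticAt.lineDeriv_comp (G := A) (A.analyticAt _) hqc, hpair, A.fderiv, hA0] at h1
    have hF : fderiv ℝ S.F (y 0, y 1) (v 0, v 1) = 0 := by
      rw [← lineDeriv_pair y v, ← JetAnalyticAt.lineDeriv_comp (G := S.F) hFa (jetAnalyticAt_pair y)]
      exact hv'
    set dc := lineDeriv ℝ (fun z : Jet n => c (z 0, z 1)) y v with hdc
    have hsplit : A ((v 0, v 1), dc) = (v 0, v 1) - ((0 : Fin n → ℝ), R dc) := by simp [hA]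
    -- Now `h1` says that (∂F/∂ẋ) R dc = 0.
    rw [hsplit, map_sub, hF, zero_sub, neg_eq_zero] at h1
    have h2 : ((S.velDeriv (y 0, y 1)).comp R) dc = 0 := h1
    have h3 := congrArg (fun L : (Fin p → ℝ) →L[ℝ] (Fin p → ℝ) => L dc)
      (Ring.inverse_mul_cancel _ hd.2.2.2.2.1)
    have h4 : dc = 0 := by
      refine Eq.trans h3.symm ?_
      rw [mul_apply_eq_comp, h2, map_zero]
    show lineDeriv ℝ (fun z : Jet n => R (c (z 0, z 1))) y v = 0
    rw [JetAnalyticAt.lineDeriv_comp (G := R) (R.analyticAt _) hca, ← hdc, h4, map_zero]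
  | succ k =>
    obtain ⟨N, L, hL⟩ := (jetAnalyticAt_newtonCorr (S := S) (R := R) (c := c) (k := k + 1) hd.1
      (by simp) fun _ => hd.2.2.2.2.1).exists_lineDeriv_eq
    have h2 : JetAnalyticAt (fun z : Jet n => S.velDeriv (z 0, z 1)) y :=
      JetAnalyticAt.comp_analyticAt (G := S.velDeriv) (analyticAt_velDeriv hd.1)
        (jetAnalyticAt_pair y)
    let C := (ContinuousLinearMap.compL ℝ (Fin p → ℝ) (Fin n → ℝ) (Fin p → ℝ)).flip R
    have h3 : JetAnalyticAt (fun z : Jet n => (S.velDeriv (z 0, z 1)).comp R) y :=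
      JetAnalyticAt.comp_analyticAt (G := C) (C.analyticAt _) h2
    obtain ⟨a, ha⟩ := hd.2.2.2.2.1
    have h4 : JetAnalyticAt (fun z : Jet n => Ring.inverse ((S.velDeriv (z 0, z 1)).comp R)) y :=
      JetAnalyticAt.comp_analyticAt (G := Ring.inverse) (by
        rw [← ha]
        exact analyticAt_inverse a) h3
    have h5 := HasDerivAt.clm_apply (h4.hasLineDerivAt v)
      ((jetAnalyticAt_lieEqn hd.1 (k + 1)).hasLineDerivAt v)
    simp only [zero_smul, add_zero, hy', hv', map_zero] at h5
    exact (R.hasFDerivAt.comp_hasDerivAt (0 : ℝ) h5).deriv.trans (map_zero R)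

theorem jetTangent_newtonStep {k : ℕ} (h : JetAnalyticAt (S.newtonCorr R c k) y) {v : Jet n}
    (hv : lineDeriv ℝ (S.newtonCorr R c k) y v = 0) : jetTangent (S.newtonStep R c k) y v = v := by
  funext j
  unfold jetTangent
  by_cases hj : j = k + 1
  · subst hj
    have h1 := HasDerivAt.sub ((jetAnalyticAt_coord (k + 1) y).hasLineDerivAt v)
      (h.hasLineDerivAt v)
    rw [hv, lineDeriv_coord, sub_zero] at h1
    have h2 : (fun z : Jet n => S.newtonStep R c k z (k + 1)) =
        fun z => z (k + 1) - S.newtonCorr R c k z := by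
      funext z
      simp [newtonStep]
    rw [h2]
    exact h1.deriv
  · simp only [newtonStep_of_ne hj]
    exact lineDeriv_coord j y v

theorem jetTangent_newtonIter (h : ∀ᶠ q in 𝓝 (y 0, y 1), S.NewtonDomain R c q)
    (hy : y ∈ S.solutionJets) {v : Jet n} (hv : v ∈ S.solutionTangent y) (k : ℕ) :
    jetTangent (S.newtonIter R c k) y v = v := by
  have hd := h.self_of_nhds
  induction k with
  | zero => exact funext fun j => lineDeriv_coord j y v
  | succ k ih =>
    have h1 := hd.jetAnalyticAt_newtonCorr_iter k
    have h2 := jetTangent_comp (jetMapAt_newtonStep h1) (hd.jetMapAt_newtonIter k) v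
    rw [hd.newtonIter_eq_self hy] at h1 h2
    rw [ih, jetTangent_newtonStep h1 (lineDeriv_newtonCorr_eq_zero h hy hv k)] at h2
    exact h2

end Newton

-- Calculus on the solution set by means of the retraction

/-- `ρ` is an analytic retraction of the open set `O` of jets onto the solution jets in `O`, with the
tangent spaces `solutionTangent`. -/
structure IsRetraction (S : ImplicitSystem n p) (O : Set (Jet n)) (ρ : Jet n → Jet n) : Prop where
  isOpen : IsOpen O
  jetMapAt : ∀ x ∈ O, JetMapAt ρ x
  mem : ∀ x ∈ O, ρ x ∈ S.solutionJets
  eq_self : ∀ x ∈ O, x ∈ S.solutionJets → ρ x = x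
  -- This is a separate condition because `solutionTangent` is defined by equations and not by
  -- velocities of curves of solutions.
  tangent : ∀ x ∈ O, x ∈ S.solutionJets → ∀ v ∈ S.solutionTangent x, jetTangent ρ x v = v

theorem exists_isRetraction {S : ImplicitSystem n p} {x₀ : Jet n} (hx₀ : x₀ ∈ S.solutionJets)
    (hreg : S.RegularAt x₀) : ∃ O ρ, x₀ ∈ O ∧ S.IsRetraction O ρ := by
  obtain ⟨R, hR⟩ := exists_rightInverse_velDeriv hreg
  obtain ⟨c, hc⟩ := exists_velocity_correction hx₀.1
    ((mem_solutionJets_iff.1 hx₀).2 0) hR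
  have hc' : ∀ᶠ q in 𝓝 (x₀ 0, x₀ 1), S.NewtonDomain R c q := hc
  obtain ⟨W, hW, hWo, hxW⟩ := eventually_nhds_iff.1 hc'
  have hmem : ∀ x : Jet n, (x 0, x 1) ∈ W → ∀ᶠ q in 𝓝 (x 0, x 1), S.NewtonDomain R c q :=
    fun x hx => Filter.mem_of_superset (hWo.mem_nhds hx) hW
  refine ⟨{x : Jet n | (x 0, x 1) ∈ W}, S.newtonLimit R c, hxW,
    ⟨hWo.preimage (by fun_prop), fun x hx => (hW _ hx).jetMapAt_newtonLimit,
      fun x hx => (hW _ hx).newtonLimit_mem, fun x hx hx' => ?_, fun x hx hx' v hv => ?_⟩⟩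
  · exact funext fun k => congrFun ((hW _ hx).newtonIter_eq_self hx' k) k
  · exact funext fun k => congrFun (jetTangent_newtonIter (hmem x hx) hx' hv k) k

/-- Differentiate the identities L_τ^k F ∘ Φ = 0. -/
theorem jetTangent_mem_solutionTangent {S : ImplicitSystem n p} {n' : ℕ} {Φ : Jet n' → Jet n}
    {y : Jet n'} (hΦ : JetMapAt Φ y) (h : ∀ᶠ z in 𝓝 y, Φ z ∈ S.solutionJets) (w : Jet n') :
    jetTangent Φ y w ∈ S.solutionTangent (Φ y) := by
  intro k i
  rw [← lineDeriv_comp_jet (u := cartanDeriv^[k] (S.eqn i))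
    (analyticJetAt_lieEqn h.self_of_nhds.1 k i) hΦ]
  have : (fun z => cartanDeriv^[k] (S.eqn i) (Φ z)) =ᶠ[𝓝 y] fun _ => 0 :=
    h.mono fun z hz => hz.2 k i
  rw [lineDeriv_congr this]
  simp [lineDeriv]

/-- The differential of L_τ^k F along τ is L_τ^{k+1} F, which vanishes. Since τ is tangent to the
solution set, Lie derivatives there depend only on restrictions to it. -/
theorem cartanField_mem_solutionTangent {S : ImplicitSystem n p} {x : Jet n}
    (hx : x ∈ S.solutionJets) : cartanField x ∈ S.solutionTangent x := by
  intro k i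
  have := hx.2 (k + 1) i
  rwa [Function.iterate_succ_apply'] at this

namespace IsRetraction

variable {S : ImplicitSystem n p} {O : Set (Jet n)} {ρ : Jet n → Jet n} {x : Jet n}

theorem eventually_mem (h : S.IsRetraction O ρ) (hx : x ∈ O) : ∀ᶠ z in 𝓝 x, z ∈ O :=
  h.isOpen.mem_nhds hx

theorem jetTangent_mem (h : S.IsRetraction O ρ) (hx : x ∈ O) (v : Jet n) :
    jetTangent ρ x v ∈ S.solutionTangent (ρ x) :=
  jetTangent_mem_solutionTangent (h.jetMapAt x hx) ((h.eventually_mem hx).mono h.mem) v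

theorem tendsto (h : S.IsRetraction O ρ) (hx : x ∈ O) (hx' : x ∈ S.solutionJets) :
    Tendsto ρ (𝓝 x) (𝓝 x) := by
  have := (h.jetMapAt x hx).continuousAt
  rwa [ContinuousAt, h.eq_self x hx hx'] at this

/-- A function that vanishes on the solution jets has derivative zero on the tangent space. -/
theorem lineDeriv_eq_zero (h : S.IsRetraction O ρ) (hx : x ∈ O) (hx' : x ∈ S.solutionJets)
    {f : Jet n → ℝ} (hf : AnalyticJetAt f x) (hf0 : ∀ᶠ z in 𝓝 x, z ∈ S.solutionJets → f z = 0)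
    {v : Jet n} (hv : v ∈ S.solutionTangent x) : lineDeriv ℝ f x v = 0 := by
  have hρx := h.eq_self x hx hx'
  -- On the tangent space f and f ∘ ρ have the same derivative, and f ∘ ρ vanishes on a whole
  -- neighbourhood.
  have h1 := lineDeriv_comp_jet (u := f) (Φ := ρ) (y := x) (by rwa [hρx]) (h.jetMapAt x hx) v
  rw [hρx, h.tangent x hx hx' v hv] at h1
  have h2 : (fun z => f (ρ z)) =ᶠ[𝓝 x] fun _ => 0 := by
    filter_upwards [(h.tendsto hx hx').eventually hf0, h.eventually_mem hx] with z hz hzO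
    exact hz (h.mem z hzO)
  rw [← h1, lineDeriv_congr h2]
  simp [lineDeriv]

/-- Two functions that agree on the solution jets have the same derivatives on the tangent space. -/
theorem lineDeriv_eq (h : S.IsRetraction O ρ) (hx : x ∈ O) (hx' : x ∈ S.solutionJets)
    {f f' : Jet n → ℝ} (hf : AnalyticJetAt f x) (hf' : AnalyticJetAt f' x)
    (hff : ∀ᶠ z in 𝓝 x, z ∈ S.solutionJets → f z = f' z)
    {v : Jet n} (hv : v ∈ S.solutionTangent x) : lineDeriv ℝ f x v = lineDeriv ℝ f' x v := by
  have h1 := h.lineDeriv_eq_zero hx hx' (f := fun z => f z - f' z) (JetAnalyticAt.sub hf hf')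
    (hff.mono fun z hz hz' => sub_eq_zero.2 (hz hz')) hv
  rw [show lineDeriv ℝ (fun z => f z - f' z) x v = _ from
    (HasDerivAt.sub (JetAnalyticAt.hasLineDerivAt hf v)
      (JetAnalyticAt.hasLineDerivAt hf' v)).deriv] at h1
  exact sub_eq_zero.1 h1

/-- Two functions equal on the solution set have equal derivatives along the tangent vector τ, so
the equality passes to L_τ and can be iterated. -/
theorem cartanDeriv_iterate_eq (h : S.IsRetraction O ρ) {O' : Set (Jet n)} (hO' : IsOpen O')
    (hO'O : O' ⊆ O) {f f' : Jet n → ℝ} (hf : ∀ x ∈ O', AnalyticJetAt f x)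
    (hf' : ∀ x ∈ O', AnalyticJetAt f' x)
    (hff : ∀ x ∈ O', x ∈ S.solutionJets → f x = f' x) (k : ℕ) :
    ∀ x ∈ O', x ∈ S.solutionJets → cartanDeriv^[k] f x = cartanDeriv^[k] f' x := by
  induction k with
  | zero => exact hff
  | succ k ih =>
    intro x hx hx'
    rw [Function.iterate_succ_apply', Function.iterate_succ_apply']
    exact h.lineDeriv_eq (hO'O hx) hx' ((hf x hx).cartanDeriv_iterate k)
      ((hf' x hx).cartanDeriv_iterate k)
      (Filter.mem_of_superset (hO'.mem_nhds hx) ih) (cartanField_mem_solutionTangent hx')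

/-- A form that vanishes on the solution jets is closed there. -/
theorem extD_eq_zero (h : S.IsRetraction O ρ) (hx : x ∈ O) (hx' : x ∈ S.solutionJets)
    {e : Jet n → Jet n → ℝ} (he : JetFormAt e x)
    (he0 : ∀ᶠ z in 𝓝 x, z ∈ S.solutionJets → ∀ v ∈ S.solutionTangent z, e z v = 0)
    {v w : Jet n} (hv : v ∈ S.solutionTangent x) (hw : w ∈ S.solutionTangent x) :
    extD e x v w = 0 := by
  have hρx := h.eq_self x hx hx'
  -- The pullback of e by ρ is zero on a neighbourhood, and d commutes with pullback; on the tangent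
  -- space ρ acts as the identity.
  have h1 := (JetFormAt.pull (h.jetMapAt x hx) (by rwa [hρx])).2 v w
  rw [h.tangent x hx hx' v hv, h.tangent x hx hx' w hw, hρx] at h1
  have h2 : ∀ᶠ z in 𝓝 x, ∀ v, formPull ρ e z v = (fun _ _ => 0 : Jet n → Jet n → ℝ) z v := by
    filter_upwards [(h.tendsto hx hx').eventually he0, h.eventually_mem hx] with z hz hzO v
    exact hz (h.mem z hzO) _ (h.jetTangent_mem hzO v)
  rw [← h1, extD_congr h2]
  simp [extD, lineDeriv]

/-- The Lie derivative of a form that vanishes on the solution jets vanishes there. -/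
theorem formLie_eq_zero (h : S.IsRetraction O ρ) (hx : x ∈ O) (hx' : x ∈ S.solutionJets)
    {e : Jet n → Jet n → ℝ} (he : JetFormAt e x)
    (he0 : ∀ᶠ z in 𝓝 x, z ∈ S.solutionJets → ∀ v ∈ S.solutionTangent z, e z v = 0)
    {v : Jet n} (hv : v ∈ S.solutionTangent x) : formLie e x v = 0 := by
  -- Cartan's formula: the contraction of de with the tangent vector τ vanishes, and the function
  -- e(τ) vanishes on the solution set.
  rw [formLie_eq he, h.extD_eq_zero hx hx' he he0 (cartanField_mem_solutionTangent hx') hv,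
    zero_add]
  refine h.lineDeriv_eq_zero hx hx' (he.jetAnalyticAt_apply (jetMapAt_cartanField x)) ?_ hv
  filter_upwards [he0] with z hz hz'
  exact hz hz' _ (cartanField_mem_solutionTangent hz')

end IsRetraction

end ImplicitSystem
end

noncomputable section

/-! ### Primitives of analytic forms and functional dependence -/

section Analysis

variable {E F G : Type*} [NormedAddCommGroup E] [NormedSpace ℝ E] [NormedAddCommGroup F]
  [NormedSpace ℝ F] [NormedAddCommGroup G] [NormedSpace ℝ G]

/-- Termwise integration of a power series along rays. -/
theorem hasSum_integral_ray {η : E → (E →L[ℝ] ℝ)} {h : E → ℝ} {x₀ : E} {r : ENNReal}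
    {P : FormalMultilinearSeries ℝ E (E →L[ℝ] ℝ)} (hP : HasFPowerSeriesOnBall η P x₀ r)
    (hh : ∀ x ∈ Metric.eball x₀ r, HasFDerivAt h (η x) x) {y : E} (hy : y ∈ Metric.eball 0 r) :
    HasSum (fun k : ℕ => (k + 1 : ℝ)⁻¹ * P k (fun _ => y) y) (h (x₀ + y) - h x₀) := by
  have hball : ∀ t ∈ Set.uIcc (0 : ℝ) 1, t • y ∈ Metric.eball (0 : E) r := by
    intro t ht
    rw [Set.uIcc_of_le zero_le_one] at ht
    rw [mem_eball_zero_iff] at hy ⊢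
    refine lt_of_le_of_lt ?_ hy
    rw [enorm_smul]
    have : ‖t‖ₑ ≤ 1 := by
      rw [← ofReal_norm, Real.norm_of_nonneg ht.1]
      exact ENNReal.ofReal_le_one.2 ht.2
    calc ‖t‖ₑ * ‖y‖ₑ ≤ 1 * ‖y‖ₑ := by gcongr
      _ = ‖y‖ₑ := one_mul _
  have hmem : ∀ t ∈ Set.uIcc (0 : ℝ) 1, x₀ + t • y ∈ Metric.eball x₀ r := by
    intro t ht
    have := hball t ht
    simpa [Metric.mem_eball, edist_eq_enorm_sub] using this
  have hderiv : ∀ t ∈ Set.uIcc (0 : ℝ) 1,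
      HasDerivAt (fun t : ℝ => h (x₀ + t • y)) (η (x₀ + t • y) y) t := by
    intro t ht
    have h1 : HasDerivAt (fun t : ℝ => x₀ + t • y) y t := by
      simpa using ((hasDerivAt_id t).smul_const y).const_add x₀
    exact (hh _ (hmem t ht)).comp_hasDerivAt t h1
  have hcont : ContinuousOn (fun t : ℝ => η (x₀ + t • y) y) (Set.uIcc 0 1) := by
    have h1 : ContinuousOn (fun t : ℝ => η (x₀ + t • y)) (Set.uIcc 0 1) :=
      hP.continuousOn.comp (by fun_prop) hmem
    exact h1.clm_apply continuousOn_const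
  have hint := intervalIntegral.integral_eq_sub_of_hasDerivAt hderiv hcont.intervalIntegrable
  simp only [one_smul, zero_smul, add_zero] at hint
  rw [← hint]
  have hsummable : Summable fun k : ℕ => ‖P k (fun _ => y) y‖ := by
    have h1 := P.summable_norm_apply (Metric.eball_subset_eball hP.r_le hy)
    exact Summable.of_nonneg_of_le (fun _ => norm_nonneg _)
      (fun k => (P k fun _ => y).le_opNorm y) (h1.mul_right ‖y‖)
  -- The increment of h is the integral of η(x₀ + t y) y over [0, 1]. Its k-th term is t^k P_k(y, …,
  -- y) y, dominated by the value at t = 1.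
  have hsum := intervalIntegral.hasSum_integral_of_dominated_convergence
    (μ := MeasureTheory.volume) (a := 0) (b := 1)
    (F := fun (k : ℕ) (t : ℝ) => t ^ k * P k (fun _ => y) y) (f := fun t => η (x₀ + t • y) y)
    (fun k _ => ‖P k (fun _ => y) y‖)
    (fun k => (by fun_prop : Continuous fun t : ℝ => t ^ k * P k (fun _ => y) y).aestronglyMeasurable)
    (fun k => Eventually.of_forall fun t ht => by
      rw [Set.uIoc_of_le zero_le_one] at ht
      rw [norm_mul, norm_pow, Real.norm_of_nonneg ht.1.le]
      exact mul_le_of_le_one_left (norm_nonneg _) (pow_le_one₀ ht.1.le ht.2))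
    (Eventually.of_forall fun _ _ => hsummable) intervalIntegrable_const
    (Eventually.of_forall fun t ht => by
      have h1 := hP.hasSum (hball t (Set.uIoc_subset_uIcc ht))
      have h2 := (ContinuousLinearMap.apply ℝ ℝ y).hasSum h1
      have h3 : (fun k => t ^ k * P k (fun _ => y) y) =
          fun k => ContinuousLinearMap.apply ℝ ℝ y (P k fun _ => t • y) := by
        funext k
        rw [(P k).map_smul_univ (fun _ => t) (fun _ => y)]
        simp
      rw [h3]
      exact h2)
  have hterm : (fun k : ℕ => (k + 1 : ℝ)⁻¹ * P k (fun _ => y) y) =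
      fun k : ℕ => ∫ t in (0 : ℝ)..1, t ^ k * P k (fun _ => y) y := by
    funext k
    rw [intervalIntegral.integral_mul_const, integral_pow]
    simp
  rw [hterm]
  exact hsum

/-- A primitive of an analytic 1-form is analytic. -/
theorem analyticAt_of_hasFDerivAt {η : E → (E →L[ℝ] ℝ)} {h : E → ℝ} {x₀ : E}
    (hη : AnalyticAt ℝ η x₀) (hh : ∀ᶠ x in 𝓝 x₀, HasFDerivAt h (η x) x) : AnalyticAt ℝ h x₀ := by
  obtain ⟨P, r₁, hP₁⟩ := hη
  obtain ⟨r₂, hr₂, hr₂'⟩ := EMetric.mem_nhds_iff.1 hh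
  have hP : HasFPowerSeriesOnBall η P x₀ (min r₁ r₂) := hP₁.mono (lt_min hP₁.r_pos hr₂)
    (min_le_left _ _)
  have hh' : ∀ x ∈ Metric.eball x₀ (min r₁ r₂), HasFDerivAt h (η x) x := fun x hx =>
    hr₂' (Metric.eball_subset_eball (min_le_right _ _) hx)
  -- The term of degree k is that of η of degree k - 1, divided by k. The maximum with 1 keeps the
  -- constant term h(x₀), and no norm increases, so the radius does not shrink.
  let q : FormalMultilinearSeries ℝ E ℝ := fun k =>
    (max k 1 : ℝ)⁻¹ • P.unshift (h x₀) k
  refine ⟨q, min r₁ r₂, ?_, hP.r_pos, fun {y} hy => ?_⟩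
  · refine hP.r_le.trans ((FormalMultilinearSeries.radius_unshift P (h x₀)).symm.le.trans
      (FormalMultilinearSeries.radius_le_of_le fun k => ?_))
    have h1 : ‖(max k 1 : ℝ)⁻¹‖ ≤ 1 := by
      rw [Real.norm_of_nonneg (by positivity)]
      exact inv_le_one_of_one_le₀ (le_max_right _ _)
    exact (norm_smul_le ((max k 1 : ℝ)⁻¹) (P.unshift (h x₀) k)).trans
      (mul_le_of_le_one_left (norm_nonneg _) h1)
  · have h1 := hasSum_integral_ray hP hh' hy
    have h2 : HasSum (fun k => q (k + 1) fun _ => y) (h (x₀ + y) - h x₀) := by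
      convert h1 using 2 with k
      have : (max ((k + 1 : ℕ) : ℝ) 1) = k + 1 := by
        push_cast
        exact max_eq_left (by linarith [(Nat.cast_nonneg k : (0 : ℝ) ≤ k)])
      have h4 : (Fin.init fun _ : Fin (k + 1) => y) = fun _ => y := rfl
      simp [q, FormalMultilinearSeries.unshift, h4]
    have h3 := (hasSum_nat_add_iff (f := fun k => q k fun _ => y) 1).1 h2
    convert h3 using 1
    simp [q, FormalMultilinearSeries.unshift]

/-- The Poincaré lemma for analytic 1-forms. -/
theorem exists_analytic_primitive [CompleteSpace E] {η : E → (E →L[ℝ] ℝ)} {x₀ : E}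
    (hη : AnalyticAt ℝ η x₀) (hs : ∀ᶠ x in 𝓝 x₀, ∀ a b, fderiv ℝ η x a b = fderiv ℝ η x b a) :
    ∃ h : E → ℝ, AnalyticAt ℝ h x₀ ∧ ∀ᶠ x in 𝓝 x₀, HasFDerivAt h (η x) x := by
  obtain ⟨r, hr, hball⟩ := Metric.eventually_nhds_iff_ball.1 (hη.eventually_analyticAt.and hs)
  obtain ⟨h, hh⟩ := (convex_ball x₀ r).exists_forall_hasFDerivAt_of_fderiv_symmetric
    Metric.isOpen_ball (fun x hx => (hball x hx).1.differentiableAt.differentiableWithinAt)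
    (fun x hx => (hball x hx).2)
  have hh' : ∀ᶠ x in 𝓝 x₀, HasFDerivAt h (η x) x :=
    Filter.mem_of_superset (Metric.ball_mem_nhds x₀ hr) hh
  exact ⟨h, analyticAt_of_hasFDerivAt hη hh', hh'⟩

/-- If the derivative of `f` vanishes where that of the submersion `u` does, then `f` is a function
of `u`. -/
theorem exists_analytic_factor [FiniteDimensional ℝ E] [FiniteDimensional ℝ F]
    [FiniteDimensional ℝ G] {u : E → F} {f : E → G} {a : E} (hu : AnalyticAt ℝ u a)
    (hf : AnalyticAt ℝ f a) (hsurj : Function.Surjective (fderiv ℝ u a))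
    (hker : ∀ᶠ e in 𝓝 a, ∀ v, fderiv ℝ u e v = 0 → fderiv ℝ f e v = 0) :
    ∃ g : F → G, AnalyticAt ℝ g (u a) ∧ ∀ᶠ e in 𝓝 a, f e = g (u e) := by
  have : CompleteSpace E := FiniteDimensional.complete ℝ E
  have : CompleteSpace F := FiniteDimensional.complete ℝ F
  have : CompleteSpace G := FiniteDimensional.complete ℝ G
  have hstr : HasStrictFDerivAt u (fderiv ℝ u a) a := hu.hasStrictFDerivAt
  have hcompl := (fderiv ℝ u a).ker_closedComplemented_of_finiteDimensional_range
  -- Complete u by a projection π onto the kernel of its derivative; ψ is the local inverse of (u,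
  -- π), so u becomes the first coordinate.
  let φ := HasStrictFDerivAt.implicitFunctionDataOfComplemented u (fderiv ℝ u a) hstr
    (LinearMap.range_eq_top.2 hsurj) hcompl
  let K := (fderiv ℝ u a).ker
  let π : E → K := φ.rightFun
  have hπa : π a = 0 := by simp [π, φ]
  have hπ : AnalyticAt ℝ π a := by
    have : AnalyticAt ℝ (fun x => φ.rightDeriv (x - a)) a :=
      AnalyticAt.comp (g := φ.rightDeriv) (f := fun x => x - a)
        (φ.rightDeriv.analyticAt _) (analyticAt_id.sub analyticAt_const)
    exact this
  let ψ : F × K → E := φ.implicitFunction.uncurry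
  have hψ : AnalyticAt ℝ ψ (u a, 0) := by
    have := φ.contDiffAt_implicitFunction (n := ⊤) hu.contDiffAt hπ.contDiffAt (by simp)
    have h2 : φ.prodFun φ.pt = (u a, 0) := Prod.ext rfl hπa
    rw [h2] at this
    exact this.analyticAt
  have hψa : ψ (u a, 0) = a := by
    have := φ.implicitFunction_apply_image.self_of_nhds
    rw [← hπa]
    exact this
  have hright : ∀ᶠ q in 𝓝 (u a, (0 : K)), u (ψ q) = q.1 := by
    have := φ.leftFun_implicitFunction
    have h2 : φ.prodFun φ.pt = (u a, 0) := Prod.ext rfl hπa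
    rw [h2] at this
    exact this
  have hleft : ∀ᶠ e in 𝓝 a, ψ (u e, π e) = e := φ.implicitFunction_apply_image
  have htend : Tendsto ψ (𝓝 (u a, 0)) (𝓝 a) := by
    have := hψ.continuousAt
    rwa [ContinuousAt, hψa] at this
  let H : F × K → G := fun q => f (ψ q)
  -- Since u ∘ ψ is the first projection, dψ maps the K-directions into ker du, where df vanishes.
  -- Hence f ∘ ψ does not depend on the coordinate in K.
  have hvert : ∀ᶠ q in 𝓝 (u a, (0 : K)), DifferentiableAt ℝ H q ∧
      ∀ κ : K, fderiv ℝ H q (0, κ) = 0 := by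
    filter_upwards [hright.eventually_nhds, hψ.eventually_analyticAt,
      htend.eventually (hker.and (hu.eventually_analyticAt.and hf.eventually_analyticAt))]
      with q h1 h2 ⟨h3, h4, h5⟩
    have hH := h5.differentiableAt.hasFDerivAt.comp q h2.differentiableAt.hasFDerivAt
    have hU := h4.differentiableAt.hasFDerivAt.comp q h2.differentiableAt.hasFDerivAt
    refine ⟨hH.differentiableAt, fun κ => ?_⟩
    have h6 : fderiv ℝ H q = _ := hH.fderiv
    rw [h6]
    refine h3 _ ?_
    have h7 : HasFDerivAt (u ∘ ψ) (ContinuousLinearMap.fst ℝ F K) q :=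
      (ContinuousLinearMap.fst ℝ F K).hasFDerivAt.congr_of_eventuallyEq h1
    have h8 := hU.unique h7
    exact congrArg (fun L : F × K →L[ℝ] F => L (0, κ)) h8
  obtain ⟨r, hr, hball⟩ := Metric.eventually_nhds_iff_ball.1 hvert
  have hconst : ∀ q ∈ Metric.ball (u a, (0 : K)) r, H q = H (q.1, 0) := by
    intro q hq
    rw [← ball_prod_same] at hq
    have hline : ∀ κ ∈ Metric.ball (0 : K) r, HasFDerivAt (fun κ => H (q.1, κ))
        (0 : K →L[ℝ] G) κ := by
      intro κ hκ
      have h1 := hball (q.1, κ) (by rw [← ball_prod_same]; exact ⟨hq.1, hκ⟩)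
      have h2 : HasFDerivAt (fun κ : K => (q.1, κ)) (ContinuousLinearMap.inr ℝ F K) κ :=
        hasFDerivAt_prodMk_right _ _
      have h3 : (fderiv ℝ H (q.1, κ)).comp (ContinuousLinearMap.inr ℝ F K) = 0 :=
        ContinuousLinearMap.ext h1.2
      rw [← h3]
      exact h1.1.hasFDerivAt.comp κ h2
    have := (convex_ball (0 : K) r).is_const_of_fderivWithin_eq_zero (𝕜 := ℝ)
      (f := fun κ => H (q.1, κ))
      (fun κ hκ => (hline κ hκ).differentiableAt.differentiableWithinAt)
      (fun κ hκ => by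
        rw [fderivWithin_of_isOpen Metric.isOpen_ball hκ]
        exact (hline κ hκ).fderiv) hq.2 (Metric.mem_ball_self hr)
    exact this
  refine ⟨fun y => H (y, 0), ?_, ?_⟩
  · have h1 : AnalyticAt ℝ H (u a, 0) :=
      AnalyticAt.comp (g := f) (f := ψ) (by rwa [hψa]) hψ
    exact AnalyticAt.comp (g := H) (f := fun y => (y, (0 : K))) h1
      (analyticAt_id.prod analyticAt_const)
  · have h1 : Tendsto (fun e => (u e, π e)) (𝓝 a) (𝓝 (u a, 0)) := by
      have := hu.continuousAt.prodMk hπ.continuousAt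
      rwa [ContinuousAt, hπa] at this
    filter_upwards [hleft, h1.eventually (Metric.ball_mem_nhds _ hr)] with e h2 h3
    rw [← hconst _ h3]
    show f e = f (ψ (u e, π e))
    rw [h2]

end Analysis

-- The Poincaré lemma, openness and functional dependence on jets

section JetAnalysis

variable {n : ℕ} {E F : Type*} [NormedAddCommGroup E] [NormedSpace ℝ E] [NormedAddCommGroup F]
  [NormedSpace ℝ F] [FiniteDimensional ℝ E] [FiniteDimensional ℝ F]

theorem eventually_jetTrunc_iff {x : Jet n} {N : ℕ} {q : (Fin N → Fin n → ℝ) → Prop} :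
    (∀ᶠ z in 𝓝 x, q (jetTrunc N z)) ↔ ∀ᶠ ζ in 𝓝 (jetTrunc N x), q ζ := by
  rw [← map_jetTrunc_nhds, eventually_map]

/-- The Poincaré lemma on jets. -/
theorem JetFormAt.exists_primitive {e : Jet n → Jet n → ℝ} {x : Jet n} (he : JetFormAt e x)
    (hc : ∀ᶠ z in 𝓝 x, ∀ v w, extD e z v w = 0) :
    ∃ h : Jet n → ℝ, AnalyticJetAt h x ∧ ∀ᶠ z in 𝓝 x, ∀ v, lineDeriv ℝ h z v = e z v := by
  obtain ⟨N, g, hg, hge⟩ := he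
  have h1 : ∀ᶠ ζ in 𝓝 (jetTrunc N x), ∀ a b, fderiv ℝ g ζ a b = fderiv ℝ g ζ b a := by
    rw [← eventually_jetTrunc_iff]
    filter_upwards [hc, hge.eventually_nhds,
      ((continuous_jetTrunc N).tendsto x).eventually hg.eventually_analyticAt] with z h1 h2 h3 a b
    -- Every truncated vector is the truncation of a jet, so closedness on jets is the full symmetry
    -- condition for the model.
    have h4 := h1 (jetExtend 0 N a) (jetExtend 0 N b)
    unfold extD at h4
    rw [lineDeriv_form_model h3 h2, lineDeriv_form_model h3 h2, jetTrunc_jetExtend,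
      jetTrunc_jetExtend] at h4
    exact sub_eq_zero.1 h4
  obtain ⟨h, hh, hd⟩ := exists_analytic_primitive hg h1
  refine ⟨fun z => h (jetTrunc N z), ⟨N, h, hh, Eventually.of_forall fun _ => rfl⟩, ?_⟩
  filter_upwards [JetAnalyticAt.hasLineDerivAt_model (u := fun z => h (jetTrunc N z)) hh
    (Eventually.of_forall fun _ => rfl), eventually_jetTrunc_iff.2 hd, hge] with z h1 h2 h3 v
  rw [(h1 v).lineDeriv, h2.fderiv, h3]

theorem JetAnalyticAt.exists_common_model {u : Jet n → E} {f : Jet n → F} {x : Jet n}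
    (hu : JetAnalyticAt u x) (hf : JetAnalyticAt f x) : ∃ (N : ℕ) (U : (Fin N → Fin n → ℝ) → E)
      (H : (Fin N → Fin n → ℝ) → F), AnalyticAt ℝ U (jetTrunc N x) ∧ AnalyticAt ℝ H (jetTrunc N x) ∧
      (u =ᶠ[𝓝 x] fun z => U (jetTrunc N z)) ∧ (f =ᶠ[𝓝 x] fun z => H (jetTrunc N z)) := by
  obtain ⟨N, hN⟩ := hu.raise
  obtain ⟨N', hN'⟩ := hf.raise
  obtain ⟨g, hg, hgf⟩ := hN (max N N') (le_max_left _ _)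
  obtain ⟨g', hg', hgf'⟩ := hN' (max N N') (le_max_right _ _)
  exact ⟨_, g, g', hg, hg', hgf, hgf'⟩

theorem JetAnalyticAt.surjective_fderiv_model {E : Type*} [NormedAddCommGroup E] [NormedSpace ℝ E]
    [CompleteSpace E] {u : Jet n → E} {x : Jet n} {N : ℕ}
    {U : (Fin N → Fin n → ℝ) → E} (hU : AnalyticAt ℝ U (jetTrunc N x))
    (hu : u =ᶠ[𝓝 x] fun z => U (jetTrunc N z))
    (hs : Function.Surjective (lineDeriv ℝ u x)) :
    Function.Surjective (fderiv ℝ U (jetTrunc N x)) := by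
  intro c
  obtain ⟨v, hv⟩ := hs c
  exact ⟨jetTrunc N v, by
    rw [← hv, ((JetAnalyticAt.hasLineDerivAt_model hU hu).self_of_nhds v).lineDeriv]⟩

/-- Analytic submersions on jets are open. -/
theorem JetAnalyticAt.map_nhds_eq {u : Jet n → E} {x : Jet n} (hu : JetAnalyticAt u x)
    (hs : Function.Surjective (lineDeriv ℝ u x)) : map u (𝓝 x) = 𝓝 (u x) := by
  have : CompleteSpace E := FiniteDimensional.complete ℝ E
  obtain ⟨N, U, hU, hUu⟩ := hu
  rw [Filter.map_congr hUu, hUu.self_of_nhds]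
  have := (hU.hasStrictFDerivAt).map_nhds_eq_of_surj
    (LinearMap.range_eq_top.2 (surjective_fderiv_model hU hUu hs))
  rw [← this, ← map_jetTrunc_nhds, Filter.map_map]
  rfl

/-- If the derivative of `f` vanishes where that of the submersion `u` does, then `f` is a function
of `u`. -/
theorem JetAnalyticAt.exists_factor {u : Jet n → E} {f : Jet n → F} {x : Jet n}
    (hu : JetAnalyticAt u x) (hf : JetAnalyticAt f x)
    (hs : Function.Surjective (lineDeriv ℝ u x))
    (hker : ∀ᶠ z in 𝓝 x, ∀ v, lineDeriv ℝ u z v = 0 → lineDeriv ℝ f z v = 0) :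
    ∃ g : E → F, AnalyticAt ℝ g (u x) ∧ ∀ᶠ z in 𝓝 x, f z = g (u z) := by
  have : CompleteSpace E := FiniteDimensional.complete ℝ E
  have : CompleteSpace F := FiniteDimensional.complete ℝ F
  obtain ⟨N, U, H, hU, hH, hUu, hHf⟩ := hu.exists_common_model hf
  have hker' : ∀ᶠ ζ in 𝓝 (jetTrunc N x), ∀ v, fderiv ℝ U ζ v = 0 → fderiv ℝ H ζ v = 0 := by
    rw [← eventually_jetTrunc_iff]
    filter_upwards [hker, hasLineDerivAt_model hU hUu, hasLineDerivAt_model hH hHf]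
      with z h1 h2 h3 v hv
    have h4 := h1 (jetExtend 0 N v)
    rw [(h2 _).lineDeriv, (h3 _).lineDeriv, jetTrunc_jetExtend] at h4
    exact h4 hv
  obtain ⟨g, hg, hgU⟩ := exists_analytic_factor hU hH (surjective_fderiv_model hU hUu hs) hker'
  refine ⟨g, by rw [hUu.self_of_nhds]; exact hg, ?_⟩
  filter_upwards [eventually_jetTrunc_iff.2 hgU, hUu, hHf] with z h1 h2 h3
  rw [h2, h3, h1]

end JetAnalysis
end

noncomputable section

/-! ### Operators -/

namespace DiffOp

variable {A B : Type*} [CommRing A] [CommRing B] {d : Derivation ℤ A A} {d' : Derivation ℤ B B}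

theorem toPoly_add (P Q : DiffOp d) : (P + Q).toPoly = P.toPoly + Q.toPoly := rfl

theorem toPoly_mul (P Q : DiffOp d) : (P * Q).toPoly = compOp d P.toPoly Q.toPoly := rfl

theorem toPoly_ofPoly (p : Polynomial A) : (ofPoly d p).toPoly = p := rfl

theorem ofPoly_add (p q : Polynomial A) : ofPoly d (p + q) = ofPoly d p + ofPoly d q := rfl

theorem toPoly_sum {ι : Type*} (s : Finset ι) (P : ι → DiffOp d) :
    (∑ i ∈ s, P i).toPoly = ∑ i ∈ s, (P i).toPoly :=
  map_sum (⟨⟨toPoly, rfl⟩, toPoly_add⟩ : DiffOp d →+ Polynomial A) _ _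

/-- The operator of multiplication by `a`. -/
def const (d : Derivation ℤ A A) (a : A) : DiffOp d := ofPoly d (Polynomial.C a)

/-- The operator `d/dt`. -/
def ddt (d : Derivation ℤ A A) : DiffOp d := ofPoly d Polynomial.X

theorem toPoly_const_mul (a : A) (P : DiffOp d) :
    (const d a * P).toPoly = Polynomial.C a * P.toPoly := by
  rw [toPoly_mul, const, toPoly_ofPoly, ← Polynomial.monomial_zero_left, compOp_monomial]
  rfl

theorem toPoly_ddt_mul (P : DiffOp d) : (ddt d * P).toPoly = compD d P.toPoly := by
  rw [toPoly_mul, ddt, toPoly_ofPoly, ← Polynomial.monomial_one_one_eq_X, compOp_monomial]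
  simp

theorem toPoly_ddt_pow (k : ℕ) : (ddt d ^ k).toPoly = Polynomial.X ^ k := by
  induction k with
  | zero => rfl
  | succ k ih =>
    rw [pow_succ', toPoly_ddt_mul, ih, ← compD_iterate_one (d := d), ← compD_iterate_one (d := d),
      Function.iterate_succ_apply']

theorem toPoly_injective : Function.Injective (toPoly : DiffOp d → Polynomial A) := fun _ _ h => h

theorem ofPoly_monomial (k : ℕ) (a : A) :
    ofPoly d (Polynomial.monomial k a) = const d a * ddt d ^ k := by
  apply toPoly_injective
  rw [toPoly_const_mul, toPoly_ddt_pow, Polynomial.C_mul_X_pow_eq_monomial]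
  rfl

theorem eq_sum_range (P : DiffOp d) {M : ℕ} (h : P.toPoly.natDegree < M) :
    P = ∑ k ∈ Finset.range M, const d (P.toPoly.coeff k) * ddt d ^ k := by
  apply toPoly_injective
  rw [toPoly_sum]
  simp only [toPoly_const_mul, toPoly_ddt_pow, Polynomial.C_mul_X_pow_eq_monomial]
  exact Polynomial.as_sum_range' _ _ h

/-- The functions and d/dt generate the operators. An identity of actions therefore needs checking
for these two kinds of left factors only. -/
theorem induction {motive : DiffOp d → Prop} (one : motive 1)
    (add : ∀ P Q, motive P → motive Q → motive (P + Q))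
    (const_mul : ∀ a P, motive P → motive (const d a * P))
    (ddt_mul : ∀ P, motive P → motive (ddt d * P)) (P : DiffOp d) : motive P := by
  have hpow : ∀ k, motive (ddt d ^ k) := by
    intro k
    induction k with
    | zero => simpa using one
    | succ k ih => rw [pow_succ']; exact ddt_mul _ ih
  have h : ∀ p : Polynomial A, motive (ofPoly d p) := by
    intro p
    induction p using Polynomial.induction_on' with
    | add p q hp hq => exact add _ _ hp hq
    | monomial k a => rw [ofPoly_monomial]; exact const_mul _ _ (hpow k)
  exact h P

theorem coeff_compD (p : Polynomial A) (k : ℕ) :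
    (compD d p).coeff k = d (p.coeff k) + (if k = 0 then 0 else p.coeff (k - 1)) := by
  induction p using Polynomial.induction_on' with
  | add p q hp hq =>
    rw [compD_add, Polynomial.coeff_add, hp, hq, Polynomial.coeff_add, map_add, Polynomial.coeff_add]
    split_ifs <;> ring
  | monomial m a =>
    rw [compD_monomial, Polynomial.coeff_add, Polynomial.coeff_monomial, Polynomial.coeff_monomial,
      Polynomial.coeff_monomial, Polynomial.coeff_monomial]
    congr 1
    · split_ifs <;> simp
    · rcases k with _ | k <;> simp

theorem compD_map (f : A →+* B) (hf : ∀ a, f (d a) = d' (f a)) (p : Polynomial A) :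
    (compD d p).map f = compD d' (p.map f) := by
  induction p using Polynomial.induction_on' with
  | add p q hp hq => rw [compD_add, Polynomial.map_add, hp, hq, Polynomial.map_add, compD_add]
  | monomial m a => simp [compD_monomial, hf]

theorem compD_iterate_map (f : A →+* B) (hf : ∀ a, f (d a) = d' (f a)) (k : ℕ) (p : Polynomial A) :
    ((compD d)^[k] p).map f = (compD d')^[k] (p.map f) := by
  induction k with
  | zero => rfl
  | succ k ih => rw [Function.iterate_succ_apply', compD_map f hf, ih, Function.iterate_succ_apply']

/-- The ring homomorphism of operators induced by a homomorphism of differential rings. -/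
def mapHom (f : A →+* B) (hf : ∀ a, f (d a) = d' (f a)) : DiffOp d →+* DiffOp d' where
  toFun P := ofPoly d' (P.toPoly.map f)
  map_zero' := Polynomial.map_zero f
  map_one' := Polynomial.map_one f
  map_add' P Q := Polynomial.map_add f
  map_mul' P Q := by
    apply toPoly_injective
    simp only [toPoly_mul, toPoly_ofPoly]
    have h : ∀ p q : Polynomial A, (compOp d p q).map f = compOp d' (p.map f) (q.map f) := by
      intro p q
      induction p using Polynomial.induction_on' with
      | add p p' hp hp' =>
        rw [compOp_add_left, Polynomial.map_add, hp, hp', Polynomial.map_add, compOp_add_left]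
      | monomial m a =>
        rw [compOp_monomial, Polynomial.map_monomial, compOp_monomial, Polynomial.map_mul,
          Polynomial.map_C, compD_iterate_map f hf]
    exact h _ _

theorem toPoly_mapHom (f : A →+* B) (hf : ∀ a, f (d a) = d' (f a)) (P : DiffOp d) :
    (mapHom f hf P).toPoly = P.toPoly.map f := rfl

end DiffOp

/-! ### The module of forms -/

section FormModule

variable {n : ℕ} {x₀ : Jet n}

theorem lieForm_add (ω ω' : JetForm x₀) : lieForm (ω + ω') = lieForm ω + lieForm ω' := by
  unfold lieForm
  rw [Finsupp.sum_add_index']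
  · simp
  · intro b a a'
    simp only [map_add, Finsupp.single_add]
    abel

theorem lieForm_single (b : ℕ × Fin n) (a : analyticGerms x₀) :
    lieForm (Finsupp.single b a) =
      Finsupp.single b (germDeriv x₀ a) + Finsupp.single (b.1 + 1, b.2) a := by
  unfold lieForm
  rw [Finsupp.sum_single_index]
  simp

theorem lieForm_smul (a : analyticGerms x₀) (ω : JetForm x₀) :
    lieForm (a • ω) = germDeriv x₀ a • ω + a • lieForm ω := by
  induction ω using Finsupp.induction_linear with
  | zero => simp [lieForm]
  | add ω ω' h h' => rw [smul_add, lieForm_add, h, h', lieForm_add, smul_add, smul_add]; abel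
  | single b c =>
    rw [Finsupp.smul_single, lieForm_single, lieForm_single, smul_eq_mul, Derivation.leibniz,
      smul_add, Finsupp.smul_single, Finsupp.smul_single, Finsupp.smul_single, Finsupp.single_add]
    simp only [smul_eq_mul, mul_comm c]
    abel

theorem lieForm_iterate_add (k : ℕ) (ω ω' : JetForm x₀) :
    lieForm^[k] (ω + ω') = lieForm^[k] ω + lieForm^[k] ω' := by
  induction k with
  | zero => rfl
  | succ k ih => simp only [Function.iterate_succ_apply', ih, lieForm_add]

theorem opForm_add_left (P Q : JetOp x₀) (ω : JetForm x₀) :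
    opForm (P + Q) ω = opForm P ω + opForm Q ω := by
  unfold opForm
  rw [DiffOp.toPoly_add, Polynomial.sum_add_index]
  · simp
  · intros; rw [add_smul]

theorem opForm_add_right (P : JetOp x₀) (ω ω' : JetForm x₀) :
    opForm P (ω + ω') = opForm P ω + opForm P ω' := by
  unfold opForm Polynomial.sum
  simp [lieForm_iterate_add, smul_add, Finset.sum_add_distrib]

theorem opForm_monomial (k : ℕ) (a : analyticGerms x₀) (ω : JetForm x₀) :
    opForm (DiffOp.ofPoly (germDeriv x₀) (Polynomial.monomial k a)) ω = a • lieForm^[k] ω := by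
  unfold opForm
  rw [DiffOp.toPoly_ofPoly, Polynomial.sum_monomial_index]
  simp

theorem opForm_one (ω : JetForm x₀) : opForm 1 ω = ω := by
  have h := opForm_monomial 0 1 ω
  rw [Polynomial.monomial_zero_one] at h
  rw [one_smul] at h
  exact h

theorem opForm_const_mul (a : analyticGerms x₀) (P : JetOp x₀) (ω : JetForm x₀) :
    opForm (DiffOp.const _ a * P) ω = a • opForm P ω := by
  have h : ∀ p : Polynomial (analyticGerms x₀),
      opForm (DiffOp.ofPoly (germDeriv x₀) (Polynomial.C a * p)) ω =
        a • opForm (DiffOp.ofPoly (germDeriv x₀) p) ω := by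
    intro p
    induction p using Polynomial.induction_on' with
    | add p q hp hq =>
      rw [mul_add, DiffOp.ofPoly_add, opForm_add_left, hp, hq, ← smul_add, ← opForm_add_left,
        DiffOp.ofPoly_add]
    | monomial k b =>
      rw [Polynomial.C_mul_monomial, opForm_monomial, opForm_monomial, mul_smul]
  have h2 := h P.toPoly
  rw [← DiffOp.toPoly_const_mul] at h2
  exact h2

theorem opForm_ddt_mul (P : JetOp x₀) (ω : JetForm x₀) :
    opForm (DiffOp.ddt _ * P) ω = lieForm (opForm P ω) := by
  have h : ∀ p : Polynomial (analyticGerms x₀),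
      opForm (DiffOp.ofPoly (germDeriv x₀) (DiffOp.compD (germDeriv x₀) p)) ω =
        lieForm (opForm (DiffOp.ofPoly (germDeriv x₀) p) ω) := by
    intro p
    induction p using Polynomial.induction_on' with
    | add p q hp hq =>
      rw [DiffOp.compD_add, DiffOp.ofPoly_add, opForm_add_left, hp, hq, ← lieForm_add,
        ← opForm_add_left, DiffOp.ofPoly_add]
    | monomial k b =>
      rw [DiffOp.compD_monomial, DiffOp.ofPoly_add, opForm_add_left, opForm_monomial, opForm_monomial, opForm_monomial, lieForm_smul,
        Function.iterate_succ_apply']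
  have h2 := h P.toPoly
  rw [← DiffOp.toPoly_ddt_mul] at h2
  exact h2

theorem opForm_mul (P Q : JetOp x₀) (ω : JetForm x₀) :
    opForm (P * Q) ω = opForm P (opForm Q ω) := by
  induction P using DiffOp.induction with
  | one => rw [one_mul, opForm_one]
  | add P P' h h' => rw [add_mul, opForm_add_left, h, h', opForm_add_left]
  | const_mul a P h => rw [mul_assoc, opForm_const_mul, h, opForm_const_mul]
  | ddt_mul P h => rw [mul_assoc, opForm_ddt_mul, h, opForm_ddt_mul]

theorem opForm_sum_left {ι : Type*} (s : Finset ι) (P : ι → JetOp x₀) (ω : JetForm x₀) :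
    opForm (∑ i ∈ s, P i) ω = ∑ i ∈ s, opForm (P i) ω :=
  map_sum (AddMonoidHom.mk' (fun P : JetOp x₀ => opForm P ω) fun P Q => opForm_add_left P Q ω) _ _

theorem opForm_sum_right {ι : Type*} (s : Finset ι) (P : JetOp x₀) (ω : ι → JetForm x₀) :
    opForm P (∑ i ∈ s, ω i) = ∑ i ∈ s, opForm P (ω i) :=
  map_sum (AddMonoidHom.mk' (fun ω : JetForm x₀ => opForm P ω) (opForm_add_right P)) _ _

theorem matForm_mul {r s t : ℕ} (M : Matrix (Fin r) (Fin s) (JetOp x₀))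
    (N : Matrix (Fin s) (Fin t) (JetOp x₀)) (ω : Fin t → JetForm x₀) :
    matForm (M * N) ω = matForm M (matForm N ω) := by
  funext i
  simp only [matForm, Matrix.mul_apply, opForm_sum_left, opForm_sum_right, opForm_mul]
  exact Finset.sum_comm

theorem lieForm_iterate_dx (k : ℕ) (j : Fin n) :
    lieForm^[k] (dxForm x₀ j) = Finsupp.single (k, j) 1 := by
  induction k with
  | zero => rfl
  | succ k ih =>
    rw [Function.iterate_succ_apply', ih, lieForm_single, Derivation.map_one_eq_zero]
    simp

theorem opForm_dx_apply (P : JetOp x₀) (j : Fin n) (b : ℕ × Fin n) :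
    opForm P (dxForm x₀ j) b = if b.2 = j then P.toPoly.coeff b.1 else 0 := by
  have h : opForm P (dxForm x₀ j) = P.toPoly.sum fun k a => Finsupp.single (k, j) a := by
    unfold opForm
    simp [lieForm_iterate_dx]
  rw [h, Polynomial.sum_def, Finsupp.finsetSum_apply]
  obtain ⟨k, i⟩ := b
  simp only [Finsupp.single_apply, Prod.mk.injEq]
  by_cases hij : i = j
  · subst hij
    simp only [and_true, if_true, Finset.sum_ite_eq', Polynomial.mem_support_iff]
    split_ifs with h0
    · rfl
    · exact (Polynomial.notMem_support_iff.1 h0).symm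
  · simp [hij, Ne.symm hij]

/-- The coefficient of dx_j^{(k)} in the form A_i dx is the coefficient of (d/dt)^k in A_{ij}; forms
and rows of operators are thus the same data. -/
theorem matForm_dx_apply {r : ℕ} (M : Matrix (Fin r) (Fin n) (JetOp x₀)) (i : Fin r)
    (b : ℕ × Fin n) : matForm M (dxForm x₀) i b = (M i b.2).toPoly.coeff b.1 := by
  simp [matForm, Finsupp.finsetSum_apply, opForm_dx_apply]

end FormModule
end

noncomputable section

/-! ### Representatives of germs -/

section Germs

variable {n n' : ℕ} {x₀ : Jet n}

theorem germRep_analytic (γ : analyticGerms x₀) : AnalyticJetAt (germRep γ) x₀ := (germRep_spec γ).1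

theorem germRep_eventuallyEq {γ : analyticGerms x₀} {f : Jet n → ℝ}
    (h : (f : Germ (𝓝 x₀) ℝ) = γ.1) : germRep γ =ᶠ[𝓝 x₀] f :=
  Germ.coe_eq.1 ((germRep_spec γ).2.trans h.symm)

theorem germRep_mk (f : Jet n → ℝ) (hf : AnalyticJetAt f x₀) :
    germRep (analyticGerms.mk f hf) =ᶠ[𝓝 x₀] f := germRep_eventuallyEq rfl

theorem germ_ext {γ γ' : analyticGerms x₀} (h : germRep γ =ᶠ[𝓝 x₀] germRep γ') : γ = γ' :=
  Subtype.ext (by rw [← (germRep_spec γ).2, ← (germRep_spec γ').2]; exact Germ.coe_eq.2 h)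

theorem germRep_add (γ γ' : analyticGerms x₀) :
    ∀ᶠ x in 𝓝 x₀, germRep (γ + γ') x = germRep γ x + germRep γ' x :=
  germRep_eventuallyEq (f := germRep γ + germRep γ') (by
    rw [Germ.coe_add, (germRep_spec γ).2, (germRep_spec γ').2]; rfl)

theorem germRep_mul (γ γ' : analyticGerms x₀) :
    ∀ᶠ x in 𝓝 x₀, germRep (γ * γ') x = germRep γ x * germRep γ' x :=
  germRep_eventuallyEq (f := germRep γ * germRep γ') (by
    rw [Germ.coe_mul, (germRep_spec γ).2, (germRep_spec γ').2]; rfl)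

theorem germRep_zero : ∀ᶠ x in 𝓝 x₀, germRep (0 : analyticGerms x₀) x = 0 :=
  germRep_eventuallyEq (f := 0) rfl

theorem germRep_one : ∀ᶠ x in 𝓝 x₀, germRep (1 : analyticGerms x₀) x = 1 :=
  germRep_eventuallyEq (f := 1) rfl

theorem germRep_deriv (γ : analyticGerms x₀) :
    germRep (germDeriv x₀ γ) =ᶠ[𝓝 x₀] cartanDeriv (germRep γ) := by
  refine germRep_eventuallyEq ?_
  have h : (germDeriv x₀ γ).1 =
    Germ.map' (lc := 𝓝 x₀) cartanDeriv (fun _ _ h => cartanDeriv_congr h) γ.1 := rfl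
  rw [h, ← (germRep_spec γ).2]
  rfl

theorem eventually_comp {y₀ : Jet n'} {Φ : Jet n' → Jet n} (hΦ : JetMapAt Φ y₀) (h : Φ y₀ = x₀)
    {q : Jet n → Prop} (hq : ∀ᶠ x in 𝓝 x₀, q x) : ∀ᶠ y in 𝓝 y₀, q (Φ y) :=
  hΦ.continuousAt.eventually (by rwa [h])

/-- The pullback of germs along a map between jet spaces. -/
def pullGerm {y₀ : Jet n'} (Φ : Jet n' → Jet n) (hΦ : JetMapAt Φ y₀) (h : Φ y₀ = x₀) :
    analyticGerms x₀ →+* analyticGerms y₀ where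
  toFun γ := analyticGerms.mk (fun y => germRep γ (Φ y))
    (JetMapAt.comp_jet (u := germRep γ) (by rw [h]; exact germRep_analytic γ) hΦ)
  map_one' := Subtype.ext (Germ.coe_eq.2 (eventually_comp hΦ h germRep_one))
  map_zero' := Subtype.ext (Germ.coe_eq.2 (eventually_comp hΦ h germRep_zero))
  map_mul' γ γ' := Subtype.ext (Germ.coe_eq.2 (eventually_comp hΦ h (germRep_mul γ γ')))
  map_add' γ γ' := Subtype.ext (Germ.coe_eq.2 (eventually_comp hΦ h (germRep_add γ γ')))

theorem germRep_pullGerm {y₀ : Jet n'} {Φ : Jet n' → Jet n} (hΦ : JetMapAt Φ y₀) (h : Φ y₀ = x₀)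
    (γ : analyticGerms x₀) :
    ∀ᶠ y in 𝓝 y₀, germRep (pullGerm Φ hΦ h γ) y = germRep γ (Φ y) :=
  germRep_mk (fun y => germRep γ (Φ y))
    (JetMapAt.comp_jet (u := germRep γ) (by rw [h]; exact germRep_analytic γ) hΦ)

theorem pullGerm_deriv {y₀ : Jet n'} {Φ : Jet n' → Jet n} (hΦ : ∀ᶠ y in 𝓝 y₀, JetMapAt Φ y)
    (h : Φ y₀ = x₀) (hL : ∀ᶠ y in 𝓝 y₀, jetTangent Φ y (cartanField y) = cartanField (Φ y))
    (γ : analyticGerms x₀) :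
    pullGerm Φ hΦ.self_of_nhds h (germDeriv x₀ γ) =
      germDeriv y₀ (pullGerm Φ hΦ.self_of_nhds h γ) := by
  refine germ_ext ?_
  have h0 : (germRep (pullGerm Φ hΦ.self_of_nhds h γ)) =ᶠ[𝓝 y₀] fun y => germRep γ (Φ y) :=
    germRep_pullGerm _ _ _
  filter_upwards [germRep_pullGerm hΦ.self_of_nhds h (germDeriv x₀ γ),
    germRep_deriv (pullGerm Φ hΦ.self_of_nhds h γ), cartanDeriv_congr h0,
    eventually_comp hΦ.self_of_nhds h (germRep_deriv γ), hΦ, hL,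
    eventually_comp hΦ.self_of_nhds h (JetAnalyticAt.eventually (germRep_analytic γ))]
    with y h1 h2 h3 h4 h5 h6 h7
  rw [h1, h2, h3, h4]
  exact (cartanDeriv_comp h5 h7 h6).symm

end Germs

/-! ### Evaluation of rows of operators -/

section RowEval

variable {n q s : ℕ} {x₀ : Jet n}

/-- The value `∑ a_{k,j}(x) C_j^{(k)}` of the row of operators `r_j = ∑ a_{k,j} (d/dt)^k`. -/
def rowEval (r : Fin q → JetOp x₀) (x : Jet n) (C : Jet q) : ℝ :=
  ∑ j, (r j).toPoly.sum fun k a => germRep a x * C k j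

/-- A strict bound of the orders of the operators in a row. -/
def rowOrder (r : Fin q → JetOp x₀) : ℕ := Finset.univ.sup (fun j => (r j).toPoly.natDegree) + 1

theorem natDegree_lt_rowOrder (r : Fin q → JetOp x₀) (j : Fin q) :
    (r j).toPoly.natDegree < rowOrder r :=
  Nat.lt_succ_of_le (Finset.le_sup (f := fun j => (r j).toPoly.natDegree) (Finset.mem_univ j))

/-- This holds only near x₀, because the chosen representative of the zero germ need not vanish
farther away. A common range M allows rows of different orders to be compared. -/
theorem rowEval_eq_range (r : Fin q → JetOp x₀) {M : ℕ} (hM : rowOrder r ≤ M) :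
    ∀ᶠ x in 𝓝 x₀, ∀ C : Jet q, rowEval r x C =
      ∑ j, ∑ k ∈ Finset.range M, germRep ((r j).toPoly.coeff k) x * C k j := by
  filter_upwards [germRep_zero] with x hx C
  refine Finset.sum_congr rfl fun j _ => ?_
  exact Polynomial.sum_over_range' _ (by simp [hx]) _
    ((natDegree_lt_rowOrder r j).trans_le hM)

theorem rowEval_congr_right (r : Fin q → JetOp x₀) {x : Jet n} {C C' : Jet q}
    (h : ∀ k < rowOrder r, ∀ j, C k j = C' k j) : rowEval r x C = rowEval r x C' := by
  refine Finset.sum_congr rfl fun j _ => Finset.sum_congr rfl fun k hk => ?_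
  show germRep _ x * C k j = germRep _ x * C' k j
  rw [h k ((Polynomial.le_natDegree_of_mem_supp k hk).trans_lt (natDegree_lt_rowOrder r j))]

theorem rowEval_add (r r' : Fin q → JetOp x₀) :
    ∀ᶠ x in 𝓝 x₀, ∀ C : Jet q, rowEval (r + r') x C = rowEval r x C + rowEval r' x C := by
  let M := max (rowOrder (r + r')) (max (rowOrder r) (rowOrder r'))
  filter_upwards [rowEval_eq_range (r + r') (le_max_left _ _ : _ ≤ M),
    rowEval_eq_range r ((le_max_left _ _).trans (le_max_right _ _) : _ ≤ M),
    rowEval_eq_range r' ((le_max_right _ _).trans (le_max_right _ _) : _ ≤ M),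
    eventually_all.2 fun j => (eventually_all_finset (Finset.range M)).2 fun k _ =>
      germRep_add ((r j).toPoly.coeff k) ((r' j).toPoly.coeff k)] with x h1 h2 h3 h4 C
  rw [h1, h2, h3, ← Finset.sum_add_distrib]
  refine Finset.sum_congr rfl fun j _ => ?_
  rw [← Finset.sum_add_distrib]
  refine Finset.sum_congr rfl fun k hk => ?_
  rw [Pi.add_apply, DiffOp.toPoly_add, Polynomial.coeff_add, h4 j k hk, add_mul]

theorem rowEval_zero : ∀ᶠ x in 𝓝 x₀, ∀ C : Jet q, rowEval (0 : Fin q → JetOp x₀) x C = 0 := by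
  exact Eventually.of_forall fun x C => Finset.sum_eq_zero fun j _ => Polynomial.sum_zero_index _

theorem rowEval_sum {ι : Type*} (t : Finset ι) (r : ι → Fin q → JetOp x₀) :
    ∀ᶠ x in 𝓝 x₀, ∀ C : Jet q, rowEval (∑ i ∈ t, r i) x C = ∑ i ∈ t, rowEval (r i) x C := by
  classical
  induction t using Finset.induction_on with
  | empty => simpa using rowEval_zero
  | insert a t ha ih =>
    filter_upwards [ih, rowEval_add (r a) (∑ i ∈ t, r i)] with x h1 h2 C
    rw [Finset.sum_insert ha, Finset.sum_insert ha, h2, h1]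

theorem rowEval_const_mul (a : analyticGerms x₀) (r : Fin q → JetOp x₀) :
    ∀ᶠ x in 𝓝 x₀, ∀ C : Jet q,
      rowEval (fun j => DiffOp.const _ a * r j) x C = germRep a x * rowEval r x C := by
  let r' : Fin q → JetOp x₀ := fun j => DiffOp.const _ a * r j
  let M := max (rowOrder r') (rowOrder r)
  filter_upwards [rowEval_eq_range r' (le_max_left _ _ : _ ≤ M),
    rowEval_eq_range r (le_max_right _ _ : _ ≤ M),
    eventually_all.2 fun j => (eventually_all_finset (Finset.range M)).2 fun k _ =>
      germRep_mul a ((r j).toPoly.coeff k)] with x h1 h2 h3 C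
  rw [h1, h2, Finset.mul_sum]
  refine Finset.sum_congr rfl fun j _ => ?_
  rw [Finset.mul_sum]
  refine Finset.sum_congr rfl fun k hk => ?_
  rw [DiffOp.toPoly_const_mul, Polynomial.coeff_C_mul, h3 j k hk, mul_assoc]

theorem jetFormAt_rowEval (r : Fin n → JetOp x₀) : JetFormAt (rowEval r) x₀ := by
  refine JetFormAt.congr ?_ (rowEval_eq_range r le_rfl)
  exact JetFormAt.sum _ fun j _ => JetFormAt.sum _ fun k _ =>
    JetFormAt.smul (germRep_analytic _) (JetFormAt.coord k j x₀)

theorem lineDeriv_rowEval (r : Fin q → JetOp x₀) {M : ℕ} (hM : rowOrder r ≤ M) :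
    ∀ᶠ x in 𝓝 x₀, ∀ (C : Jet q) (w : Jet n), lineDeriv ℝ (fun z => rowEval r z C) x w =
      ∑ j, ∑ k ∈ Finset.range M, lineDeriv ℝ (germRep ((r j).toPoly.coeff k)) x w * C k j := by
  filter_upwards [(rowEval_eq_range r hM).eventually_nhds,
    eventually_all.2 fun j => (eventually_all_finset (Finset.range M)).2 fun k _ =>
      JetAnalyticAt.eventually (germRep_analytic ((r j).toPoly.coeff k))] with x h1 h2 C w
  have h3 : (fun z => rowEval r z C) =ᶠ[𝓝 x] fun z =>
      ∑ j, ∑ k ∈ Finset.range M, germRep ((r j).toPoly.coeff k) z * C k j :=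
    h1.mono fun z hz => hz C
  rw [lineDeriv_congr h3]
  have h4 : HasLineDerivAt ℝ (fun z =>
      ∑ j, ∑ k ∈ Finset.range M, germRep ((r j).toPoly.coeff k) z * C k j)
      (∑ j, ∑ k ∈ Finset.range M, lineDeriv ℝ (germRep ((r j).toPoly.coeff k)) x w * C k j) x w := by
    unfold HasLineDerivAt
    exact HasDerivAt.fun_sum fun j _ => HasDerivAt.fun_sum fun k hk =>
      HasDerivAt.mul_const ((h2 j k hk).hasLineDerivAt w) _
  exact h4.lineDeriv

/-- Left multiplication by `d/dt` is the Lie derivative. -/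
theorem rowEval_ddt_mul (r : Fin n → JetOp x₀) :
    ∀ᶠ x in 𝓝 x₀, ∀ v : Jet n,
      rowEval (fun j => DiffOp.ddt _ * r j) x v = formLie (rowEval r) x v := by
  let r' : Fin n → JetOp x₀ := fun j => DiffOp.ddt _ * r j
  let M := max (rowOrder r') (rowOrder r)
  have hcoeff : ∀ j k, (r' j).toPoly.coeff k = germDeriv x₀ ((r j).toPoly.coeff k) +
      (if k = 0 then 0 else (r j).toPoly.coeff (k - 1)) := by
    intro j k
    rw [DiffOp.toPoly_ddt_mul, DiffOp.coeff_compD]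
  filter_upwards [rowEval_eq_range r' ((le_max_left _ _ : _ ≤ M).trans (Nat.le_succ M)),
    rowEval_eq_range r (le_max_right _ _ : _ ≤ M), lineDeriv_rowEval r
      ((le_max_right _ _ : _ ≤ M).trans (Nat.le_succ M)),
    eventually_all.2 fun j => (eventually_all_finset (Finset.range (M + 1))).2 fun k _ =>
      germRep_add (germDeriv x₀ ((r j).toPoly.coeff k))
        (if k = 0 then 0 else (r j).toPoly.coeff (k - 1)),
    eventually_all.2 fun j => (eventually_all_finset (Finset.range (M + 1))).2 fun k _ =>
      germRep_deriv ((r j).toPoly.coeff k), germRep_zero] with x h1 h2 h3 h4 h5 h6 v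
  unfold formLie
  rw [h1, h3, h2, ← Finset.sum_add_distrib]
  refine Finset.sum_congr rfl fun j _ => ?_
  have h7 : ∑ k ∈ Finset.range (M + 1), germRep ((r' j).toPoly.coeff k) x * v k j =
      ∑ k ∈ Finset.range (M + 1), (cartanDeriv (germRep ((r j).toPoly.coeff k)) x * v k j +
        germRep (if k = 0 then 0 else (r j).toPoly.coeff (k - 1)) x * v k j) := by
    refine Finset.sum_congr rfl fun k hk => ?_
    rw [hcoeff, h4 j k hk, h5 j k hk, add_mul]
  rw [h7, Finset.sum_add_distrib]
  congr 1
  -- Shift of index: the coefficient k - 1 multiplies v_k, which is the entry k - 1 of `cartanField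
  -- v`. The term k = 0 has coefficient zero, and the term k = M on the other side is missing
  -- because the order of r is less than M + 1.
  rw [Finset.sum_range_succ']
  simp only [h6, cartanField, if_true, zero_mul, add_zero, Nat.add_eq_zero_iff, one_ne_zero, and_false,
    if_false, Nat.add_sub_cancel, M]

/-- The values of the derivatives of the rows of `N`. -/
def rowProlong (N : Matrix (Fin s) (Fin q) (JetOp x₀)) (x : Jet n) (C : Jet q) : Jet s :=
  fun k i => rowEval (fun j => DiffOp.ddt _ ^ k * N i j) x C

/-- Evaluation of a product. -/
theorem rowEval_vecMul (r : Fin s → JetOp x₀) (N : Matrix (Fin s) (Fin q) (JetOp x₀)) :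
    ∀ᶠ x in 𝓝 x₀, ∀ C : Jet q,
      rowEval (Matrix.vecMul r N) x C = rowEval r x (rowProlong N x C) := by
  -- Expand each r_i in powers of d/dt, so that only multiplications by functions and sums remain to
  -- be evaluated.
  have h0 : Matrix.vecMul r N = ∑ i, ∑ k ∈ Finset.range (rowOrder r),
      fun j => DiffOp.const _ ((r i).toPoly.coeff k) * (DiffOp.ddt _ ^ k * N i j) := by
    funext j
    simp only [Matrix.vecMul, dotProduct, Finset.sum_apply]
    refine Finset.sum_congr rfl fun i _ => ?_
    conv_lhs => rw [DiffOp.eq_sum_range (r i) (natDegree_lt_rowOrder r i)]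
    rw [Finset.sum_mul]
    simp only [mul_assoc]
  rw [h0]
  filter_upwards [rowEval_sum Finset.univ fun i => ∑ k ∈ Finset.range (rowOrder r),
      fun j => DiffOp.const _ ((r i).toPoly.coeff k) * (DiffOp.ddt _ ^ k * N i j),
    eventually_all.2 fun i => rowEval_sum (Finset.range (rowOrder r)) fun k j =>
      DiffOp.const _ ((r i).toPoly.coeff k) * (DiffOp.ddt _ ^ k * N i j),
    eventually_all.2 fun i => (eventually_all_finset (Finset.range (rowOrder r))).2 fun k _ =>
      rowEval_const_mul ((r i).toPoly.coeff k) fun j => DiffOp.ddt _ ^ k * N i j,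
    rowEval_eq_range r le_rfl] with x h1 h2 h3 h4 C
  rw [h1, h4]
  refine Finset.sum_congr rfl fun i _ => ?_
  rw [h2]
  exact Finset.sum_congr rfl fun k hk => h3 i k hk C

theorem rowEval_ddt_pow_single (k : ℕ) (i : Fin q) :
    ∀ᶠ x in 𝓝 x₀, ∀ C : Jet q,
      rowEval (fun j => DiffOp.ddt (germDeriv x₀) ^ k *
        (1 : Matrix (Fin q) (Fin q) (JetOp x₀)) i j) x C = C k i := by
  filter_upwards [germRep_zero (x₀ := x₀), germRep_one (x₀ := x₀)] with x h0 h1 C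
  unfold rowEval
  beta_reduce
  rw [Finset.sum_eq_single i]
  · rw [Matrix.one_apply_eq, mul_one, DiffOp.toPoly_ddt_pow,
      ← Polynomial.monomial_one_right_eq_X_pow, Polynomial.sum_monomial_index _ _ (by simp [h0]),
      h1, one_mul]
  · intro j _ hj
    rw [Matrix.one_apply_ne hj.symm, mul_zero]
    exact Polynomial.sum_zero_index _
  · simp

/-- A row is determined by its values. -/
theorem row_ext {r r' : Fin q → JetOp x₀}
    (h : ∀ k j, ∀ᶠ x in 𝓝 x₀, rowEval r x (Pi.single k (Pi.single j 1)) =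
      rowEval r' x (Pi.single k (Pi.single j 1))) : r = r' := by
  have key : ∀ (r : Fin q → JetOp x₀) k j, ∀ᶠ x in 𝓝 x₀,
      rowEval r x (Pi.single k (Pi.single j 1)) = germRep ((r j).toPoly.coeff k) x := by
    intro r k j
    filter_upwards [rowEval_eq_range r (le_max_left (rowOrder r) (k + 1))] with x hx
    rw [hx, Finset.sum_eq_single j, Finset.sum_eq_single k]
    · simp
    · intro k' _ hk'
      simp [Pi.single_eq_of_ne hk']
    · intro hk
      exact absurd (Finset.mem_range.2 (lt_of_lt_of_le (Nat.lt_succ_self k) (le_max_right _ _))) hk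
    · intro j' _ hj'
      refine Finset.sum_eq_zero fun k' _ => ?_
      by_cases hk' : k' = k
      · subst hk'; simp [Pi.single_eq_of_ne hj']
      · simp [Pi.single_eq_of_ne hk']
    · simp
  funext j
  apply DiffOp.toPoly_injective
  ext1 k
  refine germ_ext ?_
  filter_upwards [key r k j, key r' k j, h k j] with x h1 h2 h3
  rw [← h1, ← h2, h3]

end RowEval
end

noncomputable section

/-! ### Rows of operators, differential forms and pullbacks -/

section RowForms

variable {n n' q : ℕ} {x₀ : Jet n} {y₀ : Jet n'}

/-- This connects the exterior derivative on finitely supported forms, used in the definition of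
strong closedness, with `extD`, for which pullback and Cartan's formula are available. -/
theorem extDerivForm_matForm_dx {r : ℕ} (A : Matrix (Fin r) (Fin n) (JetOp x₀)) (i : Fin r) :
    ∀ᶠ x in 𝓝 x₀, ∀ v w : Jet n,
      extDerivForm (matForm A (dxForm x₀) i) x v w = extD (rowEval (A i)) x v w := by
  have h0 : ∀ᶠ x in 𝓝 x₀, germRep (0 : analyticGerms x₀) =ᶠ[𝓝 x] fun _ => (0 : ℝ) :=
    eventually_eventually_nhds.2 germRep_zero
  filter_upwards [lineDeriv_rowEval (A i) le_rfl, h0] with x h1 h2 v w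
  have h3 : ∀ u : Jet n, lineDeriv ℝ (germRep (0 : analyticGerms x₀)) x u = 0 := fun u => by
    rw [lineDeriv_congr h2]; simp [lineDeriv]
  unfold extDerivForm extD
  rw [h1, h1, ← Finset.sum_sub_distrib,
    Finsupp.sum_of_support_subset (s := Finset.range (rowOrder (A i)) ×ˢ Finset.univ),
    Finset.sum_product_right]
  · refine Finset.sum_congr rfl fun j _ => ?_
    rw [← Finset.sum_sub_distrib]
    refine Finset.sum_congr rfl fun k _ => ?_
    rw [matForm_dx_apply]
  · rintro ⟨k, j⟩ hk
    rw [Finsupp.mem_support_iff, matForm_dx_apply] at hk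
    refine Finset.mem_product.2 ⟨Finset.mem_range.2 ?_, Finset.mem_univ _⟩
    exact (Polynomial.le_natDegree_of_ne_zero hk).trans_lt (natDegree_lt_rowOrder (A i) j)
  · intro b _
    rw [h3, h3]
    ring

/-- Every 1-form is given by a row of operators. -/
theorem JetFormAt.exists_row {e : Jet n → Jet n → ℝ} (he : JetFormAt e x₀) :
    ∃ r : Fin n → JetOp x₀, ∀ᶠ x in 𝓝 x₀, ∀ v, rowEval r x v = e x v := by
  obtain ⟨N, g, hg, hge⟩ := id he
  -- The coefficient of dx_i^{(k)} is the value of the form on the corresponding coordinate vector.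
  let a : Fin n → ℕ → analyticGerms x₀ := fun i k =>
    analyticGerms.mk (fun z => e z (Pi.single k (Pi.single i 1)))
      (he.jetAnalyticAt_apply (jetMapAt_const _ x₀))
  let R : Fin n → ℕ → Fin n → JetOp x₀ := fun i k j => DiffOp.const _ (a i k) *
    (DiffOp.ddt (germDeriv x₀) ^ k * (1 : Matrix (Fin n) (Fin n) (JetOp x₀)) i j)
  refine ⟨∑ i, ∑ k ∈ Finset.range N, R i k, ?_⟩
  filter_upwards [hge, rowEval_sum Finset.univ fun i => ∑ k ∈ Finset.range N, R i k,
    eventually_all.2 fun i => rowEval_sum (Finset.range N) (R i),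
    eventually_all.2 fun i => (eventually_all_finset (Finset.range N)).2 fun k _ =>
      rowEval_const_mul (a i k) fun j =>
        DiffOp.ddt (germDeriv x₀) ^ k * (1 : Matrix (Fin n) (Fin n) (JetOp x₀)) i j,
    eventually_all.2 fun i => (eventually_all_finset (Finset.range N)).2 fun k _ =>
      rowEval_ddt_pow_single (x₀ := x₀) k i,
    eventually_all.2 fun i => (eventually_all_finset (Finset.range N)).2 fun k _ =>
      germRep_mk (fun z => e z (Pi.single k (Pi.single i 1)))
        (he.jetAnalyticAt_apply (jetMapAt_const _ x₀))] with x h0 h1 h2 h3 h4 h5 v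
  have h6 : jetTrunc N v = ∑ i : Fin n, ∑ k : Fin N, v k i •
      jetTrunc N (Pi.single (k : ℕ) (Pi.single i (1 : ℝ)) : Jet n) := by
    funext k i
    simp only [Finset.sum_apply, Pi.smul_apply, smul_eq_mul]
    rw [Finset.sum_eq_single i, Finset.sum_eq_single k]
    · simp [jetTrunc]
    · intro k' _ hk'
      simp [jetTrunc, Pi.single_eq_of_ne (fun h => hk' (Fin.ext h.symm) : (k : ℕ) ≠ k')]
    · simp
    · intro i' _ hi'
      refine Finset.sum_eq_zero fun k' _ => ?_
      by_cases hk' : (k : ℕ) = k'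
      · simp [jetTrunc, hk', Pi.single_eq_of_ne hi'.symm]
      · simp [jetTrunc, Pi.single_eq_of_ne hk']
    · simp
  rw [h1, h0 v, h6, map_sum]
  refine Finset.sum_congr rfl fun i _ => ?_
  rw [h2, map_sum, Finset.sum_range]
  refine Finset.sum_congr rfl fun k _ => ?_
  have hk := Finset.mem_range.2 k.2
  rw [map_smul, smul_eq_mul, ← h0, mul_comm]
  exact (h3 i k hk v).trans (by rw [h4 i k hk, h5 i k hk])

/-- The pullback of operators along a map that relates the Cartan fields. -/
def pullOp (Φ : Jet n' → Jet n) (hΦ : ∀ᶠ y in 𝓝 y₀, JetMapAt Φ y) (h : Φ y₀ = x₀)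
    (hL : ∀ᶠ y in 𝓝 y₀, jetTangent Φ y (cartanField y) = cartanField (Φ y)) :
    JetOp x₀ →+* JetOp y₀ :=
  DiffOp.mapHom (pullGerm Φ hΦ.self_of_nhds h) (pullGerm_deriv hΦ h hL)

theorem rowEval_pullOp {Φ : Jet n' → Jet n} (hΦ : ∀ᶠ y in 𝓝 y₀, JetMapAt Φ y) (h : Φ y₀ = x₀)
    (hL : ∀ᶠ y in 𝓝 y₀, jetTangent Φ y (cartanField y) = cartanField (Φ y))
    (r : Fin q → JetOp x₀) : ∀ᶠ y in 𝓝 y₀, ∀ C : Jet q,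
      rowEval (fun j => pullOp Φ hΦ h hL (r j)) y C = rowEval r (Φ y) C := by
  let r' : Fin q → JetOp y₀ := fun j => pullOp Φ hΦ h hL (r j)
  filter_upwards [rowEval_eq_range r' (le_max_left (rowOrder r') (rowOrder r)),
    eventually_comp hΦ.self_of_nhds h
      (rowEval_eq_range r (le_max_right (rowOrder r') (rowOrder r))),
    eventually_all.2 fun j =>
      (eventually_all_finset (Finset.range (max (rowOrder r') (rowOrder r)))).2 fun k _ =>
      germRep_pullGerm hΦ.self_of_nhds h ((r j).toPoly.coeff k)] with y h1 h2 h3 C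
  rw [h1, h2]
  refine Finset.sum_congr rfl fun j _ => Finset.sum_congr rfl fun k hk => ?_
  rw [← h3 j k hk]
  congr 2
  exact congrArg (fun P : Polynomial _ => P.coeff k) (DiffOp.toPoly_mapHom _ _ _)
    |>.trans (Polynomial.coeff_map _ _)

/-- If the row `r` is the differential of `f`, then `(d/dt)^k r` is the differential of `L^k f`. -/
theorem rowEval_ddt_pow_mul {f : Jet n → ℝ} (hf : AnalyticJetAt f x₀) {r : Fin n → JetOp x₀}
    (h : ∀ᶠ x in 𝓝 x₀, ∀ v, rowEval r x v = lineDeriv ℝ f x v) (k : ℕ) :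
    ∀ᶠ x in 𝓝 x₀, ∀ v, rowEval (fun j => DiffOp.ddt _ ^ k * r j) x v =
      lineDeriv ℝ (cartanDeriv^[k] f) x v := by
  induction k with
  | zero => simpa using h
  | succ k ih =>
    -- Multiplication by d/dt is the Lie derivative, which commutes with d.
    have h1 := rowEval_ddt_mul fun j => DiffOp.ddt (germDeriv x₀) ^ k * r j
    simp only [pow_succ', mul_assoc, Function.iterate_succ_apply']
    filter_upwards [h1, ih.eventually_nhds,
      JetAnalyticAt.eventually (AnalyticJetAt.cartanDeriv_iterate hf k)] with x h2 h3 h4 v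
    rw [h2, formLie_congr h3, lineDeriv_cartanDeriv h4]

/-- Each order k has its own neighbourhood of validity, so near x₀ only finitely many orders can be
treated together. -/
theorem rowProlong_eq {φ : Fin q → Jet n → ℝ} (hφ : ∀ i, AnalyticJetAt (φ i) x₀)
    {A : Matrix (Fin q) (Fin n) (JetOp x₀)}
    (hA : ∀ i, ∀ᶠ x in 𝓝 x₀, ∀ v, rowEval (A i) x v = lineDeriv ℝ (φ i) x v) (M : ℕ) :
    ∀ᶠ x in 𝓝 x₀, ∀ k < M, ∀ i v, rowProlong A x v k i = jetTangent (prolong φ) x v k i := by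
  have h1 : ∀ᶠ x in 𝓝 x₀, ∀ k ∈ Finset.range M, ∀ i v,
      rowProlong A x v k i = lineDeriv ℝ (cartanDeriv^[k] (φ i)) x v :=
    (eventually_all_finset (Finset.range M)).2 fun k _ =>
      eventually_all.2 fun i => rowEval_ddt_pow_mul (hφ i) (hA i) k
  filter_upwards [h1, eventually_all.2 fun i => JetAnalyticAt.eventually (hφ i)] with x h2 h3 k hk i v
  rw [h2 k (Finset.mem_range.2 hk), jetTangent_prolong h3]

theorem rowEval_vecMul_of_differentials {φ : Fin q → Jet n → ℝ}
    (hφ : ∀ i, AnalyticJetAt (φ i) x₀) {A : Matrix (Fin q) (Fin n) (JetOp x₀)}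
    (hA : ∀ i, ∀ᶠ x in 𝓝 x₀, ∀ v, rowEval (A i) x v = lineDeriv ℝ (φ i) x v)
    (r : Fin q → JetOp x₀) :
    ∀ᶠ x in 𝓝 x₀, ∀ v, rowEval (Matrix.vecMul r A) x v =
      rowEval r x (jetTangent (prolong φ) x v) := by
  filter_upwards [rowEval_vecMul r A, rowProlong_eq hφ hA (rowOrder r)] with x h1 h2 v
  rw [h1]
  exact rowEval_congr_right r fun k hk j => h2 k hk j v

end RowForms

-- The matrix P(F) as the differential of the equations

namespace ImplicitSystem

variable {n p : ℕ} {S : ImplicitSystem n p} {x₀ : Jet n}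

/-- The rows of `P(F)` are the differentials of the equations. -/
theorem rowEval_polyMatrix (hx₀ : x₀ 0 ∈ S.X) (i : Fin p) :
    ∀ᶠ x in 𝓝 x₀, ∀ v, rowEval (S.polyMatrix x₀ hx₀ i) x v = lineDeriv ℝ (S.eqn i) x v := by
  let r := S.polyMatrix x₀ hx₀ i
  let a : Fin n → analyticGerms x₀ := fun j =>
    analyticGerms.mk _ (S.analyticJetAt_partial hx₀ i (Pi.single j 1, 0))
  let b : Fin n → analyticGerms x₀ := fun j =>
    analyticGerms.mk _ (S.analyticJetAt_partial hx₀ i (0, Pi.single j 1))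
  have hr : ∀ j, (r j).toPoly = Polynomial.C (a j) + Polynomial.C (b j) * Polynomial.X :=
    fun j => rfl
  filter_upwards [rowEval_eq_range r (le_max_left (rowOrder r) 2), germRep_zero,
    eventually_all.2 fun j => germRep_mk _ (S.analyticJetAt_partial hx₀ i (Pi.single j 1, 0)),
    eventually_all.2 fun j => germRep_mk _ (S.analyticJetAt_partial hx₀ i (0, Pi.single j 1)),
    S.isOpen_stateJets.mem_nhds hx₀] with x h1 h0 h2 h3 hX v
  have h4 : lineDeriv ℝ (S.eqn i) x v = fderiv ℝ S.F (x 0, x 1) (v 0, v 1) i := by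
    have h5 := JetAnalyticAt.lineDeriv_comp (u := fun z : Jet n => (z 0, z 1)) (G := S.F) (x := x)
      (S.analytic_F _ ⟨hX, trivial⟩) (jetAnalyticAt_pair x) v
    have h6 := JetAnalyticAt.lineDeriv_pi (u := fun z : Jet n => S.F (z 0, z 1)) (x := x)
      (JetAnalyticAt.comp_analyticAt (G := S.F) (S.analytic_F _ ⟨hX, trivial⟩)
        (jetAnalyticAt_pair x)) v i
    rw [lineDeriv_pair] at h5
    rw [← h5, ← h6]
    rfl
  have h7 : ((v 0, v 1) : (Fin n → ℝ) × (Fin n → ℝ)) = ∑ j, (v 0 j • ((Pi.single j 1, 0) :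
      (Fin n → ℝ) × (Fin n → ℝ)) + v 1 j • ((0, Pi.single j 1) : (Fin n → ℝ) × (Fin n → ℝ))) := by
    refine Prod.ext ?_ ?_ <;> funext l <;>
      simp [Prod.fst_sum, Prod.snd_sum, Finset.sum_apply, Pi.single_apply]
  rw [h1, h4, h7, map_sum, Finset.sum_apply]
  refine Finset.sum_congr rfl fun j _ => ?_
  rw [← Finset.sum_subset (Finset.range_mono (le_max_right (rowOrder r) 2))]
  · rw [Finset.sum_range_succ, Finset.sum_range_one, hr]
    simp only [Polynomial.coeff_add, Polynomial.coeff_C_zero, Polynomial.coeff_C_mul,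
      Polynomial.coeff_X_zero, mul_zero, add_zero, Polynomial.coeff_C_succ, Polynomial.coeff_X_one,
      mul_one, zero_add, map_add, map_smul, Pi.add_apply, Pi.smul_apply, smul_eq_mul, a, b]
    rw [h2, h3]
    ring
  · intro k _ hk
    have hk2 : 2 ≤ k := not_lt.1 (Finset.mem_range.not.1 hk)
    have hc : (r j).toPoly.coeff k = 0 := by
      rw [hr, Polynomial.coeff_add, Polynomial.coeff_C_mul, Polynomial.coeff_C_of_ne_zero (by omega),
        Polynomial.coeff_X_of_ne_one (by omega), mul_zero, add_zero]
    rw [hc, h0, zero_mul]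

end ImplicitSystem
end

noncomputable section

/-! ### Splittings attached to Smith decompositions -/

section Splitting

variable {R : Type*} [Ring R] {p m : ℕ}

theorem rectId_mul_apply {r s t : ℕ} (h : r ≤ s) (A : Matrix (Fin s) (Fin t) R) (i : Fin r)
    (j : Fin t) : (rectId R r s * A) i j = A (Fin.castLE h i) j := by
  rw [Matrix.mul_apply, Finset.sum_eq_single (Fin.castLE h i)]
  · simp [rectId]
  · intro k _ hk
    rw [rectId, Matrix.of_apply, if_neg fun h' => hk (Fin.ext h'.symm), zero_mul]
  · simp

theorem rectId_mul_lowerId : rectId R p (p + m) * lowerId R p m = 0 := by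
  ext i j
  rw [rectId_mul_apply (Nat.le_add_right p m), lowerId, Matrix.of_apply, Matrix.zero_apply, if_neg]
  have := i.2
  simp only [Fin.val_castLE]
  omega

theorem rectId_mul_rectId : rectId R m (p + m) * rectId R (p + m) m = 1 := by
  ext i j
  rw [rectId_mul_apply (Nat.le_add_left m p), rectId, Matrix.of_apply, Matrix.one_apply]
  simp [Fin.ext_iff]

/-- The two products are the complementary projections onto the first p and the last m coordinates.
-/
theorem rectId_mul_add_lowerId_mul :
    rectId R (p + m) p * rectId R p (p + m) + lowerId R p m * (lowerId R p m).transpose = 1 := by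
  ext i j
  rw [Matrix.add_apply, Matrix.mul_apply, Matrix.mul_apply]
  simp only [rectId, lowerId, Matrix.of_apply, Matrix.transpose_apply, Matrix.one_apply,
    mul_ite, mul_one, mul_zero]
  refine Fin.addCases (fun i => ?_) (fun i => ?_) i
  · rw [Finset.sum_eq_single i, Finset.sum_eq_zero]
    · simp [Fin.ext_iff]
    · intro k _
      have := i.2
      rw [if_neg (c := ((Fin.castAdd m i : Fin (p + m)) : ℕ) = p + k) (by simp; omega), ite_self]
    · intro k _ hk
      rw [if_neg (c := ((Fin.castAdd m i : Fin (p + m)) : ℕ) = k)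
        (fun h => hk (Fin.ext (by simpa using h.symm))), ite_self]
    · simp
  · rw [Finset.sum_eq_zero, Finset.sum_eq_single i]
    · simp [Fin.ext_iff, eq_comm]
    · intro k _ hk
      rw [if_neg (c := ((Fin.natAdd p i : Fin (p + m)) : ℕ) = p + k)
        (fun h => hk (Fin.ext (by simpa using h.symm))), ite_self]
    · simp
    · intro k _
      have := k.2
      rw [if_neg (c := ((Fin.natAdd p i : Fin (p + m)) : ℕ) = k) (by simp; omega), ite_self]

/-- Let VPU = (I, 0), Û = U(0; I), and QÛW = (I; 0). With G = ÛW, N = W⁻¹(0, I)U⁻¹ and X = U(I; 0)V,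
the two complementary projections give GN + XP = 1, and PG = 0. For B = (I, 0)Q one has BG = 1, so
multiplication by B on the left gives B = N + BXP. Thus B may replace N once X is replaced by X -
GBX. -/
theorem exists_splitting {P : Matrix (Fin p) (Fin (p + m)) R}
    {U : Matrix (Fin (p + m)) (Fin (p + m)) R} (hU : U ∈ rightSmith P)
    {Q : Matrix (Fin (p + m)) (Fin (p + m)) R} (hQ : Q ∈ leftSmith (U * lowerId R p m)) :
    ∃ (G : Matrix (Fin (p + m)) (Fin m) R) (X : Matrix (Fin (p + m)) (Fin p) R),
      P * G = 0 ∧ rectId R m (p + m) * Q * G = 1 ∧ G * (rectId R m (p + m) * Q) + X * P = 1 := by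
  obtain ⟨hU, V, hV', hV⟩ := hU
  obtain ⟨-, W, hW', hW⟩ := hQ
  obtain ⟨U', hu, -⟩ := isUnit_iff_exists.1 hU
  obtain ⟨V', -, hv⟩ := isUnit_iff_exists.1 hV'
  obtain ⟨W', hw, -⟩ := isUnit_iff_exists.1 hW'
  have hPU : P * (U * lowerId R p m) = 0 := by
    have h1 : V * (P * (U * lowerId R p m)) = 0 := by
      rw [← Matrix.mul_assoc, ← Matrix.mul_assoc, hV, rectId_mul_lowerId]
    calc P * (U * lowerId R p m) = 1 * (P * (U * lowerId R p m)) := (Matrix.one_mul _).symm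
      _ = 0 := by rw [← hv, Matrix.mul_assoc, h1, Matrix.mul_zero]
  set B := rectId R m (p + m) * Q
  set G := U * lowerId R p m * W
  set X := U * rectId R (p + m) p * V
  set N := W' * ((lowerId R p m).transpose * U')
  have hBG : B * G = 1 := by
    rw [Matrix.mul_assoc, ← Matrix.mul_assoc Q, hW, rectId_mul_rectId]
  have h1 : G * N + X * P = 1 := by
    have h3 : G * N = U * (lowerId R p m * (lowerId R p m).transpose) * U' := by
      calc G * N = U * lowerId R p m * ((W * W') * ((lowerId R p m).transpose * U')) := by
            simp only [G, N, Matrix.mul_assoc]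
        _ = _ := by rw [hw, Matrix.one_mul]; simp only [Matrix.mul_assoc]
    have h4 : X * P = U * (rectId R (p + m) p * rectId R p (p + m)) * U' := by
      calc X * P = U * rectId R (p + m) p * (V * P * (U * U')) := by
            rw [hu, Matrix.mul_one]; simp only [X, Matrix.mul_assoc]
        _ = U * rectId R (p + m) p * (V * P * U) * U' := by simp only [Matrix.mul_assoc]
        _ = _ := by rw [hV]; simp only [Matrix.mul_assoc]
    rw [h3, h4, ← Matrix.add_mul, ← Matrix.mul_add, add_comm (lowerId R p m * _), rectId_mul_add_lowerId_mul,
      Matrix.mul_one, hu]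
  have h2 : N + B * X * P = B := by
    calc N + B * X * P = B * (G * N + X * P) := by
          rw [Matrix.mul_add, ← Matrix.mul_assoc B G, hBG, Matrix.one_mul, Matrix.mul_assoc]
      _ = B := by rw [h1, Matrix.mul_one]
  refine ⟨G, X - G * B * X, ?_, hBG, ?_⟩
  · rw [← Matrix.mul_assoc, hPU, Matrix.zero_mul]
  · calc G * B + (X - G * B * X) * P = G * (N + B * X * P) + (X - G * B * X) * P := by rw [h2]
      _ = G * N + X * P := by
        rw [Matrix.mul_add, Matrix.sub_mul]
        simp only [Matrix.mul_assoc]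
        abel
      _ = 1 := h1

/-- For a decomposition VPU = (I, 0), a matrix in the left Smith set of U(0; I) is U⁻¹ followed by
the permutation that moves the last m rows to the top. -/
theorem exists_mem_leftSmith {P : Matrix (Fin p) (Fin (p + m)) R} (hP : IsHyperRegular P) :
    ∃ U ∈ rightSmith P, (leftSmith (U * lowerId R p m)).Nonempty := by
  obtain ⟨V, U, hV, hU, h⟩ := hP
  refine ⟨U, ⟨hU, V, hV, h⟩, ?_⟩
  obtain ⟨U', hUU', hU'U⟩ := isUnit_iff_exists.1 hU
  let σ : Fin (p + m) ≃ Fin (p + m) := (finCongr (Nat.add_comm p m)).trans finAddFlip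
  let Sw : Matrix (Fin (p + m)) (Fin (p + m)) R :=
    (1 : Matrix (Fin (p + m)) (Fin (p + m)) R).submatrix σ id
  have hmul : ∀ (τ : Fin (p + m) ≃ Fin (p + m)) {t : ℕ} (A : Matrix (Fin (p + m)) (Fin t) R),
      (1 : Matrix (Fin (p + m)) (Fin (p + m)) R).submatrix τ id * A = A.submatrix τ id := by
    intro τ t A
    ext i j
    simp [Matrix.mul_apply, Matrix.one_apply]
  have hSw : IsUnit Sw := by
    refine ⟨⟨Sw, (1 : Matrix (Fin (p + m)) (Fin (p + m)) R).submatrix σ.symm id, ?_, ?_⟩, rfl⟩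
    · rw [hmul]; ext i j; simp [Matrix.one_apply]
    · rw [hmul]; ext i j; simp [Sw, Matrix.one_apply]
  refine ⟨Sw * U', hSw.mul (isUnit_iff_exists.2 ⟨U, hU'U, hUU'⟩), 1, isUnit_one, ?_⟩
  rw [Matrix.mul_one, Matrix.mul_assoc, ← Matrix.mul_assoc U', hU'U, Matrix.one_mul, hmul]
  ext i j
  have hσ : ((σ i : Fin (p + m)) : ℕ) = p + j ↔ (i : ℕ) = j := by
    have hj := j.2
    obtain ⟨i', rfl⟩ := (finCongr (Nat.add_comm m p)).surjective i
    refine Fin.addCases (fun a => ?_) (fun a => ?_) i'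
    · simp [σ]
    · have := a.2
      simp [σ]
      omega
  simp only [lowerId, rectId, Matrix.submatrix_apply, Matrix.of_apply, id]
  exact if_congr hσ rfl rfl

end Splitting

/-! ### Rows of operators on the tangent spaces of the solution set -/

namespace ImplicitSystem

variable {n p m : ℕ} {S : ImplicitSystem n p} {x₀ : Jet n}

/-- The entries of the prolonged P(F) at v are the differentials of all L_τ^k F at v. -/
theorem mem_solutionTangent_of_rowProlong (hx₀ : x₀ 0 ∈ S.X) {v : Jet n}
    (h : rowProlong (S.polyMatrix x₀ hx₀) x₀ v = 0) : v ∈ S.solutionTangent x₀ := by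
  intro k i
  rw [← (rowEval_ddt_pow_mul (analyticJetAt_eqn hx₀ i)
    (rowEval_polyMatrix hx₀ i) k).self_of_nhds v]
  exact congrFun (congrFun h k) i

/-- At the single point x₀ all infinitely many orders can be treated at once; on a neighbourhood
every order could require further shrinking. -/
theorem rowProlong_mul {s q t : ℕ} (A : Matrix (Fin s) (Fin q) (JetOp x₀))
    (N : Matrix (Fin q) (Fin t) (JetOp x₀)) (C : Jet t) :
    rowProlong (A * N) x₀ C = rowProlong A x₀ (rowProlong N x₀ C) := by
  funext k i
  have h : (fun j => DiffOp.ddt (germDeriv x₀) ^ k * (A * N) i j) =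
      Matrix.vecMul (fun j => DiffOp.ddt (germDeriv x₀) ^ k * A i j) N := by
    funext j
    simp only [Matrix.mul_apply, Matrix.vecMul, dotProduct, Finset.mul_sum, mul_assoc]
  unfold rowProlong
  rw [h, (rowEval_vecMul _ N).self_of_nhds]
  rfl

theorem rowProlong_one {q : ℕ} (C : Jet q) :
    rowProlong (1 : Matrix (Fin q) (Fin q) (JetOp x₀)) x₀ C = C := by
  funext k i
  exact (rowEval_ddt_pow_single k i).self_of_nhds C

theorem rowProlong_zero {s q : ℕ} (C : Jet q) :
    rowProlong (0 : Matrix (Fin s) (Fin q) (JetOp x₀)) x₀ C = 0 := by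
  funext k i
  have h : (fun j => DiffOp.ddt (germDeriv x₀) ^ k * (0 : Matrix (Fin s) (Fin q) (JetOp x₀)) i j) = 0 := by
    funext j
    simp
  unfold rowProlong
  rw [h]
  exact rowEval_zero.self_of_nhds C

/-- The vector is obtained by applying G to C: PG = 0 makes it tangent, and BG = 1 gives its values
under B. Thus all derivatives of B dx are independent on the tangent space. -/
theorem exists_mem_solutionTangent (hx₀ : x₀ 0 ∈ S.X) {B : Matrix (Fin m) (Fin n) (JetOp x₀)}
    {G : Matrix (Fin n) (Fin m) (JetOp x₀)} (hPG : S.polyMatrix x₀ hx₀ * G = 0) (hBG : B * G = 1)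
    (C : Jet m) : ∃ v ∈ S.solutionTangent x₀, rowProlong B x₀ v = C := by
  refine ⟨rowProlong G x₀ C, mem_solutionTangent_of_rowProlong hx₀ ?_, ?_⟩
  · rw [← rowProlong_mul, hPG, rowProlong_zero]
  · rw [← rowProlong_mul, hBG, rowProlong_one]

theorem IsRetraction.jetMapAt_jetTangent {O : Set (Jet n)} {ρ : Jet n → Jet n}
    (hρ : S.IsRetraction O ρ) {x : Jet n} (hx : x ∈ O) (v : Jet n) :
    JetMapAt (fun z => jetTangent ρ z v) x := by
  refine JetMapAt.of_components fun k i => ?_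
  have h := (JetFormAt.of_analytic ((hρ.jetMapAt x hx).component k i)).jetAnalyticAt_apply
    (jetMapAt_const v x)
  refine JetAnalyticAt.congr h ?_
  filter_upwards [hρ.eventually_mem hx] with z hz
  exact jetTangent_apply (hρ.jetMapAt z hz) v k i

/-- A combination of the derivatives of `B dx` that vanishes on the solution set is trivial there. -/
theorem rowEval_eq_zero_of_vecMul (hx₀ : x₀ ∈ S.solutionJets) {O : Set (Jet n)} {ρ : Jet n → Jet n}
    (hρ : S.IsRetraction O ρ) (hO : x₀ ∈ O) {B : Matrix (Fin m) (Fin n) (JetOp x₀)}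
    {G : Matrix (Fin n) (Fin m) (JetOp x₀)} (hPG : S.polyMatrix x₀ hx₀.1 * G = 0) (hBG : B * G = 1)
    {r : Fin m → JetOp x₀} (hr : ∀ᶠ x in 𝓝 x₀, x ∈ S.solutionJets → ∀ v ∈ S.solutionTangent x,
      rowEval (Matrix.vecMul r B) x v = 0) :
    ∀ᶠ x in 𝓝 x₀, x ∈ S.solutionJets → ∀ C : Jet m, rowEval r x C = 0 := by
  classical
  let ι := Fin m × Fin (rowOrder r)
  have hv : ∀ a : ι, ∃ v ∈ S.solutionTangent x₀,
      rowProlong B x₀ v = Pi.single (a.2 : ℕ) (Pi.single a.1 1) :=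
    fun a => exists_mem_solutionTangent hx₀.1 hPG hBG _
  choose v hvT hvB using hv
  -- Rows are dual vectors at x₀, carried to nearby solutions by the tangent map of ρ; columns are
  -- the derivatives of B dx up to the order of r. The matrix is the identity at x₀, hence
  -- invertible nearby.
  let Θ : Jet n → Matrix ι ι ℝ := fun x => Matrix.of fun a b =>
    rowProlong B x (jetTangent ρ x (v a)) b.2 b.1
  have hΘ : ContinuousAt Θ x₀ := by
    refine continuousAt_pi.2 fun a => continuousAt_pi.2 fun b => ?_
    exact ((jetFormAt_rowEval _).jetAnalyticAt_apply
      (hρ.jetMapAt_jetTangent hO (v a))).continuousAt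
  have hΘ0 : Θ x₀ = 1 := by
    ext a b
    simp only [Θ, Matrix.of_apply]
    rw [hρ.tangent x₀ hO hx₀ _ (hvT a), hvB, Matrix.one_apply]
    by_cases h2 : b.2 = a.2
    · by_cases h1 : b.1 = a.1
      · rw [if_pos (Prod.ext h1.symm h2.symm), h2, h1, Pi.single_eq_same, Pi.single_eq_same]
      · rw [if_neg fun h => h1 (by rw [h]), h2, Pi.single_eq_same, Pi.single_eq_of_ne h1]
    · rw [if_neg fun h => h2 (by rw [h]), Pi.single_eq_of_ne (fun h => h2 (Fin.ext h)),
        Pi.zero_apply]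
  have hdet : ∀ᶠ x in 𝓝 x₀, (Θ x).det ≠ 0 := by
    have h1 : ContinuousAt (fun x => (Θ x).det) x₀ :=
      ContinuousAt.comp (g := Matrix.det) (continuous_id.matrix_det).continuousAt hΘ
    refine h1.eventually_ne ?_
    rw [hΘ0, Matrix.det_one]
    exact one_ne_zero
  filter_upwards [hr, hdet, rowEval_vecMul r B, rowEval_eq_range r le_rfl, hρ.eventually_mem hO]
    with x h1 h2 h3 h4 h5 hx C
  let a : ι → ℝ := fun b => germRep ((r b.1).toPoly.coeff b.2) x
  have hsum : ∀ C : Jet m, rowEval r x C = ∑ b : ι, C b.2 b.1 * a b := by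
    intro C
    rw [h4, Fintype.sum_prod_type]
    refine Finset.sum_congr rfl fun j _ => ?_
    rw [Finset.sum_range]
    exact Finset.sum_congr rfl fun k _ => mul_comm _ _
  -- At a solution x the hypothesis on the vectors above says that Θ(x) annihilates the coefficients
  -- of r.
  have ha : a = 0 := by
    refine Matrix.eq_zero_of_mulVec_eq_zero h2 ?_
    funext b
    have h6 := h1 hx (jetTangent ρ x (v b)) (by
      have := hρ.jetTangent_mem h5 (v b)
      rwa [hρ.eq_self x h5 hx] at this)
    rw [h3, hsum] at h6
    exact h6
  rw [hsum, ha]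
  simp

end ImplicitSystem
end

noncomputable section

/-! ### Flat parametrizations -/

section AnalyticOn

variable {n : ℕ}

/-- `f` is given on `W` by one analytic function of finitely many coordinates. -/
def AnalyticJetOn (f : Jet n → ℝ) (W : Set (Jet n)) : Prop :=
  ∃ (N : ℕ) (g : (Fin N → Fin n → ℝ) → ℝ), ∀ y ∈ W,
    AnalyticAt ℝ g (jetTrunc N y) ∧ f y = g (jetTrunc N y)

theorem AnalyticJetOn.analyticJetAt {f : Jet n → ℝ} {W : Set (Jet n)} (h : AnalyticJetOn f W)
    (hW : IsOpen W) {y : Jet n} (hy : y ∈ W) : AnalyticJetAt f y := by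
  obtain ⟨N, g, hg⟩ := h
  exact ⟨N, g, (hg y hy).1, Filter.mem_of_superset (hW.mem_nhds hy) fun z hz => (hg z hz).2⟩

theorem AnalyticJetOn.mono {f : Jet n → ℝ} {W W' : Set (Jet n)} (h : AnalyticJetOn f W)
    (hW : W' ⊆ W) : AnalyticJetOn f W' := by
  obtain ⟨N, g, hg⟩ := h
  exact ⟨N, g, fun y hy => hg y (hW hy)⟩

/-- Differentiation raises the number of coordinates but does not shrink W, so one W serves all the
infinitely many components of a prolongation. -/
theorem AnalyticJetOn.cartanDeriv {f : Jet n → ℝ} {W : Set (Jet n)} (h : AnalyticJetOn f W)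
    (hW : IsOpen W) : AnalyticJetOn (cartanDeriv f) W := by
  obtain ⟨N, g, hg⟩ := h
  refine ⟨N + 1, fun w => fderiv ℝ g (truncRestrict n N.le_succ w) (truncShift n N w),
    fun y hy => ⟨?_, ?_⟩⟩
  · exact AnalyticAt.comp₂
      ((ContinuousLinearMap.id ℝ ((Fin N → Fin n → ℝ) →L[ℝ] ℝ)).analyticAt_bilinear _)
      (AnalyticAt.comp (g := fderiv ℝ g) (f := truncRestrict n N.le_succ) (hg y hy).1.fderiv
        ((truncRestrict n N.le_succ).analyticAt _))
      ((truncShift n N).analyticAt _)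
  · have h1 : f =ᶠ[𝓝 y] fun z => g (jetTrunc N z) :=
      Filter.mem_of_superset (hW.mem_nhds hy) fun z hz => (hg z hz).2
    exact ((AnalyticJetAt.hasLineDerivAt (hg y hy).1 h1).self_of_nhds (cartanField y)).lineDeriv

theorem AnalyticJetOn.cartanDeriv_iterate {f : Jet n → ℝ} {W : Set (Jet n)}
    (h : AnalyticJetOn f W) (hW : IsOpen W) (k : ℕ) :
    AnalyticJetOn (_root_.cartanDeriv^[k] f) W := by
  induction k with
  | zero => exact h
  | succ k ih => rw [Function.iterate_succ_apply']; exact ih.cartanDeriv hW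

theorem AnalyticJetAt.exists_analyticJetOn {f : Jet n → ℝ} {x : Jet n} (h : AnalyticJetAt f x) :
    ∃ W, IsOpen W ∧ x ∈ W ∧ AnalyticJetOn f W := by
  obtain ⟨N, g, hg, hf⟩ := h
  have h1 : ∀ᶠ z in 𝓝 x, AnalyticAt ℝ g (jetTrunc N z) ∧ f z = g (jetTrunc N z) :=
    (((continuous_jetTrunc N).tendsto x).eventually hg.eventually_analyticAt).and hf
  obtain ⟨W, hW, hWo, hxW⟩ := eventually_nhds_iff.1 h1
  exact ⟨W, hWo, hxW, N, g, hW⟩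

theorem exists_common_analyticJetOn {ι : Type*} [Finite ι] {f : ι → Jet n → ℝ} {x : Jet n}
    (h : ∀ i, AnalyticJetAt (f i) x) :
    ∃ W, IsOpen W ∧ x ∈ W ∧ ∀ i, AnalyticJetOn (f i) W := by
  choose W hW hxW hf using fun i => AnalyticJetAt.exists_analyticJetOn (h i)
  exact ⟨⋂ i, W i, isOpen_iInter_of_finite hW, Set.mem_iInter.2 hxW,
    fun i => (hf i).mono (Set.iInter_subset W i)⟩

theorem cartanDeriv_iterate_coord (k : ℕ) (i : Fin n) (x : Jet n) :
    cartanDeriv^[k] (fun z : Jet n => z 0 i) x = x k i := by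
  have h : ∀ k, cartanDeriv^[k] (fun z : Jet n => z 0 i) = fun z => z k i := by
    intro k
    induction k with
    | zero => rfl
    | succ k ih =>
      rw [Function.iterate_succ_apply', ih]
      funext z
      exact lineDeriv_coord₂ k i z _
  rw [h]

theorem relatesCartan_prolong {n' : ℕ} {φ : Fin n → Jet n' → ℝ} {W : Set (Jet n')}
    (hW : IsOpen W) (h : ∀ i, AnalyticJetOn (φ i) W) {𝒴 : Set (Jet n')} (h𝒴 : 𝒴 ⊆ W) :
    ImplicitSystem.RelatesCartan (prolong φ) 𝒴 := by
  intro k i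
  obtain ⟨N, g, hg⟩ := (h i).cartanDeriv_iterate hW k
  refine ⟨N, g, fun y hy => ⟨(hg y (h𝒴 hy)).1, (hg y (h𝒴 hy)).2, ?_⟩⟩
  have h1 : cartanDeriv^[k] (φ i) =ᶠ[𝓝 y] fun z => g (jetTrunc N z) :=
    Filter.mem_of_superset (hW.mem_nhds (h𝒴 hy)) fun z hz => (hg z hz).2
  show cartanDeriv^[k + 1] (φ i) y = _
  rw [Function.iterate_succ_apply']
  exact (cartanDeriv_congr h1).self_of_nhds

end AnalyticOn

-- Flat outputs and Lie-Bäcklund isomorphisms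

namespace ImplicitSystem

variable {n p m : ℕ}

/-- `h` and `φ` are mutually inverse up to prolongation: `h` is a flat output of the system near
`x₀`, and `x = φ(h, ḣ, …)` is the parametrization of the trajectories by it. -/
structure IsFlatParam (S : ImplicitSystem n p) (x₀ : Jet n) (y₀ : Jet m)
    (h : Fin m → Jet n → ℝ) (φ : Fin n → Jet m → ℝ) : Prop where
  analytic_output : ∀ j, AnalyticJetAt (h j) x₀
  analytic_param : ∀ i, AnalyticJetAt (φ i) y₀
  prolong_output : prolong h x₀ = y₀
  prolong_param : prolong φ y₀ = x₀
  mem : ∀ᶠ y in 𝓝 y₀, prolong φ y ∈ S.solutionJets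
  output_param : ∀ᶠ y in 𝓝 y₀, ∀ j, h j (prolong φ y) = y 0 j
  param_output : ∀ᶠ x in 𝓝 x₀, x ∈ S.solutionJets → ∀ i, φ i (prolong h x) = x 0 i

variable {S : ImplicitSystem n p} {x₀ : Jet n} {y₀ : Jet m}

theorem solutionJets_trivialSystem (m : ℕ) : (trivialSystem m).solutionJets = Set.univ :=
  Set.eq_univ_of_forall fun _ => ⟨trivial, fun _ i => i.elim0⟩

/-- A map that relates the Cartan fields is the prolongation of its components of order zero, so
these determine Φ and Ψ. -/
theorem FlatAt.exists_isFlatParam (hS : S.FlatAt x₀ y₀) (hreg : S.RegularAt x₀) :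
    ∃ h φ, S.IsFlatParam x₀ y₀ h φ := by
  obtain ⟨hx₀, -, 𝒳, 𝒴, Φ, Ψ, ⟨O₁, hO₁, hxO₁, rfl⟩, ⟨O₂, hO₂, hyO₂, rfl⟩, hΦ, hΨ, ⟨hΨΦ, hΦΨ⟩,
    hΦ₀, hΨ₀, hΦτ, hΨτ⟩ := hS
  rw [solutionJets_trivialSystem, Set.inter_univ] at *
  obtain ⟨O, ρ, hxO, hρ⟩ := exists_isRetraction hx₀ hreg
  choose N g hg using hΦτ
  choose N' g' hg' using hΨτ
  let φ : Fin n → Jet m → ℝ := fun i y => g 0 i (jetTrunc (N 0 i) y)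
  let h : Fin m → Jet n → ℝ := fun j x => g' 0 j (jetTrunc (N' 0 j) x)
  have hφa : ∀ y ∈ O₂, ∀ i, AnalyticJetAt (φ i) y := fun y hy i =>
    ⟨N 0 i, g 0 i, (hg 0 i y hy).1, EventuallyEq.rfl⟩
  have hha : ∀ x ∈ O₁ ∩ S.solutionJets, ∀ j, AnalyticJetAt (h j) x := fun x hx j =>
    ⟨N' 0 j, g' 0 j, (hg' 0 j x hx).1, EventuallyEq.rfl⟩
  have h1 : ∀ k i, ∀ y ∈ O₂, Φ y k i = cartanDeriv^[k] (φ i) y := by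
    intro k i
    induction k with
    | zero => exact fun y hy => (hg 0 i y hy).2.1
    | succ k ih =>
      intro y hy
      rw [(hg k i y hy).2.2, Function.iterate_succ_apply']
      refine (cartanDeriv_congr ?_).self_of_nhds
      filter_upwards [hO₂.mem_nhds hy] with z hz
      rw [← ih z hz, (hg k i z hz).2.1]
  have h2 : ∀ k j, ∀ x ∈ O₁ ∩ O, x ∈ S.solutionJets → Ψ x k j = cartanDeriv^[k] (h j) x := by
    intro k j
    induction k with
    | zero => exact fun x hx hxS => (hg' 0 j x ⟨hx.1, hxS⟩).2.1
    | succ k ih =>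
      intro x hx hxS
      rw [(hg' k j x ⟨hx.1, hxS⟩).2.2, Function.iterate_succ_apply']
      -- The given extension of the component of order k of Ψ agrees with L_τ^k h on the solution
      -- set only; the derivatives along the tangent vector τ still coincide.
      refine hρ.lineDeriv_eq hx.2 hxS ⟨_, _, (hg' k j x ⟨hx.1, hxS⟩).1, EventuallyEq.rfl⟩
        (AnalyticJetAt.cartanDeriv_iterate (hha x ⟨hx.1, hxS⟩ j) k) ?_
        (cartanField_mem_solutionTangent hxS)
      filter_upwards [(hO₁.inter hρ.isOpen).mem_nhds hx] with z hz hzS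
      rw [← ih z hz hzS, (hg' k j z ⟨hz.1, hzS⟩).2.1]
  have h1' : ∀ y ∈ O₂, prolong φ y = Φ y := fun y hy =>
    funext fun k => funext fun i => (h1 k i y hy).symm
  have h2' : ∀ x ∈ O₁ ∩ O, x ∈ S.solutionJets → prolong h x = Ψ x := fun x hx hxS =>
    funext fun k => funext fun j => (h2 k j x hx hxS).symm
  refine ⟨h, φ, hha x₀ ⟨hxO₁, hx₀⟩, hφa y₀ hyO₂, ?_, ?_, ?_, ?_, ?_⟩
  · rw [h2' x₀ ⟨hxO₁, hxO⟩ hx₀, hΨ₀]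
  · rw [h1' y₀ hyO₂, hΦ₀]
  · filter_upwards [hO₂.mem_nhds hyO₂] with y hy
    rw [h1' y hy]
    exact (hΦ hy).2
  · filter_upwards [hO₂.mem_nhds hyO₂] with y hy j
    rw [h1' y hy]
    have h3 := (hg' 0 j (Φ y) (hΦ hy)).2.1
    rw [hΨΦ hy] at h3
    exact h3.symm
  · filter_upwards [(hO₁.inter hρ.isOpen).mem_nhds ⟨hxO₁, hxO⟩] with x hx hxS i
    rw [h2' x hx hxS]
    have h3 := (hg 0 i (Ψ x) (hΨ ⟨hx.1, hxS⟩)).2.1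
    rw [hΦΨ ⟨hx.1, hxS⟩] at h3
    exact h3.symm

theorem continuousOn_prolong {n n' : ℕ} {φ : Fin n → Jet n' → ℝ} {W : Set (Jet n')}
    (h : ∀ y ∈ W, ∀ i, AnalyticJetAt (φ i) y) : ContinuousOn (prolong φ) W :=
  fun y hy => (jetMapAt_prolong (h y hy)).continuousAt.continuousWithinAt

/-- Prolongations of functions with `φ ∘ prolong h = x` are inverse to one another. -/
theorem IsRetraction.prolong_prolong_eq {O : Set (Jet n)} {ρ : Jet n → Jet n}
    (hρ : S.IsRetraction O ρ) {W : Set (Jet n)} (hW : IsOpen W) (hWO : W ⊆ O)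
    {h : Fin m → Jet n → ℝ} {φ : Fin n → Jet m → ℝ} (hh : ∀ x ∈ W, ∀ j, AnalyticJetAt (h j) x)
    (hφ : ∀ x ∈ W, ∀ i, AnalyticJetAt (φ i) (prolong h x))
    (heq : ∀ x ∈ W, x ∈ S.solutionJets → ∀ i, φ i (prolong h x) = x 0 i) :
    ∀ x ∈ W, x ∈ S.solutionJets → prolong φ (prolong h x) = x := by
  intro x hx hxS
  funext k i
  have h1 := cartanDeriv_iterate_comp (Φ := prolong h) (f := φ i) hW
    (fun y hy => jetMapAt_prolong (hh y hy)) (fun y hy => hφ y hy i)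
    (fun y hy => jetTangent_prolong_cartanField (hh y hy)) k x hx
  -- The identity φ(h, ḣ, …) = x is known on the solution set only, but τ is tangent to it, so L_τ^k
  -- may be applied.
  have h2 := hρ.cartanDeriv_iterate_eq hW hWO (f := fun z => φ i (prolong h z))
    (f' := fun z => z 0 i)
    (fun y hy => JetMapAt.comp_jet (u := φ i) (hφ y hy i) (jetMapAt_prolong (hh y hy)))
    (fun y _ => jetAnalyticAt_coord₂ 0 i y) (fun y hy hyS => heq y hy hyS i) k x hx hxS
  rw [cartanDeriv_iterate_coord] at h2
  exact h1.symm.trans h2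

/-- Apply L_τ^k to the identity of order zero. It holds on an open set of free jets, so no
retraction is needed. -/
theorem prolong_prolong_eq {W : Set (Jet m)} (hW : IsOpen W)
    {h : Fin m → Jet n → ℝ} {φ : Fin n → Jet m → ℝ} (hφ : ∀ y ∈ W, ∀ i, AnalyticJetAt (φ i) y)
    (hh : ∀ y ∈ W, ∀ j, AnalyticJetAt (h j) (prolong φ y))
    (heq : ∀ y ∈ W, ∀ j, h j (prolong φ y) = y 0 j) :
    ∀ y ∈ W, prolong h (prolong φ y) = y := by
  intro y hy
  funext k j
  have h1 := cartanDeriv_iterate_comp (Φ := prolong φ) (f := h j) hW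
    (fun y hy => jetMapAt_prolong (hφ y hy)) (fun y hy => hh y hy j)
    (fun y hy => jetTangent_prolong_cartanField (hφ y hy)) k y hy
  have h2 : (fun z => h j (prolong φ z)) =ᶠ[𝓝 y] fun z => z 0 j :=
    Filter.mem_of_superset (hW.mem_nhds hy) fun z hz => heq z hz j
  have h3 := (cartanDeriv_iterate_congr h2 k).self_of_nhds
  rw [cartanDeriv_iterate_coord] at h3
  exact h1.symm.trans h3

theorem IsFlatParam.eventually_prolong_prolong {h : Fin m → Jet n → ℝ} {φ : Fin n → Jet m → ℝ}
    (H : S.IsFlatParam x₀ y₀ h φ) : ∀ᶠ y in 𝓝 y₀, prolong h (prolong φ y) = y := by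
  have h1 : ∀ᶠ y in 𝓝 y₀, (∀ i, AnalyticJetAt (φ i) y) ∧
      (∀ j, AnalyticJetAt (h j) (prolong φ y)) ∧ ∀ j, h j (prolong φ y) = y 0 j :=
    (eventually_all.2 fun i => JetAnalyticAt.eventually (H.analytic_param i)).and
      ((eventually_comp (jetMapAt_prolong H.analytic_param) H.prolong_param
        (eventually_all.2 fun j => JetAnalyticAt.eventually (H.analytic_output j))).and
        H.output_param)
  obtain ⟨W, hW, hWo, hyW⟩ := eventually_nhds_iff.1 h1
  exact Filter.mem_of_superset (hWo.mem_nhds hyW) (prolong_prolong_eq hWo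
    (fun y hy => (hW y hy).1) (fun y hy => (hW y hy).2.1) fun y hy => (hW y hy).2.2)

/-- The two prolongations are inverse on neighbourhoods A₁ and A₂. Intersecting each with the
preimage of the other makes them bijections between neighbourhoods. -/
theorem IsFlatParam.flatAt {h : Fin m → Jet n → ℝ} {φ : Fin n → Jet m → ℝ}
    (H : S.IsFlatParam x₀ y₀ h φ) (hx₀ : x₀ ∈ S.solutionJets) (hreg : S.RegularAt x₀) :
    S.FlatAt x₀ y₀ := by
  obtain ⟨O, ρ, hxO, hρ⟩ := exists_isRetraction hx₀ hreg
  obtain ⟨Wφ, hWφ, hyWφ, hφ⟩ := exists_common_analyticJetOn H.analytic_param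
  obtain ⟨Wh, hWh, hxWh, hh⟩ := exists_common_analyticJetOn H.analytic_output
  have hφa : ∀ y ∈ Wφ, ∀ i, AnalyticJetAt (φ i) y := fun y hy i => (hφ i).analyticJetAt hWφ hy
  have hha : ∀ x ∈ Wh, ∀ j, AnalyticJetAt (h j) x := fun x hx j => (hh j).analyticJetAt hWh hx
  have e1 : ∀ᶠ x in 𝓝 x₀, x ∈ O ∧ x ∈ Wh ∧ prolong h x ∈ Wφ ∧
      (x ∈ S.solutionJets → ∀ i, φ i (prolong h x) = x 0 i) :=
    (hρ.eventually_mem hxO).and (Filter.Eventually.and (hWh.mem_nhds hxWh)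
      ((eventually_comp (jetMapAt_prolong H.analytic_output) H.prolong_output
        (hWφ.mem_nhds hyWφ)).and H.param_output))
  have e2 : ∀ᶠ y in 𝓝 y₀, y ∈ Wφ ∧ prolong φ y ∈ Wh ∧ prolong φ y ∈ S.solutionJets ∧
      ∀ j, h j (prolong φ y) = y 0 j :=
    Filter.Eventually.and (hWφ.mem_nhds hyWφ)
      ((eventually_comp (jetMapAt_prolong H.analytic_param) H.prolong_param
        (hWh.mem_nhds hxWh)).and (H.mem.and H.output_param))
  obtain ⟨A₁, hA₁, hA₁o, hxA₁⟩ := eventually_nhds_iff.1 e1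
  obtain ⟨A₂, hA₂, hA₂o, hyA₂⟩ := eventually_nhds_iff.1 e2
  have hΨc : ContinuousOn (prolong h) A₁ := continuousOn_prolong fun x hx => hha x (hA₁ x hx).2.1
  have hΦc : ContinuousOn (prolong φ) A₂ := continuousOn_prolong fun y hy => hφa y (hA₂ y hy).1
  have hΨΦ : ∀ y ∈ A₂, prolong h (prolong φ y) = y :=
    prolong_prolong_eq hA₂o (fun y hy => hφa y (hA₂ y hy).1) (fun y hy => hha _ (hA₂ y hy).2.1)
      fun y hy => (hA₂ y hy).2.2.2
  have hΦΨ : ∀ x ∈ A₁, x ∈ S.solutionJets → prolong φ (prolong h x) = x :=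
    hρ.prolong_prolong_eq hA₁o (fun x hx => (hA₁ x hx).1) (fun x hx => hha x (hA₁ x hx).2.1)
      (fun x hx => hφa _ (hA₁ x hx).2.2.1) fun x hx => (hA₁ x hx).2.2.2
  refine ⟨hx₀, by rw [solutionJets_trivialSystem]; trivial,
    A₁ ∩ prolong h ⁻¹' A₂ ∩ S.solutionJets, A₂ ∩ prolong φ ⁻¹' A₁ ∩ (trivialSystem m).solutionJets,
    prolong φ, prolong h,
    ⟨_, hΨc.isOpen_inter_preimage hA₁o hA₂o, ⟨hxA₁, ?_⟩, rfl⟩,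
    ⟨_, hΦc.isOpen_inter_preimage hA₂o hA₁o, ⟨hyA₂, ?_⟩, rfl⟩, ?_, ?_, ⟨?_, ?_⟩, H.prolong_param,
    H.prolong_output, ?_, ?_⟩
  · rw [Set.mem_preimage, H.prolong_output]; exact hyA₂
  · rw [Set.mem_preimage, H.prolong_param]; exact hxA₁
  · rintro y ⟨⟨hy, hy'⟩, -⟩
    refine ⟨⟨hy', ?_⟩, (hA₂ y hy).2.2.1⟩
    rw [Set.mem_preimage, hΨΦ y hy]
    exact hy
  · rintro x ⟨⟨hx, hx'⟩, hxS⟩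
    refine ⟨⟨hx', ?_⟩, by rw [solutionJets_trivialSystem]; trivial⟩
    rw [Set.mem_preimage, hΦΨ x hx hxS]
    exact hx
  · exact fun y hy => hΨΦ y hy.1.1
  · exact fun x hx => hΦΨ x hx.1.1 hx.2
  · exact relatesCartan_prolong hWφ hφ fun y hy => (hA₂ y hy.1.1).1
  · exact relatesCartan_prolong hWh hh fun x hx => (hA₁ x hx.1.1).2.1

end ImplicitSystem
end

noncomputable section

/-! ### Flat systems have a strongly closed ideal -/

section RowPull

variable {n n' q : ℕ} {x₀ : Jet n} {y₀ : Jet n'}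

theorem rowEval_sub (r r' : Fin q → JetOp x₀) :
    ∀ᶠ x in 𝓝 x₀, ∀ C : Jet q, rowEval (r - r') x C = rowEval r x C - rowEval r' x C := by
  filter_upwards [rowEval_add (r - r') r'] with x hx C
  have h := hx C
  rw [sub_add_cancel] at h
  rw [h, add_sub_cancel_right]

theorem rowEval_zero_right (r : Fin q → JetOp x₀) (x : Jet n) : rowEval r x 0 = 0 := by
  simp [rowEval, Polynomial.sum_def]

theorem rowEval_one (i : Fin q) : ∀ᶠ x in 𝓝 x₀, ∀ C : Jet q,
    rowEval ((1 : Matrix (Fin q) (Fin q) (JetOp x₀)) i) x C = C 0 i := by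
  have h := rowEval_ddt_pow_single (x₀ := x₀) 0 i
  simpa using h

theorem exists_pullOp {φ : Fin n → Jet n' → ℝ} (hφ : ∀ i, AnalyticJetAt (φ i) y₀)
    (h : prolong φ y₀ = x₀) : ∃ Φs : JetOp x₀ →+* JetOp y₀, ∀ {q : ℕ} (r : Fin q → JetOp x₀),
      ∀ᶠ y in 𝓝 y₀, ∀ C : Jet q, rowEval (fun j => Φs (r j)) y C = rowEval r (prolong φ y) C := by
  have h1 : ∀ᶠ y in 𝓝 y₀, ∀ i, AnalyticJetAt (φ i) y :=
    eventually_all.2 fun i => JetAnalyticAt.eventually (hφ i)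
  exact ⟨pullOp (prolong φ) (h1.mono fun y hy => jetMapAt_prolong hy) h
    (h1.mono fun y hy => jetTangent_prolong_cartanField hy), fun r => rowEval_pullOp _ _ _ r⟩

/-- The pullback of the differential of `f` along `prolong φ` is the differential of the
composition. -/
theorem rowEval_vecMul_pull {φ : Fin n → Jet n' → ℝ} (hφ : ∀ i, AnalyticJetAt (φ i) y₀)
    (h : prolong φ y₀ = x₀) {Φs : JetOp x₀ →+* JetOp y₀}
    (hΦs : ∀ {q : ℕ} (r : Fin q → JetOp x₀), ∀ᶠ y in 𝓝 y₀, ∀ C : Jet q,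
      rowEval (fun j => Φs (r j)) y C = rowEval r (prolong φ y) C)
    {A : Matrix (Fin n) (Fin n') (JetOp y₀)}
    (hA : ∀ i, ∀ᶠ y in 𝓝 y₀, ∀ w, rowEval (A i) y w = lineDeriv ℝ (φ i) y w)
    {f : Jet n → ℝ} (hf : AnalyticJetAt f x₀) {r : Fin n → JetOp x₀}
    (hr : ∀ᶠ x in 𝓝 x₀, ∀ v, rowEval r x v = lineDeriv ℝ f x v) :
    ∀ᶠ y in 𝓝 y₀, ∀ w, rowEval (Matrix.vecMul (fun i => Φs (r i)) A) y w =
      lineDeriv ℝ (fun z => f (prolong φ z)) y w := by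
  filter_upwards [rowEval_vecMul_of_differentials hφ hA fun i => Φs (r i), hΦs r,
    eventually_comp (jetMapAt_prolong hφ) h hr,
    eventually_comp (jetMapAt_prolong hφ) h (JetAnalyticAt.eventually hf),
    eventually_all.2 fun i => JetAnalyticAt.eventually (hφ i)] with y h1 h2 h3 h4 h5 w
  rw [h1, h2, h3]
  exact (lineDeriv_comp_jet (u := f) h4 (jetMapAt_prolong h5) w).symm

end RowPull

namespace ImplicitSystem

variable {n p m : ℕ} {S : ImplicitSystem n p} {x₀ : Jet n} {y₀ : Jet m}

/-- A left multiple of P(F) is a combination of the differentials of the L_τ^k F, which vanish on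
the tangent vectors by definition. -/
theorem rowEval_vecMul_polyMatrix (hx₀ : x₀ 0 ∈ S.X) (s : Fin p → JetOp x₀) :
    ∀ᶠ x in 𝓝 x₀, ∀ v ∈ S.solutionTangent x,
      rowEval (Matrix.vecMul s (S.polyMatrix x₀ hx₀)) x v = 0 := by
  filter_upwards [rowEval_vecMul_of_differentials (fun i => analyticJetAt_eqn hx₀ i)
    (fun i => rowEval_polyMatrix hx₀ i) s, S.isOpen_stateJets.mem_nhds hx₀] with x h1 hX v hv
  have h2 : jetTangent (prolong S.eqn) x v = 0 := by
    funext k i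
    rw [jetTangent_prolong fun i => analyticJetAt_eqn hX i]
    exact hv k i
  rw [h1, h2, rowEval_zero_right]

/-- Modulo the equations, every 1-form is a combination of the derivatives of `B dx`. -/
theorem rowEval_vecMul_splitting (hx₀ : x₀ 0 ∈ S.X) {B : Matrix (Fin m) (Fin n) (JetOp x₀)}
    {G : Matrix (Fin n) (Fin m) (JetOp x₀)} {X : Matrix (Fin n) (Fin p) (JetOp x₀)}
    (hsplit : G * B + X * S.polyMatrix x₀ hx₀ = 1) (r : Fin n → JetOp x₀) :
    ∀ᶠ x in 𝓝 x₀, ∀ v ∈ S.solutionTangent x,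
      rowEval (Matrix.vecMul (Matrix.vecMul r G) B) x v = rowEval r x v := by
  have h0 : r = Matrix.vecMul (Matrix.vecMul r G) B +
      Matrix.vecMul (Matrix.vecMul r X) (S.polyMatrix x₀ hx₀) := by
    rw [Matrix.vecMul_vecMul, Matrix.vecMul_vecMul, ← Matrix.vecMul_add, hsplit, Matrix.vecMul_one]
  filter_upwards [rowEval_vecMul_polyMatrix hx₀ (Matrix.vecMul r X),
    rowEval_add (Matrix.vecMul (Matrix.vecMul r G) B)
      (Matrix.vecMul (Matrix.vecMul r X) (S.polyMatrix x₀ hx₀))] with x h1 h2 v hv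
  have h3 := h2 v
  rw [← h0, h1 v hv, add_zero] at h3
  exact h3.symm

theorem IsFlatParam.eventually_param_output {h : Fin m → Jet n → ℝ} {φ : Fin n → Jet m → ℝ}
    (H : S.IsFlatParam x₀ y₀ h φ) {O : Set (Jet n)} {ρ : Jet n → Jet n}
    (hρ : S.IsRetraction O ρ) (hO : x₀ ∈ O) :
    ∀ᶠ x in 𝓝 x₀, x ∈ S.solutionJets → prolong φ (prolong h x) = x := by
  have h1 : ∀ᶠ x in 𝓝 x₀, x ∈ O ∧ (∀ j, AnalyticJetAt (h j) x) ∧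
      (∀ i, AnalyticJetAt (φ i) (prolong h x)) ∧
      (x ∈ S.solutionJets → ∀ i, φ i (prolong h x) = x 0 i) :=
    (hρ.eventually_mem hO).and ((eventually_all.2 fun j =>
      JetAnalyticAt.eventually (H.analytic_output j)).and
      ((eventually_comp (jetMapAt_prolong H.analytic_output) H.prolong_output
        (eventually_all.2 fun i => JetAnalyticAt.eventually (H.analytic_param i))).and
        H.param_output))
  obtain ⟨W, hW, hWo, hxW⟩ := eventually_nhds_iff.1 h1
  exact Filter.mem_of_superset (hWo.mem_nhds hxW) (hρ.prolong_prolong_eq hWo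
    (fun x hx => (hW x hx).1) (fun x hx => (hW x hx).2.1) (fun x hx => (hW x hx).2.2.1)
    fun x hx => (hW x hx).2.2.2)

/-- With B dx = dh and A dy = dφ, the matrix BG₀ expresses dh through B₀ dx on the solution set. Its
pullback along φ has the inverse Φs(B₀) A, whence M is unimodular, being a pullback of that along h.
On the solution set the coefficients of M and BG₀ coincide, so MB₀ dx equals dh there. -/
theorem IsFlatParam.exists_isClosedForm {h : Fin m → Jet n → ℝ} {φ : Fin n → Jet m → ℝ}
    (H : S.IsFlatParam x₀ y₀ h φ) (hx₀ : x₀ ∈ S.solutionJets) (hreg : S.RegularAt x₀)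
    {B₀ : Matrix (Fin m) (Fin n) (JetOp x₀)} {G₀ : Matrix (Fin n) (Fin m) (JetOp x₀)}
    {X : Matrix (Fin n) (Fin p) (JetOp x₀)} (hPG : S.polyMatrix x₀ hx₀.1 * G₀ = 0)
    (hBG : B₀ * G₀ = 1) (hsplit : G₀ * B₀ + X * S.polyMatrix x₀ hx₀.1 = 1) :
    ∃ M : Matrix (Fin m) (Fin m) (JetOp x₀), IsUnit M ∧
      ∀ i, S.IsClosedForm (matForm (M * B₀) (dxForm x₀) i) := by
  obtain ⟨O, ρ, hO, hρ⟩ := exists_isRetraction hx₀ hreg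
  choose B hB using fun j => (JetFormAt.of_analytic (H.analytic_output j)).exists_row
  choose A hA using fun i => (JetFormAt.of_analytic (H.analytic_param i)).exists_row
  change Matrix (Fin m) (Fin n) (JetOp x₀) at B
  change Matrix (Fin n) (Fin m) (JetOp y₀) at A
  obtain ⟨Φs, hΦs⟩ := exists_pullOp H.analytic_param H.prolong_param
  obtain ⟨Ψs, hΨs⟩ := exists_pullOp H.analytic_output H.prolong_output
  have hΦc : ∀ {P : Jet n → Prop}, (∀ᶠ x in 𝓝 x₀, P x) → ∀ᶠ y in 𝓝 y₀, P (prolong φ y) :=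
    fun hP => eventually_comp (jetMapAt_prolong H.analytic_param) H.prolong_param hP
  have hΨc : ∀ {P : Jet m → Prop}, (∀ᶠ y in 𝓝 y₀, P y) → ∀ᶠ x in 𝓝 x₀, P (prolong h x) :=
    fun hP => eventually_comp (jetMapAt_prolong H.analytic_output) H.prolong_output hP
  -- Differential of h ∘ φ = y, an identity on an open set, hence one of operators.
  have hBA : B.map Φs * A = 1 := by
    funext j
    refine row_ext fun k l => ?_
    filter_upwards [rowEval_vecMul_pull H.analytic_param H.prolong_param hΦs hA
      (H.analytic_output j) (hB j), H.output_param.eventually_nhds,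
      rowEval_one (x₀ := y₀) j] with y h1 h2 h3
    rw [h3]
    refine (h1 _).trans ?_
    rw [lineDeriv_congr (h2.mono fun z hz => hz j), lineDeriv_coord₂]
  have hPA : (S.polyMatrix x₀ hx₀.1).map Φs * A = 0 := by
    funext j
    refine row_ext fun k l => ?_
    filter_upwards [rowEval_vecMul_pull H.analytic_param H.prolong_param hΦs hA
      (analyticJetAt_eqn hx₀.1 j) (rowEval_polyMatrix hx₀.1 j), H.mem.eventually_nhds,
      rowEval_zero (x₀ := y₀) (q := m)] with y h1 h2 h3
    refine (h1 _).trans (Eq.trans ?_ (h3 _).symm)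
    have h4 : (fun z => S.eqn j (prolong φ z)) =ᶠ[𝓝 y] fun _ => (0 : ℝ) :=
      h2.mono fun z hz => hz.2 0 j
    rw [lineDeriv_congr h4]
    simp [lineDeriv]
  -- Differential of φ ∘ h = x, valid only on tangent vectors of the solution set.
  have hAB : ∀ i, ∀ᶠ x in 𝓝 x₀, x ∈ S.solutionJets → ∀ v ∈ S.solutionTangent x,
      rowEval ((A.map Ψs * B) i) x v = v 0 i := by
    intro i
    filter_upwards [rowEval_vecMul_pull H.analytic_output H.prolong_output hΨs hB
      (H.analytic_param i) (hA i), H.param_output.eventually_nhds, hρ.eventually_mem hO,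
      JetAnalyticAt.eventually (JetMapAt.comp_jet (u := φ i)
        (by rw [H.prolong_output]; exact H.analytic_param i)
        (jetMapAt_prolong H.analytic_output))] with x h1 h2 h3 h4 hx v hv
    refine (h1 v).trans ?_
    rw [hρ.lineDeriv_eq h3 hx h4 (jetAnalyticAt_coord₂ 0 i x)
      (h2.mono fun z hz hzS => hz hzS i) hv, lineDeriv_coord₂]
  -- The prolongation of h after that of φ is the identity near y₀, so the composite pullback fixes
  -- A.
  have hAA : (A.map Ψs).map Φs = A := by
    funext i
    refine row_ext fun k l => ?_
    filter_upwards [hΦs fun j => Ψs (A i j), hΦc (hΨs (A i)),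
      H.eventually_prolong_prolong] with y h1 h2 h3
    refine (h1 _).trans ((h2 _).trans ?_)
    rw [h3]
  obtain ⟨D, hD⟩ : ∃ D : Matrix (Fin n) (Fin n) (JetOp x₀), D = A.map Ψs * B - 1 := ⟨_, rfl⟩
  -- Modulo P, the row D_i equals (DG₀)_i B₀, and D vanishes on the tangent spaces. By independence
  -- of B₀ dx the coefficients of DG₀ vanish on the solution set, into which φ maps.
  have hN : (D * G₀).map Φs = 0 := by
    funext i
    have h1 : ∀ᶠ x in 𝓝 x₀, x ∈ S.solutionJets → ∀ C : Jet m,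
        rowEval ((D * G₀) i) x C = 0 := by
      refine rowEval_eq_zero_of_vecMul hx₀ hρ hO hPG hBG ?_
      filter_upwards [rowEval_vecMul_splitting hx₀.1 hsplit (D i), hAB i,
        rowEval_sub ((A.map Ψs * B) i) ((1 : Matrix (Fin n) (Fin n) (JetOp x₀)) i),
        rowEval_one (x₀ := x₀) i] with x h2 h3 h4 h5 hx v hv
      have h6 : rowEval (D i) x v = rowEval ((A.map Ψs * B) i) x v -
          rowEval ((1 : Matrix (Fin n) (Fin n) (JetOp x₀)) i) x v := by
        rw [hD]
        exact h4 v
      refine (h2 v hv).trans ?_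
      rw [h6, h3 hx v hv, h5, sub_self]
    refine row_ext fun k l => ?_
    filter_upwards [hΦs ((D * G₀) i), hΦc h1, H.mem,
      rowEval_zero (x₀ := y₀) (q := m)] with y h2 h3 h4 h5
    exact (h2 _).trans ((h3 h4 _).trans (h5 _).symm)
  have hABG : A * (B.map Φs * G₀.map Φs) = G₀.map Φs := by
    rw [hD, Matrix.map_mul, Matrix.map_sub _ (fun a b => map_sub Φs a b), Matrix.map_mul, hAA,
      Matrix.map_one _ (map_zero _) (map_one _), Matrix.sub_mul, Matrix.one_mul,
      Matrix.mul_assoc] at hN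
    exact sub_eq_zero.1 hN
  have hGBA : G₀.map Φs * (B₀.map Φs * A) = A := by
    have h1 := congrArg (fun Z : Matrix (Fin n) (Fin n) (JetOp x₀) => Z.map Φs * A) hsplit
    simp only [Matrix.map_add _ (fun a b => map_add Φs a b), Matrix.map_mul, Matrix.add_mul,
      Matrix.map_one _ (map_zero Φs) (map_one Φs), Matrix.one_mul, Matrix.mul_assoc, hPA,
      Matrix.mul_zero, add_zero] at h1
    exact h1
  have hBG' : B₀.map Φs * G₀.map Φs = 1 := by
    rw [← Matrix.map_mul, hBG, Matrix.map_one _ (map_zero _) (map_one _)]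
  have hT : (B.map Φs * G₀.map Φs) * (B₀.map Φs * A) = 1 := by
    rw [Matrix.mul_assoc, hGBA, hBA]
  have hT' : (B₀.map Φs * A) * (B.map Φs * G₀.map Φs) = 1 := by
    rw [Matrix.mul_assoc, hABG, hBG']
  -- The passage through the free jets replaces the coefficients of BG₀ by their values at the jet
  -- φ(h(x)), which leaves them unchanged on the solution set.
  let M : Matrix (Fin m) (Fin m) (JetOp x₀) := ((B * G₀).map Φs).map Ψs
  refine ⟨M, isUnit_iff_exists.2 ⟨(B₀.map Φs * A).map Ψs, ?_, ?_⟩, fun i => ?_⟩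
  · rw [← Matrix.map_mul, Matrix.map_mul (f := Φs), hT, Matrix.map_one _ (map_zero _) (map_one _)]
  · rw [← Matrix.map_mul, Matrix.map_mul (f := Φs), hT', Matrix.map_one _ (map_zero _) (map_one _)]
  have hvan : ∀ᶠ x in 𝓝 x₀, x ∈ S.solutionJets → ∀ v ∈ S.solutionTangent x,
      rowEval ((M * B₀) i) x v - lineDeriv ℝ (h i) x v = 0 := by
    filter_upwards [rowEval_vecMul (M i) B₀, hΨs fun j => Φs ((B * G₀) i j),
      hΨc (hΦs ((B * G₀) i)), H.eventually_param_output hρ hO, rowEval_vecMul ((B * G₀) i) B₀,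
      rowEval_vecMul_splitting hx₀.1 hsplit (B i), hB i] with x h1 h2 h3 h4 h5 h6 h7 hx v hv
    rw [sub_eq_zero]
    calc rowEval ((M * B₀) i) x v = rowEval (M i) x (rowProlong B₀ x v) := h1 v
      _ = rowEval ((B * G₀) i) (prolong φ (prolong h x)) (rowProlong B₀ x v) :=
        (h2 _).trans (h3 _)
      _ = rowEval (Matrix.vecMul ((B * G₀) i) B₀) x v := by rw [h4 hx, h5]
      _ = lineDeriv ℝ (h i) x v := (h6 v hv).trans (h7 v)
  filter_upwards [extDerivForm_matForm_dx (M * B₀) i, hvan.eventually_nhds, hρ.eventually_mem hO,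
    (jetFormAt_rowEval ((M * B₀) i)).eventually, JetAnalyticAt.eventually (H.analytic_output i)]
    with x h1 h2 h3 h4 h5 hx v hv w hw
  have h6 := hρ.extD_eq_zero h3 hx (h4.sub (JetFormAt.of_analytic h5)) h2 hv hw
  rw [extD_sub h4 (JetFormAt.of_analytic h5), extD_lineDeriv h5, sub_zero] at h6
  rw [h1, h6]

end ImplicitSystem
end

noncomputable section

/-! ### Systems with a strongly closed ideal are flat -/

namespace ImplicitSystem

variable {n p m : ℕ} {S : ImplicitSystem n p} {x₀ : Jet n}

/-- A 1-form that is closed on the solution set is the differential of a function there. -/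
theorem IsRetraction.exists_primitive {O : Set (Jet n)} {ρ : Jet n → Jet n}
    (hρ : S.IsRetraction O ρ) (hO : x₀ ∈ O) (hx₀ : x₀ ∈ S.solutionJets) {e : Jet n → Jet n → ℝ}
    (he : JetFormAt e x₀) (hc : ∀ᶠ x in 𝓝 x₀, x ∈ S.solutionJets → ∀ v ∈ S.solutionTangent x,
      ∀ w ∈ S.solutionTangent x, extD e x v w = 0) :
    ∃ h : Jet n → ℝ, AnalyticJetAt h x₀ ∧ ∀ᶠ x in 𝓝 x₀, x ∈ S.solutionJets →
      ∀ v ∈ S.solutionTangent x, lineDeriv ℝ h x v = e x v := by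
  have hρ0 : ρ x₀ = x₀ := hρ.eq_self x₀ hO hx₀
  have hpull : ∀ᶠ x in 𝓝 x₀, JetFormAt e (ρ x) :=
    eventually_comp (hρ.jetMapAt x₀ hO) hρ0 he.eventually
  -- The pullback by ρ is closed on a whole neighbourhood and agrees with e on the tangent spaces of
  -- the solution set.
  obtain ⟨h, hh, hd⟩ := JetFormAt.exists_primitive
    (JetFormAt.pull (hρ.jetMapAt x₀ hO) hpull.self_of_nhds).1 (by
      filter_upwards [hpull, hρ.eventually_mem hO,
        eventually_comp (hρ.jetMapAt x₀ hO) hρ0 hc] with x h1 h2 h3 v w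
      rw [(JetFormAt.pull (hρ.jetMapAt x h2) h1).2]
      exact h3 (hρ.mem x h2) _ (hρ.jetTangent_mem h2 v) _ (hρ.jetTangent_mem h2 w))
  refine ⟨h, hh, ?_⟩
  filter_upwards [hd, hρ.eventually_mem hO] with x h1 h2 hx v hv
  rw [h1, formPull, hρ.tangent x h2 hx v hv, hρ.eq_self x h2 hx]

/-- If a row is the differential of `f` on the solution set, then its derivatives are the
differentials of the derivatives of `f` there. -/
theorem IsRetraction.rowEval_ddt_pow_mul {O : Set (Jet n)} {ρ : Jet n → Jet n}
    (hρ : S.IsRetraction O ρ) (hO : x₀ ∈ O) {f : Jet n → ℝ} (hf : AnalyticJetAt f x₀)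
    {r : Fin n → JetOp x₀} (h : ∀ᶠ x in 𝓝 x₀, x ∈ S.solutionJets → ∀ v ∈ S.solutionTangent x,
      lineDeriv ℝ f x v = rowEval r x v) (k : ℕ) :
    ∀ᶠ x in 𝓝 x₀, x ∈ S.solutionJets → ∀ v ∈ S.solutionTangent x,
      lineDeriv ℝ (cartanDeriv^[k] f) x v =
        rowEval (fun j => DiffOp.ddt _ ^ k * r j) x v := by
  induction k with
  | zero => simpa using h
  | succ k ih =>
    have h1 := rowEval_ddt_mul fun j => DiffOp.ddt (germDeriv x₀) ^ k * r j
    simp only [pow_succ', mul_assoc, Function.iterate_succ_apply']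
    filter_upwards [h1, ih.eventually_nhds, hρ.eventually_mem hO,
      JetAnalyticAt.eventually (AnalyticJetAt.cartanDeriv_iterate hf k),
      (jetFormAt_rowEval fun j => DiffOp.ddt (germDeriv x₀) ^ k * r j).eventually]
      with x h2 h3 h4 h5 h6 hx v hv
    -- The difference of the two forms vanishes on the solution set, and then so does its Lie
    -- derivative.
    rw [h2, lineDeriv_cartanDeriv h5, ← sub_eq_zero, ← formLie_sub (JetFormAt.of_analytic h5) h6]
    refine hρ.formLie_eq_zero h4 hx ((JetFormAt.of_analytic h5).sub h6) ?_ hv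
    filter_upwards [h3] with z hz hzS w hw
    rw [hz hzS w hw, sub_self]

/-- A function that vanishes along the image of the solution set under a submersion is zero. -/
theorem IsRetraction.eventually_eq_zero_of_prolong {O : Set (Jet n)} {ρ : Jet n → Jet n}
    (hρ : S.IsRetraction O ρ) (hO : x₀ ∈ O) (hx₀ : x₀ ∈ S.solutionJets) {h : Fin m → Jet n → ℝ}
    (hh : ∀ j, AnalyticJetAt (h j) x₀)
    (hs : ∀ C : Jet m, ∃ v ∈ S.solutionTangent x₀, jetTangent (prolong h) x₀ v = C)
    {a : Jet m → ℝ} (ha : AnalyticJetAt a (prolong h x₀))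
    (ha0 : ∀ᶠ x in 𝓝 x₀, x ∈ S.solutionJets → a (prolong h x) = 0) :
    ∀ᶠ y in 𝓝 (prolong h x₀), a y = 0 := by
  have hρ0 : ρ x₀ = x₀ := hρ.eq_self x₀ hO hx₀
  have hΨρ : JetMapAt (fun x => prolong h (ρ x)) x₀ :=
    JetMapAt.comp (by rw [hρ0]; exact jetMapAt_prolong hh) (hρ.jetMapAt x₀ hO)
  obtain ⟨N, α, hα, hαa⟩ := ha
  -- The function depends on N derivatives only. The corresponding truncation of h ∘ ρ is a
  -- submersion at x₀, hence open, so its values cover a neighbourhood.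
  have hsurj : Function.Surjective
      (lineDeriv ℝ (fun x => jetTrunc N (prolong h (ρ x))) x₀) := by
    intro c
    obtain ⟨v, hv, hvC⟩ := hs (jetExtend 0 N c)
    refine ⟨v, ?_⟩
    rw [lineDeriv_trunc_comp hΨρ,
      jetTangent_comp (by rw [hρ0]; exact jetMapAt_prolong hh) (hρ.jetMapAt x₀ hO),
      hρ.tangent x₀ hO hx₀ v hv, hρ0, hvC, jetTrunc_jetExtend]
  have hmap := (hΨρ.trunc N).map_nhds_eq hsurj
  simp only [hρ0] at hmap
  have h1 : ∀ᶠ ζ in 𝓝 (jetTrunc N (prolong h x₀)), α ζ = 0 := by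
    rw [← hmap, eventually_map]
    filter_upwards [eventually_comp hΨρ (congrArg (prolong h) hρ0) hαa,
      eventually_comp (hρ.jetMapAt x₀ hO) hρ0 ha0, hρ.eventually_mem hO] with x h2 h3 h4
    rw [← h2, h3 (hρ.mem x h4)]
  filter_upwards [hαa, ((continuous_jetTrunc N).tendsto _).eventually h1] with y h2 h3
  rw [h2, h3]

/-- The primitives h of the closed forms B dx are the flat output. The relation GB + XP = 1 recovers
x from h, and BG = 1 makes h and all its derivatives independent. -/
theorem exists_isFlatParam_of_isClosedForm (hx₀ : x₀ ∈ S.solutionJets) (hreg : S.RegularAt x₀)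
    {B : Matrix (Fin m) (Fin n) (JetOp x₀)} {G : Matrix (Fin n) (Fin m) (JetOp x₀)}
    {X : Matrix (Fin n) (Fin p) (JetOp x₀)} (hPG : S.polyMatrix x₀ hx₀.1 * G = 0)
    (hBG : B * G = 1) (hsplit : G * B + X * S.polyMatrix x₀ hx₀.1 = 1)
    (hc : ∀ i, S.IsClosedForm (matForm B (dxForm x₀) i)) :
    ∃ y₀ h φ, S.IsFlatParam (m := m) x₀ y₀ h φ := by
  obtain ⟨O, ρ, hO, hρ⟩ := exists_isRetraction hx₀ hreg
  have hρ0 : ρ x₀ = x₀ := hρ.eq_self x₀ hO hx₀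
  have hh : ∀ j, ∃ h : Jet n → ℝ, AnalyticJetAt h x₀ ∧ ∀ᶠ x in 𝓝 x₀, x ∈ S.solutionJets →
      ∀ v ∈ S.solutionTangent x, lineDeriv ℝ h x v = rowEval (B j) x v := by
    intro j
    refine hρ.exists_primitive hO hx₀ (jetFormAt_rowEval (B j)) ?_
    filter_upwards [hc j, extDerivForm_matForm_dx B j] with x h1 h2 hx v hv w hw
    rw [← h2, h1 hx v hv w hw]
  choose h hha hhd using hh
  have hprol : ∀ K : ℕ, ∀ᶠ x in 𝓝 x₀, x ∈ S.solutionJets → ∀ v ∈ S.solutionTangent x,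
      ∀ k < K, ∀ j, jetTangent (prolong h) x v k j = rowProlong B x v k j := by
    intro K
    filter_upwards [(eventually_all_finset (Finset.range K)).2 fun k _ => eventually_all.2 fun j =>
        hρ.rowEval_ddt_pow_mul hO (hha j) (hhd j) k,
      eventually_all.2 fun j => JetAnalyticAt.eventually (hha j)] with x h1 h2 hx v hv k hk j
    rw [jetTangent_prolong h2]
    exact h1 k (Finset.mem_range.2 hk) j hx v hv
  have hsurj : ∀ C : Jet m, ∃ v ∈ S.solutionTangent x₀, jetTangent (prolong h) x₀ v = C := by
    intro C
    obtain ⟨v, hv, hvC⟩ := exists_mem_solutionTangent hx₀.1 hPG hBG C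
    refine ⟨v, hv, ?_⟩
    rw [← hvC]
    funext k j
    exact (hprol (k + 1)).self_of_nhds hx₀ v hv k k.lt_succ_self j
  -- The number of derivatives of h needed to recover x: dx = G (B dx) modulo P.
  let K := Finset.univ.sup fun i => rowOrder (G i)
  have hker : ∀ᶠ x in 𝓝 x₀, x ∈ S.solutionJets → ∀ v ∈ S.solutionTangent x,
      jetTrunc K (jetTangent (prolong h) x v) = 0 → v 0 = 0 := by
    filter_upwards [hprol K, eventually_all.2 fun i => rowEval_vecMul (G i) B,
      eventually_all.2 fun i => rowEval_vecMul_splitting hx₀.1 hsplit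
        ((1 : Matrix (Fin n) (Fin n) (JetOp x₀)) i),
      eventually_all.2 fun i => rowEval_one (x₀ := x₀) i] with x h1 h2 h3 h4 hx v hv hv0
    funext i
    have h5 := h3 i v hv
    have h6 : Matrix.vecMul ((1 : Matrix (Fin n) (Fin n) (JetOp x₀)) i) G = G i := by
      rw [← Matrix.mul_apply_eq_vecMul, Matrix.one_mul]
    rw [h4, h6, h2] at h5
    rw [← h5, Pi.zero_apply, ← rowEval_zero_right (G i) x]
    refine rowEval_congr_right _ fun k hk j => ?_
    have hkK : k < K := hk.trans_le (Finset.le_sup (f := fun i => rowOrder (G i)) (Finset.mem_univ i))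
    rw [← h1 hx v hv k hkK j]
    exact congrFun (congrFun hv0 ⟨k, hkK⟩) j
  have hΨ : JetMapAt (prolong h) (ρ x₀) := by rw [hρ0]; exact jetMapAt_prolong hha
  have hΨρ : JetMapAt (fun x => prolong h (ρ x)) x₀ := hΨ.comp (hρ.jetMapAt x₀ hO)
  have hhρ : ∀ᶠ x in 𝓝 x₀, ∀ j, AnalyticJetAt (h j) (ρ x) :=
    eventually_comp (hρ.jetMapAt x₀ hO) hρ0
      (eventually_all.2 fun j => JetAnalyticAt.eventually (hha j))
  -- After composition with ρ, the truncated prolongation of h is a submersion at x₀ and the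
  -- differential of x vanishes on its kernel, so x is a function of it.
  obtain ⟨g, hg, hgf⟩ := (hΨρ.trunc K).exists_factor (hρ.jetMapAt x₀ hO 0) (by
      intro c
      obtain ⟨v, hv, hvC⟩ := hsurj (jetExtend 0 K c)
      refine ⟨v, ?_⟩
      rw [lineDeriv_trunc_comp hΨρ, jetTangent_comp hΨ (hρ.jetMapAt x₀ hO),
        hρ.tangent x₀ hO hx₀ v hv, hρ0, hvC, jetTrunc_jetExtend]) (by
      filter_upwards [eventually_comp (hρ.jetMapAt x₀ hO) hρ0 hker, hρ.eventually_mem hO, hhρ]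
        with x h1 h2 h3 v hv
      have h4 := jetMapAt_prolong h3
      rw [lineDeriv_trunc_comp (h4.comp (hρ.jetMapAt x h2)),
        jetTangent_comp h4 (hρ.jetMapAt x h2)] at hv
      exact h1 (hρ.mem x h2) _ (hρ.jetTangent_mem h2 v) hv)
  let φ : Fin n → Jet m → ℝ := fun i y => g (jetTrunc K y) i
  have hφ : ∀ i, AnalyticJetAt (φ i) (prolong h x₀) := by
    intro i
    refine ⟨K, fun ζ => g ζ i, ?_, EventuallyEq.rfl⟩
    have h1 : AnalyticAt ℝ g (jetTrunc K (prolong h x₀)) := by rwa [hρ0] at hg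
    exact ((ContinuousLinearMap.proj (R := ℝ) (φ := fun _ : Fin n => ℝ) i).analyticAt _).comp h1
  have hφh : ∀ᶠ x in 𝓝 x₀, x ∈ S.solutionJets → ∀ i, φ i (prolong h x) = x 0 i := by
    filter_upwards [hgf, hρ.eventually_mem hO] with x h1 h2 hx i
    rw [hρ.eq_self x h2 hx] at h1
    exact (congrFun h1 i).symm
  have hW : ∀ᶠ x in 𝓝 x₀, x ∈ O ∧ (∀ j, AnalyticJetAt (h j) x) ∧
      (∀ i, AnalyticJetAt (φ i) (prolong h x)) ∧
      (x ∈ S.solutionJets → ∀ i, φ i (prolong h x) = x 0 i) :=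
    (hρ.eventually_mem hO).and ((eventually_all.2 fun j => JetAnalyticAt.eventually (hha j)).and
      ((eventually_comp (jetMapAt_prolong hha) rfl
        (eventually_all.2 fun i => JetAnalyticAt.eventually (hφ i))).and hφh))
  obtain ⟨W, hW, hWo, hxW⟩ := eventually_nhds_iff.1 hW
  have hΦΨ : ∀ x ∈ W, x ∈ S.solutionJets → prolong φ (prolong h x) = x :=
    hρ.prolong_prolong_eq hWo (fun x hx => (hW x hx).1) (fun x hx => (hW x hx).2.1)
      (fun x hx => (hW x hx).2.2.1) fun x hx => (hW x hx).2.2.2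
  have hΦ0 : prolong φ (prolong h x₀) = x₀ := hΦΨ x₀ hxW hx₀
  have hΦ := jetMapAt_prolong hφ
  refine ⟨prolong h x₀, h, φ, hha, hφ, rfl, hΦ0, ?_, ?_, hφh⟩
  -- F(φ, φ̇) vanishes on the image of the solution set under h, hence near y₀; the higher L_τ^k F
  -- follow by differentiation.
  · have h1 : ∀ i, ∀ᶠ y in 𝓝 (prolong h x₀), S.eqn i (prolong φ y) = 0 := by
      intro i
      refine hρ.eventually_eq_zero_of_prolong hO hx₀ hha hsurj
        (JetMapAt.comp_jet (u := S.eqn i) (by rw [hΦ0]; exact analyticJetAt_eqn hx₀.1 i) hΦ) ?_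
      filter_upwards [hWo.mem_nhds hxW] with x hx hxS
      rw [hΦΨ x hx hxS]
      exact hxS.2 0 i
    have h2 : ∀ᶠ y in 𝓝 (prolong h x₀), (∀ i, S.eqn i (prolong φ y) = 0) ∧
        prolong φ y 0 ∈ S.X ∧ ∀ i, AnalyticJetAt (φ i) y :=
      (eventually_all.2 h1).and ((eventually_comp hΦ hΦ0 (S.isOpen_stateJets.mem_nhds hx₀.1)).and
        (eventually_all.2 fun i => JetAnalyticAt.eventually (hφ i)))
    obtain ⟨V, hV, hVo, hyV⟩ := eventually_nhds_iff.1 h2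
    filter_upwards [hVo.mem_nhds hyV] with y hy
    refine ⟨(hV y hy).2.1, fun k i => ?_⟩
    rw [← cartanDeriv_iterate_comp (Φ := prolong φ) (f := S.eqn i) hVo
      (fun z hz => jetMapAt_prolong (hV z hz).2.2) (fun z hz => analyticJetAt_eqn (hV z hz).2.1 i)
      (fun z hz => jetTangent_prolong_cartanField (hV z hz).2.2) k y hy]
    have h3 : (fun z => S.eqn i (prolong φ z)) =ᶠ[𝓝 y] fun _ => (0 : ℝ) :=
      Filter.mem_of_superset (hVo.mem_nhds hy) fun z hz => (hV z hz).1 i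
    rw [(cartanDeriv_iterate_congr h3 k).self_of_nhds]
    have h4 : ∀ k, cartanDeriv^[k] (fun _ : Jet m => (0 : ℝ)) = fun _ => 0 := by
      intro k
      induction k with
      | zero => rfl
      | succ k ih => rw [Function.iterate_succ_apply', ih]; funext z; simp [cartanDeriv, lineDeriv]
    rw [h4]
  · refine eventually_all.2 fun j => ?_
    have h1 := hρ.eventually_eq_zero_of_prolong hO hx₀ hha hsurj
      (a := fun y => h j (prolong φ y) - y 0 j)
      (JetAnalyticAt.sub (JetMapAt.comp_jet (u := h j) (by rw [hΦ0]; exact hha j) hΦ)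
        (jetAnalyticAt_coord₂ 0 j _)) (by
      filter_upwards [hWo.mem_nhds hxW] with x hx hxS
      rw [hΦΨ x hx hxS]
      exact sub_self _)
    exact h1.mono fun y hy => sub_eq_zero.1 hy

end ImplicitSystem

end

-- The equivalence

theorem mainTheorem1 {p m : ℕ} (S : ImplicitSystem (p + m) p) (x₀ : Jet (p + m))
    (hx₀ : x₀ ∈ S.solutionJets) (hreg : S.RegularAt x₀)
    (hP : IsHyperRegular (S.polyMatrix x₀ hx₀.1)) :
    (∃ y₀ : Jet m, S.FlatAt x₀ y₀) ↔
      ∃ U ∈ rightSmith (S.polyMatrix x₀ hx₀.1),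
        ∃ Q ∈ leftSmith (U * lowerId (JetOp x₀) p m),
          S.StronglyClosed (matForm (rectId (JetOp x₀) m (p + m) * Q) (dxForm x₀)) := by
  constructor
  · rintro ⟨y₀, hflat⟩
    obtain ⟨h, φ, H⟩ := hflat.exists_isFlatParam hreg
    obtain ⟨U, hU, Q, hQ⟩ := exists_mem_leftSmith hP
    obtain ⟨G, X, hPG, hBG, hsplit⟩ := exists_splitting hU hQ
    obtain ⟨M, hM, hc⟩ := H.exists_isClosedForm hx₀ hreg hPG hBG hsplit
    exact ⟨U, hU, Q, hQ, M, hM, fun i => by rw [← matForm_mul]; exact hc i⟩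
  · rintro ⟨U, hU, Q, hQ, M, hM, hc⟩
    obtain ⟨G, X, hPG, hBG, hsplit⟩ := exists_splitting hU hQ
    obtain ⟨M', hMM', hM'M⟩ := isUnit_iff_exists.1 hM
    obtain ⟨y₀, h, φ, H⟩ := ImplicitSystem.exists_isFlatParam_of_isClosedForm hx₀ hreg
      -- A unimodular change of the generators preserves the splitting: (GM⁻¹)(MB) = GB and
      -- (MB)(GM⁻¹) = 1.
      (B := M * (rectId (JetOp x₀) m (p + m) * Q)) (G := G * M') (X := X)
      (by rw [← Matrix.mul_assoc, hPG, Matrix.zero_mul])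
      (by
        rw [Matrix.mul_assoc, ← Matrix.mul_assoc _ G, hBG, Matrix.one_mul, hMM'])
      (by
        rw [Matrix.mul_assoc, ← Matrix.mul_assoc M', hM'M, Matrix.one_mul, hsplit])
      (fun i => by rw [matForm_mul]; exact hc i)
    exact ⟨y₀, H.flatAt hx₀ hreg⟩
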